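/- **Problem.** Let $G=(V,E)$ be a directed graph with $n=|V|$ and $m=|E|$ (no parallel edges, loops allowed), with edge weights $w:E\to\mathbb R\cup\{+\infty\}$ and initial capacities $h:V\to\mathbb R\cup\{\pm\infty\}$. An edge is *restricted* if $w(e)<+\infty$. For $v\in V$ let $d(v)$ be the maximum, over all paths ending in $v$ (including the trivial one), of $\min(h(u),w(e_1),\dots,w(e_j))$, where $u$ is the start and $e_1,\dots,e_j$ are the edges of the path. The task is to compute $d(v)$ for all $v$. **Algorithm with parameter $k$**, on input $(G,w,h)$: 1. If $G$ is not weakly connected, solve each weakly connected component recursively. 2. If there is at most one restricted edge, solve directly: delete the restricted edge, compute the strongly connected components (Tarjan), propagate maxima of $h$ in topological order; then, if there was a restricted edge $(u_0,v_0)$, raise $d(v)$ to $\min\{d(u_0),w(u_0,v_0)\}$ (if larger) for all $v$ reachable from $v_0$. 3. Otherwise let $q$ be the number of restricted edges and $l=\min\{k,q\}$; sample $l$ distinct restricted edges uniformly at random and sort their weights, $\lambda_1<\dots<\lambda_l$. Put $\lambda_0=-\infty$, $\lambda_{l+1}=+\infty$; the index $I(x)$ is the largest $i\le l$ with $\lambda_i\le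 x$. 4. Split $V$ into the levels $V_i=\{v: I(d(v))=i\}$, $0\le i\le l$, as follows. Partition a spanning tree of the underlying undirected graph into edge-disjoint subtrees with $\Theta(s)$ vertices each, $s=\min\{\lceil\log_2 l\rceil,n\}$ ($n$ the number of vertices of the current graph); their vertex sets are the groups. File each group in a bucket by the index of its maximum initial capacity. For $i=l,l-1,\dots,0$: give label $i$ to all unlabelled vertices $u$ with $h(u)\ge\lambda_i$ in the groups filed under $i$; then, as long as there is an unscanned vertex $u$ with label $i$, scan it, i.e. for every edge $(u,v)$ put $\bar w=\min\{i,I(w(u,v))\}$ (evaluating the index, by binary search, only if $w(u,v)<\lambda_i$), and if $\lambda_{\bar w}>h(v)$ and $v$ has no label or a label less than $\bar w$, let $\bar w$ be the label of $v$; then re-file every group filed under $i$ that still has unlabelled vertices by the index of the maximum initial capacity of its unlabelled vertices. The final label of a vertex is its level. 5. For every nonempty level $V_i$, solve recursively the instance on $V_i$ with the edges $(u,v)$, $u,v\in V_i$, $w(u,v)\ge\lambda_i$; their weights become $+\infty$ if $w(u,v)\ge\lambda_{i+1}$ and are kept otherwise; the new initial capacity of $v\in V_i$ is the maximum of $h(v)$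 and of all $w(u,v)$ over edges $(u,v)\in E$ with $u$ in a higher level. The running time is the number of steps on a unit-cost random access machine (array accesses, comparisons of weights, loop rounds, random integers), weights being accessible through comparisons only. **Theorem.** If $k=2^{\Omega(\sqrt{\log n})}$, the algorithm runs in $O(m\log n/\log k+m\log k)$ time with probability $1-n^{-\omega(1)}$. That is: for every $c>0$ there is a constant $C$ such that for every $a\in\mathbb R$ there is an $n_0$ such that for all $n\ge n_0$, all integers $k\ge 2^{c\sqrt{\log_2 n}}$, and all instances $(G,w,h)$ with $n$ vertices and $m$ edges in which no two restricted edges have the same weight and $n\le 2m$ (which holds if no vertex is isolated), the algorithm halts after at most $$C\left(\frac{m\log_2 n}{\log_2 k}+m\log_2 k\right)$$ steps with probability at least $1-n^{-a}$. -/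

import Mathlib

/-!
Timed comparison-based computations, and the recursive algorithm for single-source bottleneck paths
in its multiple-source form with initial capacities: given a digraph with edge weights in
`ℝ ∪ {+∞}` and initial capacities `h v`, compute for every vertex `v` the largest value of
`min (h u, weights along the path)` over all paths that end in `v` (`u` is the start of the path).
-/

namespace Bottleneck

section Model

/-! ### The cost model

A unit-cost random access machine. Programs are built from the charged primitives below: array
access, comparison of two weights, one round of a loop, one random integer. Between two charged
primitives a program only does a number of register operations (branching, arithmetic on integers
of size polynomial in the input, `cons` and pattern matching on linked lists) that is bounded by a
constant fixed by the program text. -/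

/-- A result together with the number of elementary steps; the cost `⊤` means `no termination`. -/
structure Step (α : Type) where
  val : α
  cost : ℕ∞

instance : Monad Step where
  pure a := ⟨a, 0⟩
  bind x f := ⟨(f x.val).val, x.cost + (f x.val).cost⟩

/-- A randomized computation: the joint law of its result and of its number of steps. -/
def Rand (α : Type) : Type := PMF (Step α)

noncomputable instance : Monad Rand where
  pure a := PMF.pure ⟨a, 0⟩
  bind x f := PMF.bind x fun s =>
    PMF.map (fun t => (⟨t.val, s.cost + t.cost⟩ : Step _)) (f s.val)

noncomputable instance : MonadLift Step Rand where
  monadLift x := PMF.pure x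

/-- The probability that a randomized computation halts after at most `T` steps. -/
noncomputable def Rand.probTimeLE {α : Type} (x : Rand α) (T : ℝ) : ℝ :=
  (PMF.toOuterMeasure x {s | ∃ t : ℕ, s.cost = t ∧ (t : ℝ) ≤ T}).toReal

variable {ι α σ W : Type}

/-- One elementary step. -/
def tick : Step Unit := ⟨(), 1⟩

/-- The outcome of a loop whose termination counter ran out: it is charged infinitely many steps.
(All counters below exist only to make the loops total functions; they are not part of the
computation.) -/
def diverge (a : α) : Step α := ⟨a, ⊤⟩

/-- Arrays. -/
abbrev Arr (ι α : Type) : Type := ι → α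

/-- Memory without usable content; programs write to a cell before they read it. -/
def alloc [Inhabited α] : Arr ι α := fun _ => default

def readAt (a : Arr ι α) (i : ι) : Step α := ⟨a i, 1⟩

def writeAt [DecidableEq ι] (a : Arr ι α) (i : ι) (x : α) : Step (Arr ι α) :=
  ⟨Function.update a i x, 1⟩

/-- Comparison of two weights, the only operation on weights besides copying. -/
def leq [LinearOrder W] (x y : W) : Step Bool := ⟨decide (x ≤ y), 1⟩

def maxOf [LinearOrder W] (x y : W) : Step W := do
  if ← leq x y then pure y else pure x

def minOf [LinearOrder W] (x y : W) : Step W := do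
  if ← leq x y then pure x else pure y

/-- The loop `for x in xs do s := f x s`. -/
def forEach : List α → σ → (α → σ → Step σ) → Step σ
  | [], s, _ => do
    tick
    pure s
  | x :: xs, s, f => do
    tick
    let s ← f x s
    forEach xs s f

/-- The same loop with a randomized body. -/
noncomputable def forEachRand : List α → σ → (α → σ → Rand σ) → Rand σ
  | [], s, _ => do
    tick
    pure s
  | x :: xs, s, f => do
    tick
    let s ← f x s
    forEachRand xs s f

/-- Write `x` into all cells `i` of the list `is`. -/
def fill [DecidableEq ι] (is : List ι) (x : α) (a : Arr ι α) : Step (Arr ι α) :=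
  forEach is a fun i a => writeAt a i x

def count (xs : List α) : Step ℕ := forEach xs 0 fun _ c => pure (c + 1)

/-- `⌈log₂ l⌉`, computed by repeated doubling. -/
def ceilLog (l : ℕ) : Step ℕ := ⟨Nat.clog 2 l, Nat.clog 2 l + 1⟩

/-- A uniformly random element of `{0, …, q}`. -/
noncomputable def randUpTo (q : ℕ) : Rand ℕ :=
  PMF.map (fun j : Fin (q + 1) => (⟨j, 1⟩ : Step ℕ)) (PMF.uniformOfFintype (Fin (q + 1)))

/-- A uniformly random `l`-element selection from a list of length `q ≥ l`, by selection sampling: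
an entry is taken with probability (entries still wanted) / (entries still left). -/
noncomputable def sample : List α → ℕ → ℕ → Rand (List α)
  | [], _, _ => do
    tick
    pure []
  | x :: xs, q, l => do
    let j ← randUpTo (q - 1)
    if j < l then
      let ys ← sample xs (q - 1) (l - 1)
      pure (x :: ys)
    else
      sample xs (q - 1) l

end Model

section Sorting

variable {W : Type} [LinearOrder W]

def merge : List W → List W → Step (List W)
  | [], ys => do
    tick
    pure ys
  | x :: xs, [] => do
    tick
    pure (x :: xs)
  | x :: xs, y :: ys => do
    if ← leq x y then
      let zs ← merge xs (y :: ys)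
      pure (x :: zs)
    else
      let zs ← merge (x :: xs) ys
      pure (y :: zs)
  termination_by xs ys => xs.length + ys.length

/-- Merge sort; the first argument is a termination counter. -/
def mergeSort : ℕ → List W → Step (List W)
  | 0, xs => diverge xs
  | _ + 1, [] => do
    tick
    pure []
  | _ + 1, [x] => do
    tick
    pure [x]
  | f + 1, x :: y :: xs => do
    let p ← forEach (x :: y :: xs) (([], []) : List W × List W) fun z p => pure (z :: p.2, p.1)
    let a ← mergeSort f p.1
    let b ← mergeSort f p.2
    merge a b

/-- The index of `x`: the largest `i ≤ l` with `lam i ≤ x`, by binary search in the interval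
`[lo, hi)`; the first argument is a termination counter. -/
def locate (lam : Arr ℕ W) (x : W) : ℕ → ℕ → ℕ → Step ℕ
  | 0, lo, _ => diverge lo
  | f + 1, lo, hi =>
    if hi ≤ lo + 1 then do
      tick
      pure lo
    else do
      let y ← readAt lam ((lo + hi) / 2)
      if ← leq y x then locate lam x f ((lo + hi) / 2) hi
      else locate lam x f lo ((lo + hi) / 2)

def index (lam : Arr ℕ W) (l : ℕ) (x : W) : Step ℕ := locate lam x (l + 2) 0 (l + 1)

/-- The array of thresholds `lam 0 = ⊥`, `lam 1 < ⋯ < lam l`, `lam (l + 1) = ⊤`, from the sorted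
list of the inner ones. -/
def thresholds [BoundedOrder W] (l : ℕ) (xs : List W) : Step (Arr ℕ W) := do
  let a ← writeAt (@alloc ℕ W ⟨⊥⟩) 0 ⊥
  let p ← forEach xs (a, 1) fun x p => do
    let a ← writeAt p.1 p.2 x
    pure (a, p.2 + 1)
  writeAt p.1 (l + 1) ⊤

end Sorting

section Graphs

/-- A directed edge with its weight. -/
structure Edge (V W : Type) where
  src : V
  dst : V
  wt : W

variable {V W : Type} [DecidableEq V]

/-! ### Searching a graph

A graph is given by the list `vs` of its vertices and the list `es` of its edges. -/

/-- Adjacency lists of the underlying undirected graph. -/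
def neighbours (vs : List V) (es : List (Edge V W)) : Step (Arr V (List V)) := do
  let a ← fill vs [] alloc
  forEach es a fun e a => do
    let xs ← readAt a e.src
    let a ← writeAt a e.src (e.dst :: xs)
    let ys ← readAt a e.dst
    writeAt a e.dst (e.src :: ys)

/-- Lists of out-neighbours. -/
def successors (vs : List V) (es : List (Edge V W)) : Step (Arr V (List V)) := do
  let a ← fill vs [] alloc
  forEach es a fun e a => do
    let xs ← readAt a e.src
    writeAt a e.src (e.dst :: xs)

/-- Lists of outgoing edges. -/
def outEdges (vs : List V) (es : List (Edge V W)) : Step (Arr V (List (Edge V W))) := do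
  let a ← fill vs [] alloc
  forEach es a fun e a => do
    let xs ← readAt a e.src
    writeAt a e.src (e :: xs)

/-- Graph search with a stack of pairs (vertex to visit, vertex from which it was reached). The
state holds the marks of the visited vertices and the list of the vertices found so far, last one
first, each with its parent in the search tree. The first argument is a termination counter. -/
def explore (adj : Arr V (List V)) : ℕ → List (V × Option V) →
    Arr V Bool × List (V × Option V) → Step (Arr V Bool × List (V × Option V))
  | 0, _, s => diverge s
  | _ + 1, [], s => do
    tick
    pure s
  | f + 1, (v, p) :: st, s => do
    if ← readAt s.1 v then
      explore adj f st s
    else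
      let seen ← writeAt s.1 v true
      let us ← readAt adj v
      let st ← forEach us st fun u st => pure ((u, some v) :: st)
      explore adj f st (seen, (v, p) :: s.2)

/-- The weakly connected components, each one given by a spanning tree of it: the list of its
vertices with their parents, in which every vertex stands before its parent and the root is last. -/
def components (vs : List V) (es : List (Edge V W)) : Step (List (List (V × Option V))) := do
  let adj ← neighbours vs es
  let seen ← fill vs false alloc
  let s ← forEach vs (seen, ([] : List (List (V × Option V)))) fun v s => do
    if ← readAt s.1 v then
      pure s
    else
      let t ← explore adj (2 * es.length + 2) [(v, none)] (s.1, [])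
      pure (t.1, t.2 :: s.2)
  pure s.2

/-- Given a number `key v < c` for every vertex `v`, and edges that join vertices with equal keys
only: the graphs formed by the vertices with key `0, …, c - 1`, except those without vertices. -/
def gather (c : ℕ) (key : Arr V ℕ) (vs : List V) (es : List (Edge V W)) :
    Step (List (List V × List (Edge V W))) := do
  let vb ← fill (List.range c) [] alloc
  let eb ← fill (List.range c) [] alloc
  let vb ← forEach vs vb fun v b => do
    let i ← readAt key v
    let xs ← readAt b i
    writeAt b i (v :: xs)
  let eb ← forEach es eb fun e b => do
    let i ← readAt key e.src
    let xs ← readAt b i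
    writeAt b i (e :: xs)
  forEach (List.range c) [] fun i gs => do
    let xs ← readAt vb i
    let ys ← readAt eb i
    match xs with
    | [] => pure gs
    | x :: xs => pure ((x :: xs, ys) :: gs)

/-- The weakly connected components as graphs of their own. -/
def componentGraphs (comps : List (List (V × Option V))) (vs : List V) (es : List (Edge V W)) :
    Step (List (List V × List (Edge V W))) := do
  let p ← forEach comps ((alloc, 0) : Arr V ℕ × ℕ) fun comp p => do
    let key ← forEach comp p.1 fun x key => writeAt key x.1 p.2
    pure (key, p.2 + 1)
  gather p.2 p.1 vs es

/-! ### Partition of a tree into edge-disjoint subtrees -/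

/-- Sequences with concatenation in constant time. -/
inductive Rope (α : Type) : Type where
  | nil : Rope α
  | one : α → Rope α
  | join : Rope α → Rope α → Rope α

instance {α : Type} : Inhabited (Rope α) := ⟨Rope.nil⟩

/-- `r.flatten xs` is the list of the entries of `r`, followed by `xs`. -/
def Rope.flatten {α : Type} : Rope α → List α → Step (List α)
  | .nil, xs => do
    tick
    pure xs
  | .one x, xs => do
    tick
    pure (x :: xs)
  | .join a b, xs => do
    tick
    let xs ← b.flatten xs
    a.flatten xs

/-- Partition of a spanning tree, given as in `components`, into edge-disjoint subtrees, of which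
the vertex sets are returned. Every vertex `v` has a set `U v`, initially `{v}`, with its size. When
a vertex is treated, its set is added to the one of its parent `p`; if this has at least `s` elements
now, it is reported as a group, and `U p` becomes `{p}` again. The set of the root is added to the
last group in the end, or is the only group. -/
def partitionTree (s : ℕ) (tree : List (V × Option V)) : Step (List (List V)) := do
  let U ← forEach tree (alloc : Arr V (Rope V × ℕ)) fun x U => writeAt U x.1 (.one x.1, 1)
  let r ← forEach tree (U, ([] : List (List V))) fun x r => do
    let a ← readAt r.1 x.1
    match x.2 with
    | some p =>
      let b ← readAt r.1 p
      if s ≤ b.2 + a.2 then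
        let group ← (Rope.join b.1 a.1).flatten []
        let U ← writeAt r.1 p (.one p, 1)
        pure (U, group :: r.2)
      else
        let U ← writeAt r.1 p (.join b.1 a.1, b.2 + a.2)
        pure (U, r.2)
    | none =>
      match r.2 with
      | [] =>
        let group ← a.1.flatten []
        pure (r.1, [group])
      | g :: gs =>
        let group ← a.1.flatten g
        pure (r.1, group :: gs)
  pure r.2

/-! ### Strongly connected components -/

/-- The state of Tarjan's algorithm. -/
structure SccState (V : Type) where
  next : ℕ
  num : Arr V (Option ℕ)
  low : Arr V ℕ
  onStack : Arr V Bool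
  stack : List V
  comps : List (List V)

/-- Pop the stack down to `v`, inclusively. -/
def popTo (v : V) : List V → List V → Arr V Bool → Step (List V × List V × Arr V Bool)
  | [], comp, on => do
    tick
    pure ([], comp, on)
  | u :: st, comp, on => do
    let on ← writeAt on u false
    if u = v then pure (st, u :: comp, on) else popTo v st (u :: comp) on

/-- Depth-first search from `v`; the first numerical argument is a termination counter. -/
def visit (adj : Arr V (List V)) : ℕ → V → SccState V → Step (SccState V)
  | 0, _, S => diverge S
  | f + 1, v, S => do
    let c := S.next
    let num ← writeAt S.num v (some c)
    let low ← writeAt S.low v c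
    let on ← writeAt S.onStack v true
    let us ← readAt adj v
    let S ← forEach us (⟨c + 1, num, low, on, v :: S.stack, S.comps⟩ : SccState V) fun u S => do
      match ← readAt S.num u with
      | none =>
        let S ← visit adj f u S
        let a ← readAt S.low v
        let b ← readAt S.low u
        let low ← writeAt S.low v (min a b)
        pure { S with low := low }
      | some b =>
        if ← readAt S.onStack u then
          let a ← readAt S.low v
          let low ← writeAt S.low v (min a b)
          pure { S with low := low }
        else
          pure S
    if (← readAt S.low v) = c then
      let r ← popTo v S.stack [] S.onStack
      pure { S with stack := r.1, comps := r.2.1 :: S.comps, onStack := r.2.2 }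
    else
      pure S

/-- The strongly connected components in topological order (edges lead from earlier ones to later
ones). -/
def strongComponents (vs : List V) (adj : Arr V (List V)) : Step (List (List V)) := do
  let num ← fill vs none alloc
  let on ← fill vs false alloc
  let S ← forEach vs (⟨0, num, alloc, on, [], []⟩ : SccState V) fun v S => do
    match ← readAt S.num v with
    | none => visit adj (vs.length + 1) v S
    | some _ => pure S
  pure S.comps

end Graphs

section Algorithm

variable {V W : Type} [DecidableEq V] [LinearOrder W] [BoundedOrder W]

/-! ### At most one restricted edge

An edge is unrestricted if its weight is `⊤`, and restricted otherwise. All procedures that compute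
the bottleneck values `d` receive the array `h` and return it with `h v` replaced by `d v`. -/

/-- The lists of the restricted and of the unrestricted edges. -/
def classify (es : List (Edge V W)) : Step (List (Edge V W) × List (Edge V W)) :=
  forEach es ([], []) fun e p => do
    if ← leq ⊤ e.wt then pure (p.1, e :: p.2) else pure (e :: p.1, p.2)

/-- All edges unrestricted: contract the strongly connected components, and treat them in
topological order. -/
def solveUnrestricted (vs : List V) (es : List (Edge V W)) (h : Arr V W) : Step (Arr V W) := do
  let adj ← successors vs es
  let comps ← strongComponents vs adj
  forEach comps h fun comp h => do
    let best ← forEach comp ⊥ fun v b => do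
      let x ← readAt h v
      maxOf b x
    forEach comp h fun v h => do
      let h ← writeAt h v best
      let us ← readAt adj v
      forEach us h fun u h => do
        let x ← readAt h u
        let y ← maxOf x best
        writeAt h u y

/-- At most one restricted edge `e`: treat the paths without `e` first, and improve then the values
of the vertices that can be reached from the head of `e`. -/
def solveBase (vs : List V) (es : List (Edge V W)) (h : Arr V W) : Step (Arr V W) := do
  let p ← classify es
  let d ← solveUnrestricted vs p.2 h
  match p.1 with
  | [] => pure d
  | e :: _ =>
    let x ← readAt d e.src
    let t ← minOf x e.wt
    let adj ← successors vs es
    let seen ← fill vs false alloc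
    let s ← explore adj (2 * es.length + 2) [(e.dst, none)] (seen, [])
    forEach s.2 d fun v d => do
      let y ← readAt d v.1
      let z ← maxOf y t
      writeAt d v.1 z

/-! ### The split algorithm -/

/-- The state of the split algorithm: the labels `d'` (`none` if the label does not exist yet), the
buckets of groups, and the buckets of active vertices. A vertex is deleted from the groups that
contain it as soon as its label exists; an entry `u` of the `i`-th bucket of active vertices is
deleted as soon as the label of `u` is no longer `i`. Such entries are skipped when they are met. -/
structure SplitState (V : Type) where
  lab : Arr V (Option ℕ)
  B : Arr ℕ (List (List V))
  C : Arr ℕ (List V)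

/-- A vertex with maximal `h` among those of the group `U` which have no label, if any. -/
def groupMax (h : Arr V W) (lab : Arr V (Option ℕ)) (U : List V) : Step (Option V) :=
  forEach U none fun u best => do
    match ← readAt lab u with
    | some _ => pure best
    | none =>
      match best with
      | none => pure (some u)
      | some b =>
        let x ← readAt h b
        let y ← readAt h u
        if ← leq x y then pure (some u) else pure (some b)

/-- Put a group into the bucket given by the index of its maximum, unless the group is empty. -/
def fileGroup (h : Arr V W) (lam : Arr ℕ W) (l : ℕ) (U : List V) (S : SplitState V) :
    Step (SplitState V) := do
  match ← groupMax h S.lab U with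
  | none => pure S
  | some u =>
    let x ← readAt h u
    let i ← index lam l x
    let Us ← readAt S.B i
    let B ← writeAt S.B i (U :: Us)
    pure { S with B := B }

/-- Give `v` the label `i`, and make it active. -/
def activate (i : ℕ) (v : V) (S : SplitState V) : Step (SplitState V) := do
  let lab ← writeAt S.lab v (some i)
  let us ← readAt S.C i
  let C ← writeAt S.C i (v :: us)
  pure { S with lab := lab, C := C }

/-- Activate the vertices `u` with `lam i ≤ h u` of the groups in the `i`-th bucket. -/
def release (h : Arr V W) (lam : Arr ℕ W) (i : ℕ) (S : SplitState V) : Step (SplitState V) := do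
  let Us ← readAt S.B i
  let y ← readAt lam i
  forEach Us S fun U S =>
    forEach U S fun u S => do
      match ← readAt S.lab u with
      | some _ => pure S
      | none =>
        let x ← readAt h u
        if ← leq y x then activate i u S else pure S

/-- Treat an edge whose tail is scanned with the label `i`. The index of its weight is evaluated only
if this is less than `i`. -/
def relax (h : Arr V W) (lam : Arr ℕ W) (l i : ℕ) (e : Edge V W) (S : SplitState V) :
    Step (SplitState V) := do
  let y ← readAt lam i
  let j ← (do if ← leq y e.wt then pure i else index lam l e.wt : Step ℕ)
  let z ← readAt lam j
  let x ← readAt h e.dst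
  if ← leq z x then
    pure S
  else
    match ← readAt S.lab e.dst with
    | none => activate j e.dst S
    | some j' => if j' < j then activate j e.dst S else pure S

/-- Scan active vertices with label `i` until there are none; the first argument after the data is
a termination counter. -/
def drain (out : Arr V (List (Edge V W))) (h : Arr V W) (lam : Arr ℕ W) (l i : ℕ) :
    ℕ → SplitState V → Step (SplitState V)
  | 0, S => diverge S
  | f + 1, S => do
    match ← readAt S.C i with
    | [] => pure S
    | u :: us =>
      let C ← writeAt S.C i us
      let S : SplitState V := { S with C := C }
      if (← readAt S.lab u) = some i then
        let es ← readAt out u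
        let S ← forEach es S fun e S => relax h lam l i e S
        drain out h lam l i f S
      else
        drain out h lam l i f S

/-- The main loop of the split algorithm, for the labels `i - 1, …, 0`. -/
def sweep (n : ℕ) (out : Arr V (List (Edge V W))) (h : Arr V W) (lam : Arr ℕ W) (l : ℕ) :
    ℕ → SplitState V → Step (SplitState V)
  | 0, S => do
    tick
    pure S
  | i + 1, S => do
    let S ← release h lam i S
    let S ← drain out h lam l i (n + 1) S
    let Us ← readAt S.B i
    let S ← forEach Us S fun U S => fileGroup h lam l U S
    sweep n out h lam l i S

/-- The split algorithm for a weakly connected graph with a spanning tree as in `components`: it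
computes the level of every vertex `v`, the index `i` with `lam i ≤ d v < lam (i + 1)` (index `l`
for `d v = ⊤`). -/
def split (vs : List V) (es : List (Edge V W)) (h : Arr V W) (lam : Arr ℕ W) (l : ℕ)
    (tree : List (V × Option V)) : Step (Arr V ℕ) := do
  let n ← count vs
  let s ← ceilLog l
  let groups ← partitionTree (min s n) tree
  let out ← outEdges vs es
  let lab ← fill vs none alloc
  let B ← fill (List.range (l + 1)) [] alloc
  let C ← fill (List.range (l + 1)) [] alloc
  let S ← forEach groups (⟨lab, B, C⟩ : SplitState V) fun U S => fileGroup h lam l U S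
  let S ← sweep n out h lam l (l + 1) S
  forEach vs alloc fun v level => do
    let i ← readAt S.lab v
    writeAt level v (i.getD 0)

/-! ### The main algorithm -/

/-- The instances for the levels. Edges within a level `i` of weight less than `lam i` are dropped,
and those of weight at least `lam (i + 1)` become unrestricted. Edges `(u, v)` between different
levels are dropped; if the level of `u` is higher, then `h v` is raised to the weight of the edge. -/
def reduce (vs : List V) (es : List (Edge V W)) (h : Arr V W) (lam : Arr ℕ W) (l : ℕ)
    (level : Arr V ℕ) : Step (Arr V W × List (List V × List (Edge V W))) := do
  let p ← forEach es (h, ([] : List (Edge V W))) fun e p => do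
    let i ← readAt level e.src
    let j ← readAt level e.dst
    if i = j then
      let a ← readAt lam i
      let b ← readAt lam (i + 1)
      if ← leq a e.wt then
        if ← leq b e.wt then
          pure (p.1, (⟨e.src, e.dst, ⊤⟩ : Edge V W) :: p.2)
        else
          pure (p.1, e :: p.2)
      else
        pure p
    else if j < i then
      let x ← readAt p.1 e.dst
      let y ← maxOf x e.wt
      let h ← writeAt p.1 e.dst y
      pure (h, p.2)
    else
      pure p
  let Gs ← gather (l + 1) level vs p.2
  pure (p.1, Gs)

/-- The recursive algorithm with parameter `k`; its first numerical argument after `k` is a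
termination counter. -/
noncomputable def solve (k : ℕ) : ℕ → List V → List (Edge V W) → Arr V W → Rand (Arr V W)
  | 0, _, _, h => diverge h
  | f + 1, vs, es, h => do
    let comps ← components vs es
    match comps with
    | [tree] =>
      let p ← classify es
      let q ← count p.1
      if q ≤ 1 then
        solveBase vs es h
      else
        let l := min k q
        let sampled ← sample p.1 q l
        let ws ← forEach sampled [] fun e ws => pure (e.wt :: ws)
        let ws ← mergeSort (l + 1) ws
        let lam ← thresholds l ws
        let level ← split vs es h lam l tree
        let r ← reduce vs es h lam l level
        forEachRand r.2 r.1 fun G h => solve k f G.1 G.2 h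
    | comps =>
      let Gs ← componentGraphs comps vs es
      forEachRand Gs h fun G h => solve k f G.1 G.2 h

/-- The algorithm on the graph with the vertices `0, …, n - 1` and the given edges. (For `k ≥ 2` the
recursion depth is less than the value of the termination counter.) -/
noncomputable def mainAlgorithm (k n : ℕ) (es : List (Edge (Fin n) W)) (h : Fin n → W) :
    Rand (Arr (Fin n) W) :=
  solve k (2 * es.length + 3) (List.finRange n) es h

end Algorithm

end Bottleneck

/-! Put `ρ = ⌊√k⌋`. If an interval of weights contains at least a fraction `1/ρ` of the `q > k`
restricted edges, then `k` samples miss it with probability at most `exp (-ρ)`. Only about `q²`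
intervals, with endpoints among `⊥` and the weights, matter. So, outside a rare event, no level
inherits more than `⌈q/ρ⌉` restricted edges, and at most one if all edges are sampled
(`toOuterMeasure_sample_not_isDense`, `IsDense.length_filter_le`). Since `q ≤ n² ≤ ρ ^ J` for some
`J = O(log n / log k)`, `J` rounds leave at most one restricted edge. The instances of one round are
disjoint, so linear work per round gives the term `m log n / log k`.

Two costs of a round are not linear. Sorting `l` samples takes `l log l` steps. This is at most `q`
as long as `q > kρ`, because `log k ≤ ρ`, and beyond that at most two more rounds sort, each paid by
`q log k` (`sorting_le`).

The other cost is the split, which takes `O(n + m + l)` steps plus `O(log l)` for every edge that is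
cut, that is, dropped from the level instances (`spec_split`). A cut edge never returns, so over the
whole recursion these extra costs sum to `O(m log k)`. Binary searches occur in two places. For an
edge weight, a search is made only if the weight is below the threshold of the tail's level, and
such an edge is cut. For a group, filing costs `O(log l)`. At first there are only `O(n / log l)`
groups, or at most two. Whenever a group is filed again, the number of levels of its vertices that
lie below its bucket has dropped. Summed over the groups, the surplus of levels over one is at most
one more than the number of tree edges between different levels, and these edges are cut as well.

`budget` combines these charges, and `fails_solve` carries it through the recursion together with
the failure probability. With `m ≤ n²` edges and `J ≤ n` rounds the latter is at most `n ^ 9 * exp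
(-ρ)`; it falls below `n ^ (-a)` since `ρ` exceeds every multiple of `log n`. The correctness of the
computed values is never used: a level is whatever label a vertex ends with, and the time bounds
hold for arbitrary capacities. -/

namespace Bottleneck

/-! ### Hoare triples that record the number of steps -/

section Triples

variable {ι α β σ W : Type}

/-- The computation halts, and its result and its number of steps satisfy `Q`. -/
def Step.Spec (x : Step α) (Q : α → ℕ → Prop) : Prop := ∃ t : ℕ, x.cost = t ∧ Q x.val t

namespace Step

theorem Spec.mono {x : Step α} {Q R : α → ℕ → Prop} (hx : x.Spec Q) (h : ∀ a t, Q a t → R a t) :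
    x.Spec R := by
  obtain ⟨t, ht, hq⟩ := hx
  exact ⟨t, ht, h _ _ hq⟩

theorem spec_bind {x : Step α} {f : α → Step β} {Q : α → ℕ → Prop} {R : β → ℕ → Prop}
    (hx : x.Spec Q) (hf : ∀ a t, Q a t → (f a).Spec fun b u => R b (t + u)) :
    (x >>= f).Spec R := by
  obtain ⟨t, ht, hq⟩ := hx
  obtain ⟨u, hu, hr⟩ := hf _ _ hq
  refine ⟨t + u, ?_, hr⟩
  change x.cost + (f x.val).cost = _
  rw [ht, hu]
  push_cast
  rfl

/-- An equivalence and not merely an implication, so that its instances for the primitives serve as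
`simp` rules that execute straight-line code. Finiteness of the total cost gives finiteness of the
rest. -/
theorem spec_bind_one {x : Step α} {f : α → Step β} {R : β → ℕ → Prop} (hx : x.cost = 1) :
    (x >>= f).Spec R ↔ (f x.val).Spec fun b t => R b (t + 1) := by
  constructor
  · rintro ⟨t, ht, hr⟩
    replace ht : x.cost + (f x.val).cost = t := ht
    rw [hx] at ht
    have hne : (f x.val).cost ≠ ⊤ := by
      intro h
      rw [h] at ht
      simp at ht
    obtain ⟨u, hu⟩ := ENat.ne_top_iff_exists.mp hne
    rw [← hu] at ht
    obtain rfl : 1 + u = t := by exact_mod_cast ht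
    refine ⟨u, hu.symm, ?_⟩
    rw [add_comm] at hr
    exact hr
  · rintro ⟨t, ht, hr⟩
    refine ⟨t + 1, ?_, hr⟩
    change x.cost + (f x.val).cost = _
    rw [ht, hx, add_comm]
    push_cast
    rfl

@[simp] theorem spec_pure {a : α} {Q : α → ℕ → Prop} : (pure a : Step α).Spec Q ↔ Q a 0 := by
  constructor
  · rintro ⟨t, ht, hq⟩
    obtain rfl : t = 0 := by
      have : (0 : ℕ∞) = t := ht
      exact_mod_cast this.symm
    exact hq
  · exact fun h => ⟨0, rfl, h⟩

@[simp] theorem bind_pure {x : Step α} : (x >>= fun a => pure a) = x := by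
  change (⟨x.val, x.cost + 0⟩ : Step α) = x
  rw [add_zero]

theorem spec_one {a : α} {Q : α → ℕ → Prop} : (⟨a, 1⟩ : Step α).Spec Q ↔ Q a 1 := by
  constructor
  · rintro ⟨t, ht, hq⟩
    obtain rfl : t = 1 := by
      have : (1 : ℕ∞) = t := ht
      exact_mod_cast this.symm
    exact hq
  · exact fun h => ⟨1, rfl, h⟩

@[simp] theorem spec_tick_bind {f : Unit → Step β} {R : β → ℕ → Prop} :
    (tick >>= f).Spec R ↔ (f ()).Spec fun b t => R b (t + 1) := spec_bind_one rfl

@[simp] theorem spec_readAt_bind {a : Arr ι α} {i : ι} {f : α → Step β} {R : β → ℕ → Prop} :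
    (readAt a i >>= f).Spec R ↔ (f (a i)).Spec fun b t => R b (t + 1) := spec_bind_one rfl

@[simp] theorem spec_writeAt_bind [DecidableEq ι] {a : Arr ι α} {i : ι} {x : α}
    {f : Arr ι α → Step β} {R : β → ℕ → Prop} :
    (writeAt a i x >>= f).Spec R ↔ (f (Function.update a i x)).Spec fun b t => R b (t + 1) :=
  spec_bind_one rfl

@[simp] theorem spec_leq_bind [LinearOrder W] {x y : W} {f : Bool → Step β} {R : β → ℕ → Prop} :
    (leq x y >>= f).Spec R ↔ (f (decide (x ≤ y))).Spec fun b t => R b (t + 1) :=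
  spec_bind_one rfl

@[simp] theorem spec_writeAt [DecidableEq ι] {a : Arr ι α} {i : ι} {x : α}
    {R : Arr ι α → ℕ → Prop} : (writeAt a i x).Spec R ↔ R (Function.update a i x) 1 := spec_one

@[simp] theorem spec_forEach_nil {s : σ} {f : α → σ → Step σ} {R : σ → ℕ → Prop} :
    (forEach [] s f).Spec R ↔ R s 1 := by
  simp [forEach]

theorem spec_forEach_cons {x : α} {xs : List α} {s : σ} {f : α → σ → Step σ}
    {R : σ → ℕ → Prop} :
    (forEach (x :: xs) s f).Spec R ↔
      (f x s >>= fun s => forEach xs s f).Spec fun b t => R b (t + 1) := by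
  simp [forEach]

@[simp] theorem spec_maxOf_bind [LinearOrder W] {x y : W} {f : W → Step β} {R : β → ℕ → Prop} :
    (maxOf x y >>= f).Spec R ↔ (f (max x y)).Spec fun b t => R b (t + 1) := by
  have h : maxOf x y = ⟨max x y, 1⟩ := by
    unfold maxOf
    change (⟨((if decide (x ≤ y) = true then pure y else pure x : Step W)).val,
      1 + ((if decide (x ≤ y) = true then pure y else pure x : Step W)).cost⟩ : Step W) = _
    by_cases hxy : x ≤ y
    · simp only [hxy, decide_true, if_true, max_eq_right]
      rfl
    · simp only [hxy, decide_false, max_eq_left (le_of_not_ge hxy)]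
      rfl
  rw [h]
  exact spec_bind_one rfl

@[simp] theorem spec_maxOf [LinearOrder W] {x y : W} {R : W → ℕ → Prop} :
    (maxOf x y).Spec R ↔ R (max x y) 1 := by
  rw [← bind_pure (x := maxOf x y), spec_maxOf_bind, spec_pure]

/-- A loop with an invariant and a potential that depend on the elements still to be treated. -/
theorem spec_forEach {f : α → σ → Step σ} (I : List α → σ → Prop) (Φ : List α → σ → ℕ)
    (hf : ∀ x xs s, I (x :: xs) s →
      (f x s).Spec fun s' t => I xs s' ∧ t + 1 + Φ xs s' ≤ Φ (x :: xs) s)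
    {xs : List α} {s : σ} (h : I xs s) :
    (forEach xs s f).Spec fun s' t => I [] s' ∧ t + Φ [] s' ≤ Φ xs s + 1 := by
  induction xs generalizing s with
  | nil => simpa [add_comm] using h
  | cons x xs ih =>
    rw [spec_forEach_cons]
    refine spec_bind (hf x xs s h) fun s' t ⟨h', ht⟩ => (ih h').mono fun s'' u ⟨h'', hu⟩ => ⟨h'', ?_⟩
    omega

/-- The result of a loop whose body always halts. -/
theorem spec_forEach_foldl {f : α → σ → Step σ} {g : σ → α → σ} {c : ℕ}
    (hf : ∀ x s, (f x s).Spec fun s' t => s' = g s x ∧ t ≤ c) {xs : List α} {s : σ} :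
    (forEach xs s f).Spec fun s' t => s' = xs.foldl g s ∧ t ≤ (c + 1) * xs.length + 1 := by
  induction xs generalizing s with
  | nil => simp
  | cons x xs ih =>
    rw [spec_forEach_cons]
    refine spec_bind (hf x s) ?_
    rintro s' t ⟨rfl, ht⟩
    refine ih.mono ?_
    rintro s'' u ⟨rfl, hu⟩
    refine ⟨rfl, ?_⟩
    simp only [List.length_cons]
    nlinarith

theorem spec_fill [DecidableEq ι] (is : List ι) (x : α) (a : Arr ι α) :
    (fill is x a).Spec fun b t => (b = fun i => if i ∈ is then x else a i) ∧
      t ≤ 2 * is.length + 1 := by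
  refine (spec_forEach_foldl (g := fun a i => Function.update a i x) (c := 1) ?_).mono ?_
  · simp
  · rintro b t ⟨rfl, ht⟩
    refine ⟨?_, ht⟩
    clear ht
    induction is generalizing a with
    | nil => simp
    | cons j is ih =>
      rw [List.foldl_cons, ih]
      funext i
      by_cases h : i ∈ is
      · simp [h]
      · by_cases hj : i = j
        · simp [hj]
        · simp [hj, h]

/-- Fresh memory already reads as `default`, so initialisation with this value yields a constant
array and no case distinction on the cells written is needed later. -/
theorem spec_fill_default [DecidableEq ι] [Inhabited α] (is : List ι) :
    (fill is (default : α) (alloc : Arr ι α)).Spec fun b t => (b = fun _ => default) ∧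
      t ≤ 2 * is.length + 1 := by
  refine (spec_fill is _ _).mono ?_
  rintro b t ⟨rfl, ht⟩
  refine ⟨?_, ht⟩
  funext i
  simp [alloc]

theorem spec_fill_nil [DecidableEq ι] (is : List ι) :
    (fill is ([] : List α) (alloc : Arr ι (List α))).Spec fun b t => (b = fun _ => []) ∧
      t ≤ 2 * is.length + 1 := spec_fill_default is

theorem spec_count (xs : List α) :
    (Bottleneck.count xs).Spec fun c t => c = xs.length ∧ t ≤ xs.length + 1 := by
  refine (spec_forEach_foldl (g := fun c _ => c + 1) (c := 0) ?_).mono ?_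
  · simp
  · rintro b t ⟨rfl, ht⟩
    refine ⟨by simp, by omega⟩

theorem spec_ceilLog (l : ℕ) :
    (ceilLog l).Spec fun c t => c = Nat.clog 2 l ∧ t ≤ Nat.clog 2 l + 1 :=
  ⟨Nat.clog 2 l + 1, by simp [ceilLog], rfl, le_rfl⟩

end Step

end Triples

/-! ### Merge sort, binary search and the array of thresholds -/

section Sorting

variable {W : Type} [LinearOrder W]

theorem spec_merge (xs ys : List W) (hx : xs.Pairwise (· ≤ ·)) (hy : ys.Pairwise (· ≤ ·)) :
    (merge xs ys).Spec fun zs t => zs.Perm (xs ++ ys) ∧ zs.Pairwise (· ≤ ·) ∧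
      t ≤ xs.length + ys.length + 1 := by
  fun_induction merge xs ys with
  | case1 ys => simp [hy]
  | case2 x xs => simp [hx]
  | case3 x xs y ys ih1 ih2 =>
    rw [Step.spec_leq_bind]
    by_cases h : x ≤ y
    · simp only [h, decide_true, if_true]
      refine Step.spec_bind (ih1 hx.of_cons hy) ?_
      rintro zs t ⟨hp, hs, ht⟩
      simp only [Step.spec_pure]
      refine ⟨hp.cons x, List.pairwise_cons.mpr ⟨?_, hs⟩, ?_⟩
      · intro z hz
        rcases List.mem_append.mp (hp.mem_iff.mp hz) with hz | hz
        · exact (List.pairwise_cons.mp hx).1 z hz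
        · rcases List.mem_cons.mp hz with rfl | hz
          · exact h
          · exact h.trans ((List.pairwise_cons.mp hy).1 z hz)
      · simp only [List.length_cons] at *
        omega
    · simp only [h, decide_false]
      refine Step.spec_bind (ih2 hx hy.of_cons) ?_
      rintro zs t ⟨hp, hs, ht⟩
      simp only [Step.spec_pure]
      refine ⟨(hp.cons y).trans (List.perm_middle (l₁ := x :: xs)).symm,
        List.pairwise_cons.mpr ⟨?_, hs⟩, ?_⟩
      · intro z hz
        have hyx : y ≤ x := le_of_not_ge h
        rcases List.mem_append.mp (hp.mem_iff.mp hz) with hz | hz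
        · rcases List.mem_cons.mp hz with rfl | hz
          · exact hyx
          · exact hyx.trans ((List.pairwise_cons.mp hx).1 z hz)
        · exact (List.pairwise_cons.mp hy).1 z hz
      · simp only [List.length_cons] at *
        omega

theorem clog_half_add_one {n : ℕ} (hn : 2 ≤ n) : Nat.clog 2 ((n + 1) / 2) + 1 = Nat.clog 2 n := by
  rw [Nat.clog_of_two_le (b := 2) (by norm_num) hn]
  rfl

/-- Dealing out alternately makes the halves differ by at most one in length, so both have a
logarithm smaller by one (`clog_half_add_one`). The difference of `4 * length` pays for dealing and
merging. -/
theorem spec_mergeSort (f : ℕ) (xs : List W) (hf : xs.length < f) :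
    (mergeSort f xs).Spec fun zs t => zs.Perm xs ∧ zs.Pairwise (· ≤ ·) ∧
      t ≤ 4 * xs.length * Nat.clog 2 xs.length + 1 := by
  induction f generalizing xs with
  | zero => omega
  | succ f ih =>
    match xs with
    | [] => simp [mergeSort]
    | [x] => simp [mergeSort]
    | x :: y :: xs =>
      rw [mergeSort]
      set L := x :: y :: xs with hL
      have hL2 : 2 ≤ L.length := by simp [hL]
      refine Step.spec_bind (Step.spec_forEach
        (fun rem p => (p.1 ++ p.2 ++ rem).Perm L ∧ p.2.length ≤ p.1.length ∧
          p.1.length ≤ p.2.length + 1) (fun rem _ => rem.length) ?_ ?_) ?_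
      · rintro z zs p ⟨hp, h1, h2⟩
        simp only [Step.spec_pure, List.length_cons]
        refine ⟨⟨?_, by omega, by omega⟩, by omega⟩
        refine List.Perm.trans ?_ hp
        rw [List.perm_iff_count]
        intro a
        simp [List.count_cons]
        omega
      · simp
      · rintro p t ⟨⟨hp, h1, h2⟩, ht⟩
        simp only [List.append_nil, List.length_nil, add_zero] at hp ht
        have hlen : p.1.length + p.2.length = L.length := by
          rw [← List.length_append, hp.length_eq]
        refine Step.spec_bind (ih p.1 (by omega)) ?_
        rintro a u ⟨ha, hsa, hu⟩
        refine Step.spec_bind (ih p.2 (by omega)) ?_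
        rintro b v ⟨hb, hsb, hv⟩
        refine (spec_merge a b hsa hsb).mono ?_
        rintro zs w ⟨hz, hs, hw⟩
        refine ⟨hz.trans ((ha.append hb).trans hp), hs, ?_⟩
        have e1 := ha.length_eq
        have e2 := hb.length_eq
        have c0 := clog_half_add_one hL2
        have c1 : Nat.clog 2 p.1.length ≤ Nat.clog 2 ((L.length + 1) / 2) :=
          Nat.clog_mono_right 2 (by omega)
        have c2 : Nat.clog 2 p.2.length ≤ Nat.clog 2 ((L.length + 1) / 2) :=
          Nat.clog_mono_right 2 (by omega)
        have m1 := Nat.mul_le_mul_left (4 * p.1.length) c1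
        have m2 := Nat.mul_le_mul_left (4 * p.2.length) c2
        have m3 : 4 * p.1.length * Nat.clog 2 ((L.length + 1) / 2) +
            4 * p.2.length * Nat.clog 2 ((L.length + 1) / 2) + 4 * L.length =
            4 * L.length * Nat.clog 2 L.length := by
          rw [← c0, ← hlen]
          ring
        omega

theorem spec_locate {lam : Arr ℕ W} {x : W} {f lo hi : ℕ} (h : lo < hi) (hf : hi ≤ lo + f)
    (hx : lam lo ≤ x) :
    (locate lam x f lo hi).Spec fun r t => lam r ≤ x ∧ r < hi ∧
      t ≤ 2 * Nat.clog 2 (hi - lo) + 1 := by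
  induction f generalizing lo hi with
  | zero => omega
  | succ f ih =>
    rw [locate]
    split_ifs with h1
    · simp [hx, h]
    · have c0 := clog_half_add_one (n := hi - lo) (by omega)
      have c1 : Nat.clog 2 (hi - (lo + hi) / 2) ≤ Nat.clog 2 ((hi - lo + 1) / 2) :=
        Nat.clog_mono_right 2 (by omega)
      have c2 : Nat.clog 2 ((lo + hi) / 2 - lo) ≤ Nat.clog 2 ((hi - lo + 1) / 2) :=
        Nat.clog_mono_right 2 (by omega)
      rw [Step.spec_readAt_bind, Step.spec_leq_bind]
      by_cases h2 : lam ((lo + hi) / 2) ≤ x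
      · simp only [h2, decide_true, if_true]
        refine (ih (by omega) (by omega) h2).mono ?_
        rintro r t ⟨hr, hr', ht⟩
        exact ⟨hr, hr', by omega⟩
      · simp only [h2, decide_false]
        refine (ih (by omega) (by omega) hx).mono ?_
        rintro r t ⟨hr, hr', ht⟩
        exact ⟨hr, by omega, by omega⟩

theorem clog_succ_le (l : ℕ) : Nat.clog 2 (l + 1) ≤ Nat.clog 2 l + 1 := by
  rcases Nat.lt_or_ge l 1 with h | h
  · obtain rfl : l = 0 := by omega
    simp
  · rw [← clog_half_add_one (by omega)]
    have : Nat.clog 2 ((l + 1 + 1) / 2) ≤ Nat.clog 2 l := Nat.clog_mono_right 2 (by omega)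
    omega

/-- Maximality of the index is not recorded; the time analysis only needs that the threshold found
does not exceed `x`. -/
theorem spec_index {lam : Arr ℕ W} (l : ℕ) {x : W} (hx : lam 0 ≤ x) :
    (index lam l x).Spec fun r t => lam r ≤ x ∧ r ≤ l ∧ t ≤ 2 * Nat.clog 2 l + 3 := by
  refine (spec_locate (by omega) (by omega) hx).mono ?_
  rintro r t ⟨hr, hr', ht⟩
  have := clog_succ_le l
  exact ⟨hr, by omega, by simp only [Nat.sub_zero] at ht; omega⟩

/-- The properties of the array of thresholds on which the analysis relies; `ws` are the inner
ones. -/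
structure IsThresholds [BoundedOrder W] (l : ℕ) (ws : List W) (lam : Arr ℕ W) : Prop where
  zero : lam 0 = ⊥
  mono : ∀ i j, i ≤ j → j ≤ l + 1 → lam i ≤ lam j
  mem : ∀ i ≤ l, lam i = ⊥ ∨ lam i ∈ ws
  exists_eq : ∀ w ∈ ws, ∃ i ≤ l, lam i = w

theorem spec_thresholds [BoundedOrder W] (xs : List W) (hs : xs.Pairwise (· ≤ ·)) :
    (thresholds xs.length xs).Spec fun lam t => IsThresholds xs.length xs lam ∧
      t ≤ 2 * xs.length + 3 := by
  rw [thresholds, Step.spec_writeAt_bind]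
  refine Step.spec_bind (Step.spec_forEach
    -- Cell `0` is reserved for `⊥`, so cell `i` holds entry `i - 1` of the sorted list and the
    -- write position `p.2` is one ahead of the number of entries consumed.
    (fun rem p => p.1 0 = ⊥ ∧ 1 ≤ p.2 ∧ p.2 + rem.length = xs.length + 1 ∧
      xs.drop (p.2 - 1) = rem ∧ ∀ i, 1 ≤ i → i < p.2 → xs[i - 1]? = some (p.1 i))
    (fun rem _ => 2 * rem.length) ?_ ?_) ?_
  · rintro x rem p ⟨h0, h1, h2, h3, h4⟩
    simp only [Step.spec_writeAt_bind, Step.spec_pure, List.length_cons] at h2 ⊢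
    refine ⟨⟨?_, by omega, by omega, ?_, ?_⟩, by omega⟩
    · rw [Function.update_of_ne (by omega), h0]
    · have : p.2 + 1 - 1 = (p.2 - 1) + 1 := by omega
      rw [this, ← List.drop_drop, h3]
      rfl
    · intro i hi hi'
      rcases Nat.lt_or_ge i p.2 with hlt | hge
      · rw [Function.update_of_ne (by omega)]
        exact h4 i hi hlt
      · obtain rfl : i = p.2 := by omega
        rw [Function.update_self]
        have := congrArg (fun l => l[0]?) h3
        simpa using this
  · refine ⟨by simp, le_rfl, by simp; omega, by simp, ?_⟩
    intro i h1 h2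
    simp only at h2
    omega
  · rintro p t ⟨⟨h0, h1, h2, h3, h4⟩, ht⟩
    simp only [List.length_nil, add_zero] at h2 ht
    simp only [Step.spec_writeAt]
    have hget : ∀ i, 1 ≤ i → i ≤ xs.length → xs[i - 1]? = some (p.1 i) := fun i hi hi' =>
      h4 i hi (by omega)
    have hval : ∀ i, i ≤ xs.length →
        Function.update p.1 (xs.length + 1) (⊤ : W) i = p.1 i := fun i hi =>
      Function.update_of_ne (by omega) _ _
    refine ⟨⟨?_, ?_, ?_, ?_⟩, by omega⟩
    · rw [hval 0 (by omega), h0]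
    · intro i j hij hj
      rcases Nat.lt_or_ge xs.length j with hlt | hge
      · obtain rfl : j = xs.length + 1 := by omega
        simp
      · rw [hval i (by omega), hval j hge]
        rcases Nat.eq_zero_or_pos i with rfl | hi
        · rw [h0]
          exact bot_le
        · rcases hij.eq_or_lt with rfl | hlt
          · exact le_rfl
          · have g1 := hget i hi (by omega)
            have g2 := hget j (by omega) hge
            obtain ⟨b1, e1⟩ := List.getElem?_eq_some_iff.mp g1
            obtain ⟨b2, e2⟩ := List.getElem?_eq_some_iff.mp g2
            rw [← e1, ← e2]
            exact List.pairwise_iff_getElem.mp hs _ _ b1 b2 (by omega)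
    · intro i hi
      rw [hval i hi]
      rcases Nat.eq_zero_or_pos i with rfl | h
      · exact Or.inl h0
      · exact Or.inr (List.mem_of_getElem? (hget i h hi))
    · intro w hw
      obtain ⟨i, hi, rfl⟩ := List.mem_iff_getElem.mp hw
      refine ⟨i + 1, by omega, ?_⟩
      rw [hval _ (by omega)]
      have := hget (i + 1) (by omega) (by omega)
      rw [Nat.add_sub_cancel, List.getElem?_eq_getElem hi] at this
      exact (Option.some.inj this).symm

end Sorting

/-! ### Sums over classes and buckets -/

section Sums

/-- The source of the amortised bounds: an array update changes a potential in a single summand. The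
additive form avoids truncated subtraction. -/
theorem sum_change {ι : Type} [DecidableEq ι] {F : Finset ι} {g g' : ι → ℕ} {a : ι} (ha : a ∈ F)
    (h : ∀ i, i ≠ a → g' i = g i) : ∑ i ∈ F, g' i + g a = ∑ i ∈ F, g i + g' a := by
  rw [← Finset.add_sum_erase F g' ha, ← Finset.add_sum_erase F g ha]
  have : ∑ i ∈ F.erase a, g' i = ∑ i ∈ F.erase a, g i :=
    Finset.sum_congr rfl fun i hi => h i (Finset.ne_of_mem_erase hi)
  omega

/-- Each entry belongs to one class only; `F` may miss keys, hence an inequality. -/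
theorem sum_filter_key {ι α : Type} [DecidableEq ι] (F : Finset ι) (key : α → ι) (g : α → ℕ)
    (xs : List α) :
    ∑ i ∈ F, ((xs.filter fun x => key x = i).map g).sum ≤ (xs.map g).sum := by
  induction xs with
  | nil => simp
  | cons x xs ih =>
    have h : ∀ i, (((x :: xs).filter fun x => key x = i).map g).sum =
        (if key x = i then g x else 0) + ((xs.filter fun x => key x = i).map g).sum := by
      intro i
      by_cases hx : key x = i <;> simp [hx]
    simp only [h, Finset.sum_add_distrib, Finset.sum_ite_eq, List.map_cons, List.sum_cons]
    split_ifs <;> omega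

theorem sum_map_one {α : Type} (xs : List α) : (xs.map fun _ => 1).sum = xs.length := by
  simp

theorem sum_map_const_mul {α : Type} (xs : List α) (c : ℕ) (g : α → ℕ) :
    (xs.map fun x => c * g x).sum = c * (xs.map g).sum := by
  induction xs with
  | nil => simp
  | cons x xs ih => simp only [List.map_cons, List.sum_cons, ih]; ring

theorem sum_map_le {α : Type} (xs : List α) {f g : α → ℕ} (h : ∀ x ∈ xs, f x ≤ g x) :
    (xs.map f).sum ≤ (xs.map g).sum :=
  List.sum_le_sum h

theorem foldl_bucket {ι α β : Type} [DecidableEq ι] (key : α → ι) (y : α → β) (xs : List α)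
    (b : ι → List β) :
    xs.foldl (fun b x => Function.update b (key x) (y x :: b (key x))) b =
      fun i => ((xs.filter fun x => key x = i).map y).reverse ++ b i := by
  induction xs generalizing b with
  | nil => simp
  | cons x xs ih =>
    rw [List.foldl_cons, ih]
    funext i
    by_cases h : key x = i
    · subst h
      simp
    · have h' : i ≠ key x := fun e => h e.symm
      simp [h, h']

theorem sum_length_update_cons {ι β : Type} [DecidableEq ι] (F : Finset ι) (a : ι → List β) (i : ι)
    (x : β) :
    ∑ v ∈ F, (Function.update a i (x :: a i) v).length ≤ ∑ v ∈ F, (a v).length + 1 := by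
  by_cases hi : i ∈ F
  · have := sum_change (g := fun v => (a v).length)
      (g' := fun v => (Function.update a i (x :: a i) v).length) hi
      (fun v hv => by simp [Function.update_of_ne hv])
    simp only [Function.update_self, List.length_cons] at this
    omega
  · have : ∑ v ∈ F, (Function.update a i (x :: a i) v).length = ∑ v ∈ F, (a v).length :=
      Finset.sum_congr rfl fun v hv => by
        rw [Function.update_of_ne]
        rintro rfl
        exact hi hv
    omega

end Sums

/-! ### Graph search and spanning forests -/

section Graphs

variable {V W : Type}

/-- Two vertices are joined by an edge, in one of the two directions. -/
def Joined (es : List (Edge V W)) (u v : V) : Prop :=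
  ∃ e ∈ es, (e.src = u ∧ e.dst = v) ∨ (e.dst = u ∧ e.src = v)

/-- A list of the vertices of a rooted tree with their parents, in which every vertex stands before
its parent. -/
inductive IsTree (R : V → V → Prop) : List (V × Option V) → Prop
  | root (v : V) : IsTree R [(v, none)]
  | cons {v p : V} {t : List (V × Option V)} : p ∈ t.map Prod.fst → v ∉ t.map Prod.fst → R p v →
      IsTree R t → IsTree R ((v, some p) :: t)

theorem IsTree.ne_nil {R : V → V → Prop} {t : List (V × Option V)} (h : IsTree R t) : t ≠ [] := by
  cases h <;> simp

theorem IsTree.nodup {R : V → V → Prop} {t : List (V × Option V)} (h : IsTree R t) :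
    (t.map Prod.fst).Nodup := by
  induction h with
  | root v => simp
  | cons _ h2 _ _ ih => exact List.nodup_cons.mpr ⟨h2, ih⟩

/-- Connectivity in the form needed later: a property preserved along `R` cannot separate the
vertices of a tree. In the induction the new leaf agrees with its parent. -/
theorem IsTree.connected {R : V → V → Prop} {t : List (V × Option V)} (h : IsTree R t)
    {S : V → Prop} (hS : ∀ u ∈ t.map Prod.fst, ∀ v ∈ t.map Prod.fst, R u v → (S u ↔ S v)) :
    ∀ u ∈ t.map Prod.fst, ∀ v ∈ t.map Prod.fst, S u → S v := by
  induction h with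
  | root v => simp
  | @cons v p t hp hv hR ht ih =>
    have hS' : ∀ u ∈ t.map Prod.fst, ∀ v ∈ t.map Prod.fst, R u v → (S u ↔ S v) := fun u hu w hw =>
      hS u (List.mem_cons_of_mem _ hu) w (List.mem_cons_of_mem _ hw)
    have hpv : S p ↔ S v := hS p (List.mem_cons_of_mem _ hp) v List.mem_cons_self hR
    intro u hu w hw hSu
    rcases List.mem_cons.mp hu with rfl | hu'
    · rcases List.mem_cons.mp hw with rfl | hw'
      · exact hSu
      · exact ih hS' p hp w hw' (hpv.mpr hSu)
    · rcases List.mem_cons.mp hw with rfl | hw'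
      · exact hpv.mp (ih hS' u hu' p hp hSu)
      · exact ih hS' u hu' w hw' hSu

theorem Joined.symm {es : List (Edge V W)} {u v : V} (h : Joined es u v) : Joined es v u := by
  obtain ⟨e, he, h | h⟩ := h
  · exact ⟨e, he, Or.inr ⟨h.2, h.1⟩⟩
  · exact ⟨e, he, Or.inl ⟨h.2, h.1⟩⟩

variable [DecidableEq V]

theorem spec_neighbours (vs : List V) (es : List (Edge V W)) :
    (neighbours vs es).Spec fun adj t => (∀ u v, v ∈ adj u ↔ Joined es u v) ∧
      (∀ F : Finset V, ∑ v ∈ F, (adj v).length ≤ 2 * es.length) ∧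
      t ≤ 2 * vs.length + 5 * es.length + 2 := by
  unfold neighbours
  refine Step.spec_bind (Step.spec_fill_nil (α := V) vs) ?_
  rintro a t ⟨rfl, ht⟩
  refine (Step.spec_forEach
    (fun rem (adj : Arr V (List V)) => (∀ u v, (v ∈ adj u ∨ Joined rem u v) ↔ Joined es u v) ∧
      ∀ F : Finset V, ∑ v ∈ F, (adj v).length + 2 * rem.length ≤ 2 * es.length)
    (fun rem _ => 5 * rem.length) ?_ ?_).mono ?_
  · rintro e rem adj ⟨h1, h2⟩
    simp only [Step.spec_readAt_bind, Step.spec_writeAt_bind, Step.spec_writeAt, List.length_cons]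
    refine ⟨⟨?_, ?_⟩, by omega⟩
    · intro u v
      rw [← h1 u v]
      have hJ : Joined (e :: rem) u v ↔
          ((e.src = u ∧ e.dst = v) ∨ (e.dst = u ∧ e.src = v)) ∨ Joined rem u v := by
        simp [Joined]
      have hU : v ∈ Function.update (Function.update adj e.src (e.dst :: adj e.src)) e.dst
          (e.src :: Function.update adj e.src (e.dst :: adj e.src) e.dst) u ↔
          v ∈ adj u ∨ ((e.src = u ∧ e.dst = v) ∨ (e.dst = u ∧ e.src = v)) := by
        simp only [Function.update_apply]
        (split_ifs with i1 i2 i2 <;> try simp only [List.mem_cons]) <;> grind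
      rw [hJ, hU]
      tauto
    · intro F
      have a1 := sum_length_update_cons F (Function.update adj e.src (e.dst :: adj e.src)) e.dst
        e.src
      have a2 := sum_length_update_cons F adj e.src e.dst
      have a3 := h2 F
      simp only [List.length_cons] at a3
      omega
  · refine ⟨fun u v => ?_, fun F => ?_⟩
    · simp
    · simp
  · rintro adj u ⟨⟨h1, h2⟩, hu⟩
    refine ⟨fun u v => ?_, fun F => ?_, ?_⟩
    · rw [← h1 u v]
      simp [Joined]
    · have := h2 F
      simpa using this
    · simp only [List.length_nil] at hu
      omega

theorem spec_successors (vs : List V) (es : List (Edge V W)) :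
    (successors vs es).Spec fun adj t => (∀ u v, v ∈ adj u → ∃ e ∈ es, e.dst = v) ∧
      (∀ F : Finset V, ∑ v ∈ F, (adj v).length ≤ es.length) ∧
      t ≤ 2 * vs.length + 3 * es.length + 2 := by
  unfold successors
  refine Step.spec_bind (Step.spec_fill_nil (α := V) vs) ?_
  rintro a t ⟨rfl, ht⟩
  refine (Step.spec_forEach_foldl (c := 2)
    (g := fun b (e : Edge V W) => Function.update b e.src (e.dst :: b e.src)) ?_).mono ?_
  · intro e adj
    simp
  · rintro b u ⟨rfl, hu⟩
    rw [foldl_bucket]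
    refine ⟨fun u v hv => ?_, fun F => ?_, by omega⟩
    · simp only [List.mem_append, List.mem_reverse, List.mem_map, List.mem_filter] at hv
      rcases hv with ⟨e, he, rfl⟩ | hv
      · exact ⟨e, he.1, rfl⟩
      · exact absurd hv (by simp)
    · refine le_trans (le_of_eq ?_) ((sum_filter_key F (fun e : Edge V W => e.src) (fun _ => 1)
        es).trans (le_of_eq (sum_map_one es)))
      refine Finset.sum_congr rfl fun v _ => ?_
      rw [sum_map_one]
      simp

theorem spec_outEdges (vs : List V) (es : List (Edge V W)) :
    (outEdges vs es).Spec fun out t => (out = fun v => (es.filter fun e => e.src = v).reverse) ∧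
      t ≤ 2 * vs.length + 3 * es.length + 2 := by
  unfold outEdges
  refine Step.spec_bind (Step.spec_fill_nil (α := Edge V W) vs) ?_
  rintro a t ⟨rfl, ht⟩
  refine (Step.spec_forEach_foldl (c := 2)
    (g := fun b (e : Edge V W) => Function.update b e.src (e :: b e.src)) ?_).mono ?_
  · intro e adj
    simp
  · rintro b u ⟨rfl, hu⟩
    rw [foldl_bucket (fun e : Edge V W => e.src) (fun e => e)]
    refine ⟨?_, by omega⟩
    funext v
    simp only [List.map_id']
    exact List.append_nil _

/-- The invariant `J` is left open because `components` needs the search tree, whereas `solveBase`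
only needs the number of vertices found. An adjacency list is pushed only when its vertex is first
seen. Hence the stack together with the lists of unseen vertices bounds the number of rounds, and
the same quantities serve as a potential for the cost. -/
theorem spec_explore (adj : Arr V (List V)) (F : Finset V) (hF : ∀ v ∈ F, ∀ u ∈ adj v, u ∈ F)
    (J : List (V × Option V) → Arr V Bool → List (V × Option V) → Prop)
    (hJ1 : ∀ x st seen found, seen x.1 = true → J (x :: st) seen found → J st seen found)
    (hJ2 : ∀ x st seen found, x.1 ∈ F → seen x.1 = false → J (x :: st) seen found →
      J (((adj x.1).map fun u => (u, some x.1)).reverse ++ st) (Function.update seen x.1 true)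
        (x :: found))
    (f : ℕ) (st : List (V × Option V)) (seen : Arr V Bool) (found : List (V × Option V))
    (hst : ∀ x ∈ st, x.1 ∈ F)
    (hf : st.length + ∑ v ∈ F, (if seen v then 0 else (adj v).length) < f)
    (h0 : J st seen found) :
    (explore adj f st (seen, found)).Spec fun s t => J [] s.1 s.2 ∧
      t + ∑ v ∈ F, (if s.1 v then 0 else 4 + 2 * (adj v).length) ≤
        st.length + ∑ v ∈ F, (if seen v then 0 else 4 + 2 * (adj v).length) + 1 := by
  induction f generalizing st seen found with
  | zero => omega
  | succ f ih =>
    match st with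
    | [] =>
      simp only [explore, Step.spec_tick_bind, Step.spec_pure]
      exact ⟨h0, by simp; omega⟩
    | (v, p) :: st =>
      have hv : v ∈ F := hst (v, p) List.mem_cons_self
      simp only [List.length_cons] at hf
      rw [explore, Step.spec_readAt_bind]
      by_cases hs : seen v = true
      · simp only [hs, if_true]
        refine (ih st seen found (fun x hx => hst x (List.mem_cons_of_mem _ hx)) (by omega)
          (hJ1 _ _ _ _ hs h0)).mono ?_
        rintro s t ⟨h1, h2⟩
        exact ⟨h1, by simp only [List.length_cons]; omega⟩
      · have hs' : seen v = false := by simpa using hs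
        simp only [hs', Bool.false_eq_true, if_false, Step.spec_writeAt_bind, Step.spec_readAt_bind]
        refine Step.spec_bind (Step.spec_forEach_foldl
          (g := fun st u => (u, some v) :: st) (c := 0) ?_) ?_
        · simp
        rintro st' t ⟨rfl, ht⟩
        have e : (adj v).foldl (fun st u => (u, some v) :: st) st =
            ((adj v).map fun u => (u, some v)).reverse ++ st := by
          generalize adj v = us
          induction us generalizing st with
          | nil => simp
          | cons u us _ => simp
        have hlen : ((adj v).foldl (fun st u => (u, some v) :: st) st).length =
            (adj v).length + st.length := by
          rw [e]
          simp
        have c1 := sum_change (F := F)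
          (g := fun u => if seen u = true then 0 else (adj u).length)
          (g' := fun u => if Function.update seen v true u = true then 0 else (adj u).length)
          hv (fun u hu => by simp only [Function.update_of_ne hu])
        have c2 := sum_change (F := F)
          (g := fun u => if seen u = true then 0 else 4 + 2 * (adj u).length)
          (g' := fun u => if Function.update seen v true u = true then 0 else
            4 + 2 * (adj u).length)
          hv (fun u hu => by simp only [Function.update_of_ne hu])
        simp only [hs', Function.update_self, if_true] at c1 c2
        simp only [Bool.false_eq_true, if_false] at c1 c2
        refine (ih _ (Function.update seen v true) ((v, p) :: found) ?_ ?_ ?_).mono ?_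
        · intro x hx
          rw [e, List.mem_append, List.mem_reverse, List.mem_map] at hx
          rcases hx with ⟨u, hu, rfl⟩ | hx
          · exact hF v hv u hu
          · exact hst x (List.mem_cons_of_mem _ hx)
        · omega
        · rw [e]
          exact hJ2 (v, p) st seen found hv hs' h0
        · rintro s u ⟨h1, h2⟩
          refine ⟨h1, ?_⟩
          simp only [List.length_cons]
          omega

/-- The spanning forest that is found by `components`. -/
structure IsForest (vs : List V) (es : List (Edge V W)) (comps : List (List (V × Option V))) :
    Prop where
  tree : ∀ T ∈ comps, IsTree (Joined es) T
  nodup : (comps.flatten.map Prod.fst).Nodup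
  mem : ∀ v, v ∈ comps.flatten.map Prod.fst ↔ v ∈ vs
  closed : ∀ T ∈ comps, ∀ u v, Joined es u v → u ∈ T.map Prod.fst → v ∈ T.map Prod.fst

theorem spec_components (vs : List V) (es : List (Edge V W))
    (hes : ∀ e ∈ es, e.src ∈ vs ∧ e.dst ∈ vs) :
    (components vs es).Spec fun comps t => IsForest vs es comps ∧
      t ≤ 12 * vs.length + 9 * es.length + 4 := by
  unfold components
  refine Step.spec_bind (spec_neighbours vs es) ?_
  rintro adj t ⟨hadj, hsum, ht⟩
  refine Step.spec_bind (Step.spec_fill_default (α := Bool) vs) ?_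
  rintro seen u ⟨rfl, hu⟩
  set F := vs.toFinset with hFdef
  have hmemF : ∀ v, v ∈ F ↔ v ∈ vs := fun v => List.mem_toFinset
  have hJF : ∀ u v, Joined es u v → v ∈ F := by
    rintro u v ⟨e, he, h | h⟩
    · rw [hmemF, ← h.2]
      exact (hes e he).2
    · rw [hmemF, ← h.2]
      exact (hes e he).1
  refine Step.spec_bind (Step.spec_forEach
    (fun rem (s : Arr V Bool × List (List (V × Option V))) =>
      (∀ T ∈ s.2, IsTree (Joined es) T) ∧ (s.2.flatten.map Prod.fst).Nodup ∧
      (∀ v, v ∈ s.2.flatten.map Prod.fst ↔ s.1 v = true) ∧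
      (∀ v, s.1 v = true → v ∈ F) ∧ (∀ v ∈ vs, v ∉ rem → s.1 v = true) ∧ (∀ v ∈ rem, v ∈ vs) ∧
      ∀ T ∈ s.2, ∀ u v, Joined es u v → u ∈ T.map Prod.fst → v ∈ T.map Prod.fst)
    (fun rem s => 4 * rem.length + ∑ v ∈ F, (if s.1 v then 0 else 4 + 2 * (adj v).length))
    ?_ ?_) ?_
  · rintro v rem ⟨seen, Ts⟩ ⟨h1, h2, h3, h4, h5, h6, h7⟩
    simp only [Step.spec_readAt_bind, List.length_cons] at h1 h2 h3 h4 h5 h7 ⊢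
    by_cases hs : seen v = true
    · simp only [hs, if_true, Step.spec_pure]
      refine ⟨⟨h1, h2, h3, h4, fun w hw hw' => ?_, fun w hw => h6 w (List.mem_cons_of_mem _ hw),
        h7⟩, by omega⟩
      by_cases e : w = v
      · rw [e, hs]
      · exact h5 w hw (by simp [e, hw'])
    · have hs' : seen v = false := by simpa using hs
      simp only [hs', Bool.false_eq_true, if_false]
      have hv : v ∈ F := (hmemF v).mpr (h6 v List.mem_cons_self)
      -- The vertices marked before this search form a union of finished components; hence no edge
      -- joins the new tree to an old one.
      have hclosed : ∀ a b, Joined es a b → seen a = true → seen b = true := by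
        intro a b hab ha
        rw [← h3, List.mem_map] at ha
        obtain ⟨x, hx, rfl⟩ := ha
        obtain ⟨T, hT, hxT⟩ := List.mem_flatten.mp hx
        have := h7 T hT _ b hab (List.mem_map_of_mem hxT)
        rw [← h3, List.mem_map]
        obtain ⟨y, hy, rfl⟩ := List.mem_map.mp this
        exact ⟨y, List.mem_flatten.mpr ⟨T, hT, hy⟩, rfl⟩
      refine Step.spec_bind (spec_explore adj F (fun a _ b hb => hJF a b ((hadj a b).mp hb))
        -- Either the root is still the only stack entry and nothing is found, or the vertices found
        -- form a tree and every stack entry is a potential leaf with its parent in that tree. The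
        -- last clause says that neighbours of found vertices are marked or waiting, so the tree is
        -- closed once the stack is empty.
        (fun st seen' found =>
          (∀ w, seen' w = true ↔ seen w = true ∨ w ∈ found.map Prod.fst) ∧
          ((found = [] ∧ st = [(v, none)]) ∨ (IsTree (Joined es) found ∧ v ∈ found.map Prod.fst ∧
            ∀ x ∈ st, ∃ p, x.2 = some p ∧ p ∈ found.map Prod.fst ∧ Joined es p x.1)) ∧
          (∀ w ∈ found.map Prod.fst, seen w = false ∧ w ∈ F) ∧
          ∀ a ∈ found.map Prod.fst, ∀ b, Joined es a b → seen' b = true ∨ b ∈ st.map Prod.fst)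
        ?_ ?_ (2 * es.length + 2) [(v, none)] seen [] ?_ ?_ ?_) ?_
      · rintro ⟨x, p⟩ st seen' found hx ⟨j1, j2, j3, j4⟩
        refine ⟨j1, ?_, j3, ?_⟩
        · rcases j2 with ⟨rfl, j2⟩ | ⟨j2, j2', j2''⟩
          · have : x = v := by
              injection j2 with e _
              injection e
            subst this
            rw [j1, hs'] at hx
            simp at hx
          · exact Or.inr ⟨j2, j2', fun y hy => j2'' y (List.mem_cons_of_mem _ hy)⟩
        · intro a ha b hab
          rcases j4 a ha b hab with h | h
          · exact Or.inl h
          · rcases List.mem_cons.mp h with rfl | h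
            · exact Or.inl hx
            · exact Or.inr h
      · rintro ⟨x, p⟩ st seen' found hxF hx ⟨j1, j2, j3, j4⟩
        simp only at hxF hx
        have hxs : seen x = false ∧ x ∉ found.map Prod.fst := by
          have := (j1 x).not.mp (by simp [hx])
          push Not at this
          simpa using this
        refine ⟨?_, Or.inr ⟨?_, ?_, ?_⟩, ?_, ?_⟩
        · intro w
          by_cases e : w = x
          · simp [e]
          · rw [Function.update_of_ne e, j1 w]
            simp [e]
        · rcases j2 with ⟨rfl, j2⟩ | ⟨j2, j2', j2''⟩
          · injection j2 with e _
            rw [e]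
            exact IsTree.root v
          · obtain ⟨q, hq, hq', hq''⟩ := j2'' (x, p) List.mem_cons_self
            simp only at hq hq''
            rw [hq]
            exact IsTree.cons hq' hxs.2 hq'' j2
        · rcases j2 with ⟨rfl, j2⟩ | ⟨j2, j2', j2''⟩
          · injection j2 with e _
            rw [e]
            simp
          · exact List.mem_cons_of_mem _ j2'
        · intro y hy
          rw [List.mem_append, List.mem_reverse, List.mem_map] at hy
          rcases hy with ⟨b, hb, rfl⟩ | hy
          · exact ⟨x, rfl, by simp, (hadj x b).mp hb⟩
          · rcases j2 with ⟨rfl, j2⟩ | ⟨j2, j2', j2''⟩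
            · injection j2 with _ e
              rw [e] at hy
              simp at hy
            · obtain ⟨q, hq, hq', hq''⟩ := j2'' y (List.mem_cons_of_mem _ hy)
              exact ⟨q, hq, List.mem_cons_of_mem _ hq', hq''⟩
        · intro w hw
          rcases List.mem_cons.mp hw with rfl | hw
          · exact ⟨hxs.1, hxF⟩
          · exact j3 w hw
        · intro a ha b hab
          rcases List.mem_cons.mp ha with rfl | ha
          · right
            rw [List.map_append, List.mem_append]
            left
            rw [List.map_reverse, List.mem_reverse, List.map_map, List.mem_map]
            exact ⟨b, (hadj _ b).mpr hab, rfl⟩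
          · by_cases e : b = x
            · left
              simp [e]
            · rcases j4 a ha b hab with h | h
              · left
                rw [Function.update_of_ne e, h]
              · right
                rw [List.map_append, List.mem_append]
                right
                rcases List.mem_cons.mp h with h | h
                · exact absurd h e
                · exact h
      · simp [hv]
      · have : ∑ v ∈ F, (if seen v = true then 0 else (adj v).length) ≤
            ∑ v ∈ F, (adj v).length := Finset.sum_le_sum fun w _ => by split_ifs <;> simp
        have := hsum F
        simp only [List.length_cons, List.length_nil]
        omega
      · refine ⟨by simp, Or.inl ⟨rfl, rfl⟩, by simp, by simp⟩
      · rintro ⟨seen', T⟩ t ⟨⟨j1, j2, j3, j4⟩, ht⟩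
        simp only [List.length_cons, List.length_nil] at j1 j2 j3 j4 ht
        rcases j2 with ⟨_, j2⟩ | ⟨j2, hvT, -⟩
        · simp at j2
        simp only [Step.spec_pure]
        refine ⟨⟨?_, ?_, ?_, ?_, ?_, ?_, ?_⟩, by omega⟩
        · intro T' hT'
          rcases List.mem_cons.mp hT' with rfl | hT'
          · exact j2
          · exact h1 T' hT'
        · rw [List.flatten_cons, List.map_append, List.nodup_append']
          refine ⟨j2.nodup, h2, ?_⟩
          intro w hw hw'
          rw [h3, (j3 w hw).1] at hw'
          exact absurd hw' (by simp)
        · intro w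
          rw [List.flatten_cons, List.map_append, List.mem_append, h3, j1]
          tauto
        · intro w hw
          rcases (j1 w).mp hw with h | h
          · exact h4 w h
          · exact (j3 w h).2
        · intro w hw hw'
          rw [j1]
          by_cases e : w = v
          · exact Or.inr (e ▸ hvT)
          · exact Or.inl (h5 w hw (by simp [e, hw']))
        · exact fun w hw => h6 w (List.mem_cons_of_mem _ hw)
        · intro T' hT' a b hab ha
          rcases List.mem_cons.mp hT' with rfl | hT'
          · rcases j4 a ha b hab with h | h
            · rcases (j1 b).mp h with h | h
              · have := hclosed b a hab.symm h
                rw [(j3 a ha).1] at this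
                exact absurd this (by simp)
              · exact h
            · simp at h
          · exact h7 T' hT' a b hab ha
  · refine ⟨by simp, by simp, by simp, by simp, ?_, by simp, by simp⟩
    exact fun v hv hv' => absurd hv hv'
  · rintro ⟨seen, Ts⟩ w ⟨⟨h1, h2, h3, h4, h5, h6, h7⟩, hw⟩
    simp only [Step.spec_pure, List.length_nil] at h1 h2 h3 h4 h5 h7 hw ⊢
    refine ⟨⟨h1, h2, ?_, h7⟩, ?_⟩
    · intro v
      rw [h3]
      exact ⟨fun h => (hmemF v).mp (h4 v h), fun h => h5 v h (by simp)⟩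
    · have e1 : ∑ v ∈ F, (if (default : Bool) = true then 0 else 4 + 2 * (adj v).length) =
          4 * F.card + 2 * ∑ v ∈ F, (adj v).length := by
        simp [Finset.sum_add_distrib, Finset.mul_sum, mul_comm]
      have e2 := hsum F
      have e3 : F.card ≤ vs.length := List.toFinset_card_le vs
      rw [e1] at hw
      omega

end Graphs

/-! ### Distribution of vertices and edges by keys -/

section Gather

variable {V W : Type}

/-- The vertices with key `i`, in the order in which `gather` lists them. -/
def vertexPart (key : V → ℕ) (vs : List V) (i : ℕ) : List V := (vs.filter fun v => key v = i).reverse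

/-- The edges whose tails have key `i`, in the order in which `gather` lists them. -/
def edgePart (key : V → ℕ) (es : List (Edge V W)) (i : ℕ) : List (Edge V W) :=
  (es.filter fun e => key e.src = i).reverse

/-- `Gs` lists graphs formed by the vertices with equal keys. -/
def IsGather (c : ℕ) (key : V → ℕ) (vs : List V) (es : List (Edge V W))
    (Gs : List (List V × List (Edge V W))) : Prop :=
  ∃ is : List ℕ, is.Nodup ∧ (∀ i ∈ is, i < c ∧ vertexPart key vs i ≠ []) ∧
    Gs = is.map fun i => (vertexPart key vs i, edgePart key es i)

theorem spec_gather [DecidableEq V] (c : ℕ) (key : Arr V ℕ) (vs : List V) (es : List (Edge V W)) :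
    (gather c key vs es).Spec fun Gs t => IsGather c key vs es Gs ∧
      t ≤ 7 * c + 4 * vs.length + 4 * es.length + 5 := by
  unfold gather
  refine Step.spec_bind (Step.spec_fill_nil (α := V) (List.range c)) ?_
  rintro _ t₁ ⟨rfl, h₁⟩
  refine Step.spec_bind (Step.spec_fill_nil (α := Edge V W) (List.range c)) ?_
  rintro _ t₂ ⟨rfl, h₂⟩
  refine Step.spec_bind (Step.spec_forEach_foldl (c := 3)
    (g := fun b v => Function.update b (key v) (v :: b (key v))) (by intro v b; simp)) ?_
  rintro vb t₃ ⟨hvb, h₃⟩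
  refine Step.spec_bind (Step.spec_forEach_foldl (c := 3)
    (g := fun b (e : Edge V W) => Function.update b (key e.src) (e :: b (key e.src)))
    (by intro v b; simp)) ?_
  rintro eb t₄ ⟨heb, h₄⟩
  have hvb' : vb = vertexPart key vs := by
    rw [hvb, foldl_bucket key fun v => v]
    funext i
    simp [vertexPart]
  have heb' : eb = edgePart key es := by
    rw [heb, foldl_bucket (fun e : Edge V W => key e.src) fun e => e]
    funext i
    simp [edgePart]
  rw [hvb', heb']
  refine (Step.spec_forEach
    (fun rem Gs => rem.Nodup ∧ (∀ i ∈ rem, i < c) ∧ ∃ is : List ℕ, is.Nodup ∧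
      (∀ i ∈ is, i ∉ rem ∧ i < c ∧ vertexPart key vs i ≠ []) ∧
      Gs = is.map fun i => (vertexPart key vs i, edgePart key es i))
    (fun rem _ => 3 * rem.length) ?_ ?_).mono ?_
  · rintro i rem Gs ⟨hn, hc, is, his, hmem, rfl⟩
    obtain ⟨hi, hn⟩ := List.nodup_cons.mp hn
    simp only [Step.spec_readAt_bind, List.length_cons]
    cases hp : vertexPart key vs i with
    | nil =>
      simp only [Step.spec_pure]
      refine ⟨⟨hn, fun j hj => hc j (List.mem_cons_of_mem _ hj), is, his, fun j hj => ?_, rfl⟩,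
        by omega⟩
      obtain ⟨h1, h2⟩ := hmem j hj
      exact ⟨fun h => h1 (List.mem_cons_of_mem _ h), h2⟩
    | cons x xs =>
      simp only [Step.spec_pure]
      refine ⟨⟨hn, fun j hj => hc j (List.mem_cons_of_mem _ hj), i :: is, ?_, ?_, ?_⟩, by omega⟩
      · exact List.nodup_cons.mpr ⟨fun h => (hmem i h).1 List.mem_cons_self, his⟩
      · intro j hj
        rcases List.mem_cons.mp hj with rfl | hj
        · exact ⟨hi, hc _ List.mem_cons_self, by rw [hp]; simp⟩
        · obtain ⟨h1, h2⟩ := hmem j hj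
          exact ⟨fun h => h1 (List.mem_cons_of_mem _ h), h2⟩
      · rw [List.map_cons, hp]
  · exact ⟨List.nodup_range, fun i hi => List.mem_range.mp hi, [], by simp, by simp, rfl⟩
  · rintro Gs u ⟨⟨-, -, is, h1, h2, h3⟩, hu⟩
    refine ⟨⟨is, h1, fun i hi => (h2 i hi).2, h3⟩, ?_⟩
    simp only [List.length_range, List.length_nil] at *
    omega

theorem IsGather.sum_le {c : ℕ} {key : V → ℕ} {vs : List V} {es : List (Edge V W)}
    {Gs : List (List V × List (Edge V W))} (h : IsGather c key vs es Gs) (g : Edge V W → ℕ) :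
    (Gs.map fun G => (G.2.map g).sum).sum ≤ (es.map g).sum := by
  obtain ⟨is, hn, -, rfl⟩ := h
  rw [List.map_map]
  refine le_trans (le_of_eq ?_) (sum_filter_key is.toFinset (fun e : Edge V W => key e.src) g es)
  rw [List.sum_toFinset _ hn]
  congr 1
  refine List.map_congr_left fun i _ => ?_
  simp [edgePart]

theorem IsGather.sum_length_le {c : ℕ} {key : V → ℕ} {vs : List V} {es : List (Edge V W)}
    {Gs : List (List V × List (Edge V W))} (h : IsGather c key vs es Gs) :
    (Gs.map fun G => G.1.length).sum ≤ vs.length := by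
  obtain ⟨is, hn, -, rfl⟩ := h
  rw [List.map_map]
  refine le_trans (le_of_eq ?_) ((sum_filter_key is.toFinset key (fun _ => 1) vs).trans
    (sum_map_one vs).le)
  rw [List.sum_toFinset _ hn]
  congr 1
  refine List.map_congr_left fun i _ => ?_
  simp [vertexPart]

end Gather

/-! ### Instances and their connected components -/

section Instances

variable {V W : Type} [LinearOrder W] [BoundedOrder W]

/-- The requirements on an instance. -/
structure IsInstance (vs : List V) (es : List (Edge V W)) : Prop where
  nodup : vs.Nodup
  mem : ∀ e ∈ es, e.src ∈ vs ∧ e.dst ∈ vs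
  ne_bot : ∀ e ∈ es, e.wt ≠ ⊥
  distinct : es.Pairwise fun e e' => e.wt = e'.wt → e.wt = ⊤

/-- The restricted edges. -/
def restricted (es : List (Edge V W)) : List (Edge V W) := es.filter fun e => e.wt ≠ ⊤

theorem spec_classify (es : List (Edge V W)) :
    (classify es).Spec fun p t => p.1 = (restricted es).reverse ∧
      (∀ e ∈ p.2, e ∈ es) ∧ p.2.length ≤ es.length ∧ t ≤ 2 * es.length + 1 := by
  refine (Step.spec_forEach
    (fun rem (p : List (Edge V W) × List (Edge V W)) =>
      (restricted rem).reverse ++ p.1 = (restricted es).reverse ∧ (∀ e ∈ p.2, e ∈ es) ∧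
      (∀ e ∈ rem, e ∈ es) ∧ p.2.length + rem.length ≤ es.length)
    (fun rem _ => 2 * rem.length) ?_ ?_).mono ?_
  · rintro e rem p ⟨h1, h2, h3, h4⟩
    simp only [Step.spec_leq_bind, List.length_cons, top_le_iff] at h4 ⊢
    have h3' : ∀ e' ∈ rem, e' ∈ es := fun e' he' => h3 e' (List.mem_cons_of_mem _ he')
    by_cases h : e.wt = ⊤
    · simp only [h, decide_true, if_true, Step.spec_pure, List.length_cons]
      refine ⟨⟨by simpa [restricted, h] using h1, ?_, h3', by omega⟩, by omega⟩
      intro e' he'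
      rcases List.mem_cons.mp he' with rfl | he'
      · exact h3 _ List.mem_cons_self
      · exact h2 e' he'
    · simp only [h, decide_false, Bool.false_eq_true, if_false, Step.spec_pure]
      exact ⟨⟨by simpa [restricted, h] using h1, h2, h3', by omega⟩, by omega⟩
  · simp
  · rintro p t ⟨⟨h1, h2, -, h4⟩, ht⟩
    simp only [List.length_nil] at h4 ht
    exact ⟨by simpa [restricted] using h1, h2, by omega, by omega⟩

theorem restricted_length (es : List (Edge V W)) :
    (restricted es).length = (es.map fun e => if e.wt ≠ ⊤ then 1 else 0).sum := by
  induction es with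
  | nil => simp [restricted]
  | cons e es ih =>
    rw [List.map_cons, List.sum_cons, ← ih]
    by_cases h : e.wt = ⊤ <;> simp [restricted, h, add_comm]

theorem restricted_length_le (es : List (Edge V W)) : (restricted es).length ≤ es.length :=
  List.length_filter_le _ _

theorem IsInstance.part {vs : List V} {es : List (Edge V W)} (h : IsInstance vs es)
    {key : V → ℕ} (hkey : ∀ e ∈ es, key e.src = key e.dst) (i : ℕ) :
    IsInstance (vertexPart key vs i) (edgePart key es i) := by
  refine ⟨List.nodup_reverse.mpr (h.nodup.filter _), fun e he => ?_, fun e he => ?_, ?_⟩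
  · simp only [edgePart, List.mem_reverse, List.mem_filter, decide_eq_true_eq] at he
    simp only [vertexPart, List.mem_reverse, List.mem_filter, decide_eq_true_eq]
    exact ⟨⟨(h.mem e he.1).1, he.2⟩, (h.mem e he.1).2, (hkey e he.1) ▸ he.2⟩
  · simp only [edgePart, List.mem_reverse, List.mem_filter, decide_eq_true_eq] at he
    exact h.ne_bot e he.1
  · rw [edgePart, List.pairwise_reverse]
    exact (h.distinct.filter _).imp fun hab hba => hba ▸ hab hba.symm

variable [DecidableEq V]

/-- The claim that `components` finds a single tree in each part guarantees that the next recursive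
call takes the branch for connected graphs, so splitting into components at most doubles the depth.
If two trees were found in a part, the vertex set of the first would be closed under edges and would
separate the tree that spans the part, against `IsTree.connected`. -/
theorem spec_componentGraphs {comps : List (List (V × Option V))} {vs : List V}
    {es : List (Edge V W)} (h : IsInstance vs es) (hc : IsForest vs es comps) :
    (componentGraphs comps vs es).Spec fun Gs t => ∃ c key, IsGather c key vs es Gs ∧
      (∀ G ∈ Gs, IsInstance G.1 G.2 ∧ G.1 ≠ [] ∧ ∃ T, (components G.1 G.2).val = [T]) ∧
      t ≤ 15 * vs.length + 4 * es.length + 6 := by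
  unfold componentGraphs
  have hflat : (comps.map List.length).sum = vs.length := by
    have := ((List.perm_ext_iff_of_nodup hc.nodup h.nodup).mpr hc.mem).length_eq
    rw [← this, List.length_map, List.length_flatten]
  have hle : comps.length ≤ vs.length := by
    rw [← hflat, ← sum_map_one]
    exact sum_map_le _ fun T hT => List.length_pos_iff.mpr (hc.tree T hT).ne_nil
  refine Step.spec_bind (Step.spec_forEach
    (fun rem (p : Arr V ℕ × ℕ) => comps.drop p.2 = rem ∧ p.2 + rem.length = comps.length ∧
      ∀ i < p.2, ∀ T, comps[i]? = some T → ∀ v ∈ T.map Prod.fst, p.1 v = i)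
    (fun rem _ => (rem.map fun T => 2 * T.length).sum + 2 * rem.length) ?_ ?_) ?_
  · rintro T rem ⟨key, d⟩ ⟨h1, h2, h3⟩
    simp only [List.length_cons, List.map_cons, List.sum_cons] at h1 h2 h3 ⊢
    have hd : comps[d]? = some T := by
      have := congrArg (fun l => l[0]?) h1
      simpa using this
    refine Step.spec_bind (Step.spec_forEach_foldl (c := 1)
      (g := fun key (x : V × Option V) => Function.update key x.1 d)
      (by intro v b; simp)) ?_
    rintro key' t ⟨hk, ht⟩
    have hval : ∀ v, key' v = if v ∈ T.map Prod.fst then d else key v := by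
      rw [hk]
      clear hk h1 h2 h3 hd ht
      induction T generalizing key with
      | nil => simp
      | cons x T ih =>
        intro v
        rw [List.foldl_cons, ih]
        by_cases hv : v ∈ T.map Prod.fst
        · rw [if_pos hv, List.map_cons, if_pos (List.mem_cons_of_mem _ hv)]
        · rw [if_neg hv, List.map_cons]
          by_cases e : v = x.1
          · rw [e]
            simp
          · rw [Function.update_of_ne e, if_neg]
            simpa [e] using hv
    simp only [Step.spec_pure]
    refine ⟨⟨?_, by omega, ?_⟩, by omega⟩
    · rw [← List.drop_drop, h1]
      rfl
    · intro i hi T' hT' v hv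
      rw [hval]
      split_ifs with hvT
      · by_contra hne
        have hlt : i < d := by omega
        obtain ⟨b1, e1⟩ := List.getElem?_eq_some_iff.mp hT'
        obtain ⟨b2, e2⟩ := List.getElem?_eq_some_iff.mp hd
        have hn := hc.nodup
        rw [List.map_flatten, List.nodup_flatten] at hn
        -- Writing the keys of tree `d` cannot overwrite those of an earlier tree, because the trees
        -- of the forest are disjoint.
        have := List.pairwise_iff_getElem.mp hn.2 i d (by simpa using b1) (by simpa using b2) hlt
        rw [List.getElem_map, List.getElem_map, e1, e2] at this
        exact this hv hvT
      · rcases Nat.lt_or_ge i d with hlt | hge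
        · exact h3 i hlt T' hT' v hv
        · obtain rfl : i = d := by omega
          rw [hd] at hT'
          exact absurd (Option.some.inj hT' ▸ hv) hvT
  · exact ⟨by simp, by simp, by simp⟩
  · rintro ⟨key, c⟩ t ⟨⟨h1, h2, h3⟩, ht⟩
    simp only [List.length_nil, List.map_nil, List.sum_nil] at h2 h3 ht
    rw [sum_map_const_mul, hflat] at ht
    obtain rfl : c = comps.length := by omega
    have hkey : ∀ i (hi : i < comps.length), ∀ v, v ∈ (comps[i]).map Prod.fst ↔
        v ∈ vs ∧ key v = i := by
      intro i hi v
      constructor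
      · intro hv
        refine ⟨(hc.mem v).mp ?_, h3 i hi _ (List.getElem?_eq_getElem hi) v hv⟩
        obtain ⟨x, hx, rfl⟩ := List.mem_map.mp hv
        exact List.mem_map_of_mem (List.mem_flatten.mpr ⟨_, List.getElem_mem hi, hx⟩)
      · rintro ⟨hv, rfl⟩
        obtain ⟨x, hx, rfl⟩ := List.mem_map.mp ((hc.mem v).mpr hv)
        obtain ⟨T, hT, hxT⟩ := List.mem_flatten.mp hx
        obtain ⟨j, hj, rfl⟩ := List.mem_iff_getElem.mp hT
        have := h3 j hj _ (List.getElem?_eq_getElem hj) x.1 (List.mem_map_of_mem hxT)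
        subst this
        exact List.mem_map_of_mem hxT
    have hedge : ∀ e ∈ es, key e.src = key e.dst := by
      intro e he
      obtain ⟨x, hx, hxe⟩ := List.mem_map.mp ((hc.mem _).mpr (h.mem e he).1)
      obtain ⟨T, hT, hxT⟩ := List.mem_flatten.mp hx
      obtain ⟨j, hj, rfl⟩ := List.mem_iff_getElem.mp hT
      have hs : e.src ∈ (comps[j]).map Prod.fst := hxe ▸ List.mem_map_of_mem hxT
      have hd := hc.closed _ hT e.src e.dst ⟨e, he, Or.inl ⟨rfl, rfl⟩⟩ hs
      rw [((hkey j hj _).mp hs).2, ((hkey j hj _).mp hd).2]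
    refine (spec_gather comps.length key vs es).mono ?_
    rintro Gs u ⟨hG, hu⟩
    refine ⟨comps.length, key, hG, ?_, by simp only at *; omega⟩
    intro G hGmem
    obtain ⟨is, -, his, rfl⟩ := hG
    obtain ⟨i, hi, rfl⟩ := List.mem_map.mp hGmem
    obtain ⟨hic, hne⟩ := his i hi
    have hI := h.part hedge i
    refine ⟨hI, hne, ?_⟩
    obtain ⟨-, -, hF, -⟩ := spec_components _ _ hI.mem
    generalize (components (vertexPart key vs i, edgePart key es i).1
      (vertexPart key vs i, edgePart key es i).2).val = Ts at hF
    have hmemV : ∀ v, v ∈ vertexPart key vs i ↔ v ∈ (comps[i]).map Prod.fst := by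
      intro v
      rw [hkey i hic]
      simp [vertexPart]
    match Ts, hF with
    | [], hF =>
      exfalso
      obtain ⟨v, hv⟩ := List.exists_mem_of_ne_nil _ hne
      have := (hF.mem v).mpr hv
      simp at this
    | [T], hF => exact ⟨T, rfl⟩
    | T₁ :: T₂ :: Ts, hF =>
      exfalso
      have hsub : ∀ T ∈ T₁ :: T₂ :: Ts, ∀ v ∈ T.map Prod.fst, v ∈ (comps[i]).map Prod.fst := by
        intro T hT v hv
        rw [← hmemV, ← hF.mem]
        obtain ⟨x, hx, rfl⟩ := List.mem_map.mp hv
        exact List.mem_map_of_mem (List.mem_flatten.mpr ⟨_, hT, hx⟩)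
      obtain ⟨x, hx⟩ := List.exists_mem_of_ne_nil _ (hF.tree T₁ (by simp)).ne_nil
      obtain ⟨y, hy⟩ := List.exists_mem_of_ne_nil _ (hF.tree T₂ (by simp)).ne_nil
      have hcon := (hc.tree _ (List.getElem_mem hic)).connected (S := fun v => v ∈ T₁.map Prod.fst)
        (fun u hu v hv huv => by
          have hJ : Joined (edgePart key es i) u v := by
            obtain ⟨e, he, hh⟩ := huv
            refine ⟨e, ?_, hh⟩
            simp only [edgePart, List.mem_reverse, List.mem_filter, decide_eq_true_eq]
            refine ⟨he, ?_⟩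
            rcases hh with ⟨h', -⟩ | ⟨-, h'⟩
            · rw [h']
              exact ((hkey i hic u).mp hu).2
            · rw [h']
              exact ((hkey i hic v).mp hv).2
          exact ⟨hF.closed T₁ (by simp) u v hJ, hF.closed T₁ (by simp) v u hJ.symm⟩)
        x.1 (hsub T₁ (by simp) _ (List.mem_map_of_mem hx))
        y.1 (hsub T₂ (by simp) _ (List.mem_map_of_mem hy)) (List.mem_map_of_mem hx)
      have hn := hF.nodup
      rw [List.flatten_cons, List.map_append, List.nodup_append'] at hn
      refine hn.2.2 hcon ?_
      rw [List.flatten_cons, List.map_append, List.mem_append]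
      exact Or.inl (List.mem_map_of_mem hy)

end Instances

/-! ### Tarjan's algorithm and instances with at most one restricted edge -/

section StrongComponents

variable {V W : Type}

/-- The number of vertices that have not been visited. -/
def SccState.unnumbered (F : Finset V) (S : SccState V) : ℕ :=
  ∑ v ∈ F, if (S.num v).isNone then 1 else 0

theorem SccState.unnumbered_le {F : Finset V} {S S' : SccState V}
    (h : ∀ v, (S.num v).isSome → (S'.num v).isSome) : S'.unnumbered F ≤ S.unnumbered F := by
  refine Finset.sum_le_sum fun v _ => ?_
  have := h v
  cases h1 : S.num v <;> cases h2 : S'.num v <;> simp_all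

variable [DecidableEq V]

theorem spec_popTo (v : V) (st comp : List V) (on : Arr V Bool) :
    (popTo v st comp on).Spec fun r t => ∃ pre, st = pre ++ r.1 ∧ r.2.1 = pre.reverse ++ comp ∧
      t ≤ pre.length + 1 := by
  induction st generalizing comp on with
  | nil => simp [popTo]
  | cons u st ih =>
    rw [popTo, Step.spec_writeAt_bind]
    split_ifs with h
    · rw [Step.spec_pure]
      exact ⟨[u], rfl, rfl, by simp⟩
    · refine (ih (u :: comp) _).mono ?_
      rintro r t ⟨pre, h1, h2, h3⟩
      exact ⟨u :: pre, by rw [h1]; rfl, by rw [h2]; simp, by simp only [List.length_cons]; omega⟩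

/-- The number of steps that the depth-first search has still to pay for. -/
def SccState.potential (adj : Arr V (List V)) (F : Finset V) (S : SccState V) : ℕ :=
  ∑ v ∈ F, (if (S.num v).isNone then 10 + 6 * (adj v).length else 0) + 2 * S.stack.length +
    S.comps.length

/-- The vertices on the stack and in the components are distinct and numbered. -/
def SccState.Valid (F : Finset V) (S : SccState V) : Prop :=
  (S.stack ++ S.comps.flatten).Nodup ∧
    ∀ v ∈ S.stack ++ S.comps.flatten, v ∈ F ∧ (S.num v).isSome

/-- An unnumbered vertex holds enough credit for its visit, the inspection of its successors, its
place on the stack and the component that it may close. Each nested visit numbers a new vertex, so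
the number of unnumbered vertices bounds the depth of the recursion. That the components are
strongly connected is irrelevant for the time; only their disjointness is kept in `Valid`. -/
theorem spec_visit (adj : Arr V (List V)) (F : Finset V) (hF : ∀ v ∈ F, ∀ u ∈ adj v, u ∈ F)
    (f : ℕ) (v : V) (S : SccState V) (hv : v ∈ F) (hn : S.num v = none)
    (hf : S.unnumbered F ≤ f) (hS : S.Valid F) :
    (visit adj f v S).Spec fun S' t => S'.Valid F ∧
      (∀ u, (S.num u).isSome → (S'.num u).isSome) ∧
      t + S'.potential adj F ≤ S.potential adj F := by
  induction f generalizing v S with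
  | zero =>
    exfalso
    have : 1 ≤ S.unnumbered F := by
      refine le_trans ?_ (Finset.single_le_sum (f := fun v => if (S.num v).isNone then 1 else 0)
        (fun _ _ => Nat.zero_le _) hv)
      simp [hn]
    omega
  | succ f ih =>
    rw [visit]
    simp only [Step.spec_writeAt_bind, Step.spec_readAt_bind]
    set S₁ : SccState V := ⟨S.next + 1, Function.update S.num v (some S.next),
      Function.update S.low v S.next, Function.update S.onStack v true, v :: S.stack, S.comps⟩
      with hS₁
    have hmono₁ : ∀ u, (S.num u).isSome → (S₁.num u).isSome := by
      intro u hu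
      by_cases e : u = v
      · simp [hS₁, e]
      · simpa [hS₁, e] using hu
    have hcnt₁ : S₁.unnumbered F ≤ f := by
      have := sum_change (F := F) (g := fun u => if (S.num u).isNone then 1 else 0)
        (g' := fun u => if (S₁.num u).isNone then 1 else 0) hv
        (fun u hu => by simp [hS₁, Function.update_of_ne hu])
      simp only [hS₁, hn, Function.update_self, Option.isNone_none, if_true,
        Option.isNone_some, Bool.false_eq_true, if_false] at this
      simp only [SccState.unnumbered, hS₁] at hf ⊢
      omega
    have hpot₁ : S₁.potential adj F + 8 + 6 * (adj v).length ≤ S.potential adj F := by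
      have := sum_change (F := F)
        (g := fun u => if (S.num u).isNone then 10 + 6 * (adj u).length else 0)
        (g' := fun u => if (S₁.num u).isNone then 10 + 6 * (adj u).length else 0) hv
        (fun u hu => by simp [hS₁, Function.update_of_ne hu])
      simp only [hS₁, hn, Function.update_self, Option.isNone_none, if_true,
        Option.isNone_some, Bool.false_eq_true, if_false] at this
      simp only [SccState.potential, hS₁, List.length_cons]
      omega
    have hval₁ : S₁.Valid F := by
      have hvn : v ∉ S.stack ++ S.comps.flatten := fun h => by
        have := (hS.2 v h).2
        rw [hn] at this
        simp at this
      refine ⟨List.nodup_cons.mpr ⟨hvn, hS.1⟩, fun u hu => ?_⟩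
      rcases List.mem_cons.mp hu with rfl | hu
      · exact ⟨hv, by simp [hS₁]⟩
      · exact ⟨(hS.2 u hu).1, hmono₁ u (hS.2 u hu).2⟩
    refine Step.spec_bind (Step.spec_forEach
      (fun rem S' => (∀ u ∈ rem, u ∈ F) ∧ S'.Valid F ∧
        ∀ u, (S₁.num u).isSome → (S'.num u).isSome)
      (fun rem S' => 6 * rem.length + S'.potential adj F) ?_ ?_) ?_
    · rintro u rem S' ⟨h1, h2, h3⟩
      have hrem : ∀ w ∈ rem, w ∈ F := fun w hw => h1 w (List.mem_cons_of_mem _ hw)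
      simp only [Step.spec_readAt_bind, List.length_cons]
      cases hu : S'.num u with
      | none =>
        simp only
        refine Step.spec_bind (ih u S' (h1 u List.mem_cons_self) hu
          ((SccState.unnumbered_le h3).trans hcnt₁) h2) ?_
        rintro S'' t ⟨g1, g2, g3⟩
        simp only [Step.spec_readAt_bind, Step.spec_writeAt_bind, Step.spec_pure]
        refine ⟨⟨hrem, g1, fun w hw => g2 w (h3 w hw)⟩, ?_⟩
        simp only [SccState.potential] at g3 ⊢
        omega
      | some b =>
        simp only [Step.spec_readAt_bind]
        split_ifs
        · simp only [Step.spec_readAt_bind, Step.spec_writeAt_bind, Step.spec_pure]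
          refine ⟨⟨hrem, h2, h3⟩, ?_⟩
          simp only [SccState.potential]
          omega
        · simp only [Step.spec_pure]
          exact ⟨⟨hrem, h2, h3⟩, by omega⟩
    · exact ⟨hF v hv, hval₁, fun _ h => h⟩
    · rintro S₂ t₂ ⟨⟨-, h2, h3⟩, ht₂⟩
      simp only [List.length_nil] at ht₂
      rw [Step.spec_readAt_bind]
      split_ifs
      · refine Step.spec_bind (spec_popTo v S₂.stack [] S₂.onStack) ?_
        rintro r t₃ ⟨pre, e1, e2, ht₃⟩
        rw [Step.spec_pure]
        -- Popping only moves vertices from the stack into the new component, so validity persists.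
        have hperm : (r.1 ++ (r.2.1 :: S₂.comps).flatten).Perm (S₂.stack ++ S₂.comps.flatten) := by
          rw [e1, e2, List.flatten_cons, List.append_nil]
          rw [List.perm_iff_count]
          intro a
          simp
          omega
        refine ⟨⟨hperm.nodup_iff.mpr h2.1, fun u hu => h2.2 u (hperm.mem_iff.mp hu)⟩,
          fun u hu => h3 u (hmono₁ u hu), ?_⟩
        have e3 := congrArg List.length e1
        simp only [List.length_append] at e3
        simp only [SccState.potential, List.length_cons] at hpot₁ ht₂ ⊢
        omega
      · rw [Step.spec_pure]
        exact ⟨h2, fun u hu => h3 u (hmono₁ u hu), by omega⟩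

theorem spec_strongComponents (vs : List V) (adj : Arr V (List V))
    (hF : ∀ v ∈ vs, ∀ u ∈ adj v, u ∈ vs) :
    (strongComponents vs adj).Spec fun comps t => comps.flatten.Nodup ∧
      (∀ v ∈ comps.flatten, v ∈ vs) ∧
      t + comps.length ≤ 16 * vs.length + 6 * ∑ v ∈ vs.toFinset, (adj v).length + 3 := by
  unfold strongComponents
  refine Step.spec_bind (Step.spec_fill_default (α := Option ℕ) vs) ?_
  rintro _ t₁ ⟨rfl, h₁⟩
  refine Step.spec_bind (Step.spec_fill_default (α := Bool) vs) ?_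
  rintro _ t₂ ⟨rfl, h₂⟩
  set F := vs.toFinset with hFd
  have hF' : ∀ v ∈ F, ∀ u ∈ adj v, u ∈ F := by
    simpa [hFd] using hF
  refine Step.spec_bind (Step.spec_forEach
    (fun rem S' => (∀ u ∈ rem, u ∈ F) ∧ S'.Valid F)
    (fun rem S' => 2 * rem.length + S'.potential adj F) ?_ ?_) ?_
  · rintro u rem S' ⟨h1, h2⟩
    have hrem : ∀ w ∈ rem, w ∈ F := fun w hw => h1 w (List.mem_cons_of_mem _ hw)
    simp only [Step.spec_readAt_bind, List.length_cons]
    cases hu : S'.num u with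
    | none =>
      simp only
      refine (spec_visit adj F hF' (vs.length + 1) u S' (h1 u List.mem_cons_self) hu ?_ h2).mono ?_
      · have : S'.unnumbered F ≤ ∑ v ∈ F, 1 := Finset.sum_le_sum fun v _ => by split_ifs <;> simp
        have : F.card ≤ vs.length := List.toFinset_card_le vs
        simp only [Finset.sum_const, smul_eq_mul, mul_one] at *
        omega
      · rintro S'' t ⟨g1, -, g3⟩
        exact ⟨⟨hrem, g1⟩, by omega⟩
    | some b =>
      simp only [Step.spec_pure]
      exact ⟨⟨hrem, h2⟩, by omega⟩
  · exact ⟨fun u hu => List.mem_toFinset.mpr hu, by simp [SccState.Valid]⟩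
  · rintro S t ⟨⟨-, h⟩, ht⟩
    rw [Step.spec_pure]
    refine ⟨(List.nodup_append'.mp h.1).2.1, fun v hv =>
      List.mem_toFinset.mp (h.2 v (List.mem_append_right _ hv)).1, ?_⟩
    have hc : F.card ≤ vs.length := List.toFinset_card_le vs
    have e : ∑ v ∈ F, (10 + 6 * (adj v).length) = 10 * F.card + 6 * ∑ v ∈ F, (adj v).length := by
      simp [Finset.sum_add_distrib, Finset.mul_sum, mul_comm]
    have hd : (default : Option ℕ) = none := rfl
    simp only [SccState.potential, List.length_nil, hd, Option.isNone_none, if_true, e] at ht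
    omega

variable [LinearOrder W] [BoundedOrder W]

theorem sum_map_le_sum_finset {l : List V} {F : Finset V} (g : V → ℕ) (hl : l.Nodup)
    (h : ∀ v ∈ l, v ∈ F) : (l.map g).sum ≤ ∑ v ∈ F, g v := by
  rw [← List.sum_toFinset _ hl]
  exact Finset.sum_le_sum_of_subset fun v hv => h v (List.mem_toFinset.mp hv)

/-- The components returned are disjoint, so every list of successors is traversed at most once when
the maxima are propagated. -/
theorem spec_solveUnrestricted (vs : List V) (es : List (Edge V W)) (h : Arr V W)
    (hes : ∀ e ∈ es, e.src ∈ vs ∧ e.dst ∈ vs) :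
    (solveUnrestricted vs es h).Spec fun _ t => t ≤ 73 * vs.length + 37 * es.length + 20 := by
  unfold solveUnrestricted
  refine Step.spec_bind (spec_successors vs es) ?_
  rintro adj t₁ ⟨hadj, hsum, h₁⟩
  have hF : ∀ v ∈ vs, ∀ u ∈ adj v, u ∈ vs := by
    intro v _ u hu
    obtain ⟨e, he, rfl⟩ := hadj v u hu
    exact (hes e he).2
  refine Step.spec_bind (spec_strongComponents vs adj hF) ?_
  rintro comps t₂ ⟨hn, hmem, h₂⟩
  refine (Step.spec_forEach (fun _ _ => True)
    (fun rem _ => (rem.map fun comp => 4 + (comp.map fun v => 7 + 4 * (adj v).length).sum).sum)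
    ?_ trivial).mono ?_
  · rintro comp rem h -
    refine Step.spec_bind (Step.spec_forEach (fun _ _ => True) (fun rem _ => 3 * rem.length)
      ?_ trivial) ?_
    · rintro v rem b -
      simp only [Step.spec_readAt_bind, Step.spec_maxOf, List.length_cons]
      exact ⟨trivial, by omega⟩
    rintro best t ⟨-, ht⟩
    refine (Step.spec_forEach (fun _ _ => True)
      (fun rem _ => (rem.map fun v => 4 + 4 * (adj v).length).sum) ?_ trivial).mono ?_
    · rintro v rem h' -
      simp only [Step.spec_readAt_bind, Step.spec_writeAt_bind, List.map_cons, List.sum_cons]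
      refine (Step.spec_forEach (fun _ _ => True) (fun rem _ => 4 * rem.length) ?_ trivial).mono ?_
      · rintro u rem h'' -
        simp only [Step.spec_readAt_bind, Step.spec_maxOf_bind, Step.spec_writeAt, List.length_cons]
        exact ⟨trivial, by omega⟩
      · rintro h'' u ⟨-, hu⟩
        simp only [List.length_nil] at hu
        exact ⟨trivial, by omega⟩
    · rintro h' u ⟨-, hu⟩
      refine ⟨trivial, ?_⟩
      have e : (comp.map fun v => 7 + 4 * (adj v).length).sum =
          (comp.map fun v => 4 + 4 * (adj v).length).sum + 3 * comp.length := by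
        clear ht hu
        induction comp with
        | nil => simp
        | cons v comp ih => simp only [List.map_cons, List.sum_cons, List.length_cons, ih]; omega
      simp only [List.map_cons, List.sum_cons, List.map_nil, List.sum_nil, List.length_nil] at *
      omega
  · rintro h' u ⟨-, hu⟩
    have e1 : (comps.map fun comp => 4 + (comp.map fun v => 7 + 4 * (adj v).length).sum).sum =
        4 * comps.length + (comps.flatten.map fun v => 7 + 4 * (adj v).length).sum := by
      clear hn hmem h₂ hu
      induction comps with
      | nil => simp
      | cons comp comps ih =>
        simp only [List.map_cons, List.sum_cons, List.length_cons, List.flatten_cons,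
          List.map_append, List.sum_append, ih]
        omega
    have e2 := sum_map_le_sum_finset (F := vs.toFinset) (fun v => 7 + 4 * (adj v).length) hn
      (fun v hv => List.mem_toFinset.mpr (hmem v hv))
    have e3 : ∑ v ∈ vs.toFinset, (7 + 4 * (adj v).length) =
        7 * vs.toFinset.card + 4 * ∑ v ∈ vs.toFinset, (adj v).length := by
      simp [Finset.sum_add_distrib, Finset.mul_sum, mul_comm]
    have e4 := hsum vs.toFinset
    have e5 := List.toFinset_card_le vs
    rw [e1] at hu
    simp only [List.map_nil, List.sum_nil] at hu
    omega

theorem spec_solveBase (vs : List V) (es : List (Edge V W)) (h : Arr V W)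
    (hes : ∀ e ∈ es, e.src ∈ vs ∧ e.dst ∈ vs) :
    (solveBase vs es h).Spec fun _ t => t ≤ 90 * vs.length + 50 * es.length + 40 := by
  unfold solveBase
  refine Step.spec_bind (spec_classify es) ?_
  rintro ⟨rs, us⟩ t₁ ⟨hr, hu, hul, h₁⟩
  simp only at hr hu hul
  refine Step.spec_bind (spec_solveUnrestricted vs us h fun e he => hes e (hu e he)) ?_
  rintro d t₂ h₂
  cases rs with
  | nil =>
    simp only [Step.spec_pure]
    omega
  | cons e rs =>
    simp only [Step.spec_readAt_bind]
    have he : e ∈ es := by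
      have : e ∈ (restricted es).reverse := hr ▸ List.mem_cons_self
      exact (List.mem_filter.mp (List.mem_reverse.mp this)).1
    have hmin : ∀ x y : W, (minOf x y).Spec fun _ t => t ≤ 1 := by
      intro x y
      unfold minOf
      rw [Step.spec_leq_bind]
      split_ifs <;> simp
    refine Step.spec_bind (hmin _ _) ?_
    rintro x t₃ h₃
    refine Step.spec_bind (spec_successors vs es) ?_
    rintro adj t₄ ⟨hadj, hsum, h₄⟩
    refine Step.spec_bind (Step.spec_fill_default (α := Bool) vs) ?_
    rintro _ t₅ ⟨rfl, h₅⟩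
    set F := vs.toFinset with hFd
    have hd : (default : Bool) = false := rfl
    have hcard : F.card ≤ vs.length := List.toFinset_card_le vs
    refine Step.spec_bind (spec_explore adj F ?_
      -- A vertex is found only when it is marked for the first time; this bounds the number of
      -- values to be raised by the number of vertices.
      (fun _ seen found => found.length + ∑ v ∈ F, (if seen v then 0 else 1) ≤ F.card)
      (fun _ _ _ _ _ h => h) ?_ (2 * es.length + 2) [(e.dst, none)] (fun _ => default) [] ?_ ?_ ?_)
      ?_
    · intro v _ u hu
      obtain ⟨e', he', rfl⟩ := hadj v u hu
      exact List.mem_toFinset.mpr (hes e' he').2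
    · intro y st seen found hy hs hJ
      have := sum_change (F := F) (g := fun u => if seen u = true then 0 else 1)
        (g' := fun u => if Function.update seen y.1 true u = true then 0 else 1)
        hy (fun u hu => by simp only [Function.update_of_ne hu])
      simp only [hs, Function.update_self, if_true, Bool.false_eq_true, if_false] at this
      simp only [List.length_cons]
      omega
    · simpa [hFd] using (hes e he).2
    · have := hsum F
      simp only [hd, Bool.false_eq_true, if_false, List.length_cons, List.length_nil]
      omega
    · simp [hd]
    · rintro ⟨seen, found⟩ t₆ ⟨hlen, h₆⟩
      refine (Step.spec_forEach (fun _ _ => True) (fun rem _ => 4 * rem.length) ?_ trivial).mono ?_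
      · rintro v rem d' -
        simp only [Step.spec_readAt_bind, Step.spec_maxOf_bind, Step.spec_writeAt, List.length_cons]
        exact ⟨trivial, by omega⟩
      · rintro d' u ⟨-, hu'⟩
        have e4 := hsum F
        have e3 : ∑ v ∈ F, (4 + 2 * (adj v).length) = 4 * F.card + 2 * ∑ v ∈ F, (adj v).length := by
          simp [Finset.sum_add_distrib, Finset.mul_sum, mul_comm]
        simp only [hd, Bool.false_eq_true, if_false, List.length_cons, List.length_nil, e3]
          at hlen h₆ hu'
        omega

end StrongComponents

/-! ### Partition of a spanning tree into groups -/

section Partition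

variable {V W : Type}

/-- The number of distinct values of `lev` on `U`. -/
def numLevels (lev : V → ℕ) (U : List V) : ℕ := (U.map lev).toFinset.card

theorem numLevels_pos {lev : V → ℕ} {U : List V} {v : V} (h : v ∈ U) : 1 ≤ numLevels lev U :=
  Finset.card_pos.mpr ⟨lev v, List.mem_toFinset.mpr (List.mem_map_of_mem h)⟩

/-- If `u` and `v` have the same level, it is counted once in the union. With `u` and `v` the ends
of a tree edge, joining two subtrees thus raises the surplus of levels over one only at crossing
edges. -/
theorem numLevels_append_le {lev : V → ℕ} {A B : List V} {u v : V} (hu : u ∈ A) (hv : v ∈ B) :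
    numLevels lev (A ++ B) - 1 ≤
      (numLevels lev A - 1) + (numLevels lev B - 1) + if lev v ≠ lev u then 1 else 0 := by
  have h1 := numLevels_pos (lev := lev) hu
  have h2 := numLevels_pos (lev := lev) hv
  have h3 := Finset.card_union_add_card_inter (A.map lev).toFinset (B.map lev).toFinset
  have h4 : numLevels lev (A ++ B) = ((A.map lev).toFinset ∪ (B.map lev).toFinset).card := by
    rw [numLevels, List.map_append, List.toFinset_append]
  simp only [numLevels] at *
  split_ifs with h
  · omega
  · have : 1 ≤ ((A.map lev).toFinset ∩ (B.map lev).toFinset).card := by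
      refine Finset.card_pos.mpr ⟨lev u, Finset.mem_inter.mpr ⟨?_, ?_⟩⟩
      · exact List.mem_toFinset.mpr (List.mem_map_of_mem hu)
      · push Not at h
        rw [← h]
        exact List.mem_toFinset.mpr (List.mem_map_of_mem hv)
    omega

/-- The entries of a rope. -/
def Rope.toList {α : Type} : Rope α → List α
  | .nil => []
  | .one x => [x]
  | .join a b => a.toList ++ b.toList

/-- The number of nodes of a rope. -/
def Rope.nodes {α : Type} : Rope α → ℕ
  | .nil => 1
  | .one _ => 1
  | .join a b => a.nodes + b.nodes + 1

theorem spec_flatten {α : Type} (r : Rope α) (xs : List α) :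
    (r.flatten xs).Spec fun ys t => ys = r.toList ++ xs ∧ t = r.nodes := by
  induction r generalizing xs with
  | nil => simp [Rope.flatten, Rope.toList, Rope.nodes]
  | one x => simp [Rope.flatten, Rope.toList, Rope.nodes]
  | join a b iha ihb =>
    rw [Rope.flatten, Step.spec_tick_bind]
    refine Step.spec_bind (ihb xs) ?_
    rintro _ t ⟨rfl, rfl⟩
    refine (iha _).mono ?_
    rintro _ t ⟨rfl, rfl⟩
    exact ⟨by simp [Rope.toList], by simp only [Rope.nodes]; omega⟩

/-- The number of tree edges between different levels. -/
def crossings (lev : V → ℕ) (tree : List (V × Option V)) : ℕ :=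
  (tree.map fun x => match x.2 with
    | some p => if lev x.1 ≠ lev p then 1 else 0
    | none => 0).sum

/-- A crossing tree edge is charged to a graph edge between the same vertices, via the child.
Children are distinct, so a graph edge is charged at most twice: once for each end. -/
theorem crossings_le {es : List (Edge V W)} {tree : List (V × Option V)} [DecidableEq V]
    (h : IsTree (Joined es) tree) (lev : V → ℕ) :
    crossings lev tree ≤ 2 * (es.map fun e => if lev e.src ≠ lev e.dst then 1 else 0).sum := by
  set g : Edge V W → ℕ := fun e => if lev e.src ≠ lev e.dst then 1 else 0 with hg
  have key : crossings lev tree ≤ ((tree.map Prod.fst).map fun v =>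
      ((es.filter fun e => e.src = v).map g).sum + ((es.filter fun e => e.dst = v).map g).sum).sum := by
    clear_value g
    induction h with
    | root v => simp [crossings]
    | @cons v p t hp hv hR ht ih =>
      simp only [crossings, List.map_cons, List.sum_cons] at ih ⊢
      have : (if lev v ≠ lev p then 1 else 0) ≤
          ((es.filter fun e => e.src = v).map g).sum + ((es.filter fun e => e.dst = v).map g).sum := by
        split_ifs with hne
        · obtain ⟨e, he, ⟨h1, h2⟩ | ⟨h1, h2⟩⟩ := hR
          · have hge : g e = 1 := by
              rw [hg]
              simp only [h1, h2]
              exact if_pos fun e => hne e.symm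
            have := List.single_le_sum (l := (es.filter fun e => e.dst = v).map g)
              (fun _ _ => Nat.zero_le _) (g e) (List.mem_map_of_mem (by simp [he, h2]))
            omega
          · have hge : g e = 1 := by
              rw [hg]
              simp only [h1, h2]
              exact if_pos hne
            have := List.single_le_sum (l := (es.filter fun e => e.src = v).map g)
              (fun _ _ => Nat.zero_le _) (g e) (List.mem_map_of_mem (by simp [he, h2]))
            omega
        · exact Nat.zero_le _
      omega
  refine key.trans ?_
  rw [← List.sum_toFinset _ h.nodup, Finset.sum_add_distrib]
  have a := sum_filter_key (tree.map Prod.fst).toFinset (fun e : Edge V W => e.src) g es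
  have b := sum_filter_key (tree.map Prod.fst).toFinset (fun e : Edge V W => e.dst) g es
  omega

/-- The properties of the groups on which the analysis relies. -/
structure IsGrouping (s : ℕ) (tree : List (V × Option V)) (Us : List (List V)) : Prop where
  ne_nil : ∀ U ∈ Us, U ≠ []
  mem : ∀ U ∈ Us, ∀ v ∈ U, v ∈ tree.map Prod.fst
  length_le : ∀ U ∈ Us, U.length ≤ 3 * s
  sum_le : (Us.map List.length).sum ≤ 2 * tree.length
  large : (∀ U ∈ Us, s ≤ U.length) ∨ Us.length ≤ 1
  levels : ∀ lev : V → ℕ, (Us.map fun U => numLevels lev U - 1).sum ≤ crossings lev tree + 1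

/-- A pending set has at most `s` elements, so a reported union of two has between `s` and `2 * s`;
the set of the root can add another `s` at the end. A report leaves a copy of the parent behind, at
most one per vertex treated, which gives the total size `2 * tree.length`. -/
theorem spec_partitionTree [DecidableEq V] {R : V → V → Prop} {s : ℕ} (hs : 1 ≤ s)
    {tree : List (V × Option V)} (htree : IsTree R tree) :
    (partitionTree s tree).Spec fun Us t => IsGrouping s tree Us ∧ t ≤ 10 * tree.length + 2 := by
  unfold partitionTree
  refine Step.spec_bind (Step.spec_forEach_foldl (c := 1)
    (g := fun U (x : V × Option V) => Function.update U x.1 (Rope.one x.1, 1))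
    (by intro x U; simp)) ?_
  rintro U₀ t₀ ⟨hU₀, h₀⟩
  have hval : ∀ v ∈ tree.map Prod.fst, U₀ v = (Rope.one v, 1) := by
    rw [hU₀]
    clear hU₀ h₀ htree
    generalize (alloc : Arr V (Rope V × ℕ)) = U
    induction tree using List.reverseRecOn with
    | nil => simp
    | append_singleton tree x ih =>
      intro v hv
      rw [List.foldl_append, List.foldl_cons, List.foldl_nil]
      by_cases e : v = x.1
      · rw [e, Function.update_self]
      · rw [Function.update_of_ne e]
        refine ih v ?_
        rw [List.map_append, List.mem_append] at hv
        rcases hv with hv | hv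
        · exact hv
        · simp [e] at hv
  -- The summand `rem.length` of the size clause is the credit for future copies of parents. The
  -- bound on `nodes` makes flattening linear in the size of a group. In the last clause the surplus
  -- of levels is charged to crossings already treated, with one extra unit once the root is done.
  let I : List (V × Option V) → Arr V (Rope V × ℕ) × List (List V) → Prop := fun rem r =>
    (rem = [] ∨ IsTree R rem) ∧
    (∀ v ∈ rem.map Prod.fst, (r.1 v).1.toList.length = (r.1 v).2 ∧
      (r.1 v).1.nodes + 1 ≤ 2 * (r.1 v).2 ∧ v ∈ (r.1 v).1.toList ∧
      (∀ w ∈ (r.1 v).1.toList, w ∈ tree.map Prod.fst) ∧ (r.1 v).2 ≤ s) ∧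
    (∀ U ∈ r.2, U ≠ [] ∧ (∀ v ∈ U, v ∈ tree.map Prod.fst) ∧ U.length ≤ 3 * s ∧
      (rem ≠ [] → s ≤ U.length ∧ U.length ≤ 2 * s)) ∧
    ((∀ U ∈ r.2, s ≤ U.length) ∨ r.2.length ≤ 1) ∧
    (r.2.map List.length).sum + ∑ v ∈ (rem.map Prod.fst).toFinset, (r.1 v).2 + rem.length ≤
      2 * tree.length ∧
    ∀ lev : V → ℕ, (r.2.map fun U => numLevels lev U - 1).sum +
      ∑ v ∈ (rem.map Prod.fst).toFinset, (numLevels lev (r.1 v).1.toList - 1) +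
      crossings lev rem ≤ crossings lev tree + if rem = [] then 1 else 0
  refine Step.spec_bind (Step.spec_forEach I
    (fun rem r => 6 * rem.length + 2 * ∑ v ∈ (rem.map Prod.fst).toFinset, (r.1 v).2) ?_ ?_) ?_
  · rintro ⟨v, q⟩ rem ⟨U, Us⟩ ⟨h1, h2, h3, h4, h5, h6⟩
    rcases h1 with h1 | h1
    · exact absurd h1 (by simp)
    simp only [Step.spec_readAt_bind, List.map_cons, List.toFinset_cons] at h2 h3 h4 h5 h6 ⊢
    cases h1 with
    | root =>
      obtain ⟨g1, g2, g3, g4, g5⟩ := h2 v (by simp)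
      simp only [List.map_nil, List.toFinset_nil, insert_empty_eq, Finset.sum_singleton,
        List.length_cons, List.length_nil, List.cons_ne_nil, if_false] at h5 h6 ⊢
      cases Us with
      | nil =>
        simp only
        refine Step.spec_bind (spec_flatten _ _) ?_
        rintro _ t ⟨rfl, rfl⟩
        rw [Step.spec_pure]
        refine ⟨⟨Or.inl rfl, by simp, ?_, Or.inr (by simp), ?_, ?_⟩, ?_⟩
        · intro X hX
          rw [List.append_nil, List.mem_singleton] at hX
          subst hX
          exact ⟨List.ne_nil_of_mem g3, g4, by omega, fun h => absurd rfl h⟩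
        · simp only [List.map_nil, List.sum_nil] at h5
          simp only [List.append_nil, List.map_cons, List.map_nil, List.sum_cons, List.sum_nil,
            List.toFinset_nil, Finset.sum_empty, List.length_nil]
          omega
        · intro lev
          have := h6 lev
          simp only [List.map_nil, List.sum_nil] at this
          simp only [List.append_nil, List.map_cons, List.map_nil, List.sum_cons, List.sum_nil,
            List.toFinset_nil, Finset.sum_empty, if_true]
          have e : crossings lev ([] : List (V × Option V)) = 0 := rfl
          omega
        · rw [Finset.sum_empty]
          omega
      | cons g gs =>
        simp only
        refine Step.spec_bind (spec_flatten _ _) ?_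
        rintro _ t ⟨rfl, rfl⟩
        rw [Step.spec_pure]
        obtain ⟨k1, k2, k3, k4⟩ := h3 g List.mem_cons_self
        have k5 := k4 (by simp)
        refine ⟨⟨Or.inl rfl, by simp, ?_, Or.inl ?_, ?_, ?_⟩, ?_⟩
        · intro X hX
          rcases List.mem_cons.mp hX with rfl | hX
          · refine ⟨by simp [k1], ?_, ?_, fun h => absurd rfl h⟩
            · intro w hw
              rcases List.mem_append.mp hw with hw | hw
              · exact g4 w hw
              · exact k2 w hw
            · rw [List.length_append]
              omega
          · obtain ⟨k1, k2, k3, k4⟩ := h3 X (List.mem_cons_of_mem _ hX)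
            exact ⟨k1, k2, k3, fun h => absurd rfl h⟩
        · intro X hX
          rcases List.mem_cons.mp hX with rfl | hX
          · rw [List.length_append]
            omega
          · exact ((h3 X (List.mem_cons_of_mem _ hX)).2.2.2 (by simp)).1
        · simp only [List.map_cons, List.sum_cons] at h5
          simp only [List.map_cons, List.map_nil, List.sum_cons, List.length_append,
            List.toFinset_nil, Finset.sum_empty, List.length_nil]
          omega
        · intro lev
          have := h6 lev
          simp only [List.map_cons, List.sum_cons] at this
          -- The set of the root and the last group need not be joined by a tree edge; an arbitrary
          -- `w` of the group is used, and the possible loss is the extra unit.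
          obtain ⟨w, hw⟩ := List.exists_mem_of_ne_nil _ k1
          have hl := numLevels_append_le (lev := lev) g3 hw
          simp only [List.map_cons, List.map_nil, List.sum_cons,
            List.toFinset_nil, Finset.sum_empty, if_true]
          have e : crossings lev ([] : List (V × Option V)) = 0 := rfl
          split_ifs at hl <;> omega
        · rw [Finset.sum_empty]
          omega
    | @cons _ p _ hp hv hR ht =>
      have hne : rem ≠ [] := ht.ne_nil
      have hpF : p ∈ (rem.map Prod.fst).toFinset := List.mem_toFinset.mpr hp
      have hvF : v ∉ (rem.map Prod.fst).toFinset := fun h => hv (List.mem_toFinset.mp h)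
      obtain ⟨a1, a2, a3, a4, a5⟩ := h2 v (by simp)
      obtain ⟨b1, b2, b3, b4, b5⟩ := h2 p (List.mem_cons_of_mem _ hp)
      have h2' : ∀ u ∈ rem.map Prod.fst, u ≠ p → (U u).1.toList.length = (U u).2 ∧
          (U u).1.nodes + 1 ≤ 2 * (U u).2 ∧ u ∈ (U u).1.toList ∧
          (∀ w ∈ (U u).1.toList, w ∈ tree.map Prod.fst) ∧ (U u).2 ≤ s :=
        fun u hu _ => h2 u (List.mem_cons_of_mem _ hu)
      simp only [Finset.sum_insert hvF, List.length_cons, List.cons_ne_nil, if_false,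
        Step.spec_readAt_bind] at h5 h6 ⊢
      have hc : ∀ lev, crossings lev ((v, some p) :: rem) =
          (if lev v ≠ lev p then 1 else 0) + crossings lev rem := fun lev => by
        simp [crossings]
      have s1 : ∀ X : Rope V × ℕ, ∑ u ∈ (rem.map Prod.fst).toFinset, (Function.update U p X u).2 +
          (U p).2 = ∑ u ∈ (rem.map Prod.fst).toFinset, (U u).2 + X.2 := fun X => by
        have := sum_change (g := fun u => (U u).2) (g' := fun u => (Function.update U p X u).2)
          hpF (fun u hu => by simp only [Function.update_of_ne hu])
        simpa only [Function.update_self] using this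
      have s2 : ∀ (lev : V → ℕ) (X : Rope V × ℕ), ∑ u ∈ (rem.map Prod.fst).toFinset,
          (numLevels lev (Function.update U p X u).1.toList - 1) +
          (numLevels lev (U p).1.toList - 1) = ∑ u ∈ (rem.map Prod.fst).toFinset,
          (numLevels lev (U u).1.toList - 1) + (numLevels lev X.1.toList - 1) := fun lev X => by
        have := sum_change (g := fun u => numLevels lev (U u).1.toList - 1)
          (g' := fun u => numLevels lev (Function.update U p X u).1.toList - 1)
          hpF (fun u hu => by simp only [Function.update_of_ne hu])
        simpa only [Function.update_self] using this
      split_ifs with hsize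
      · refine Step.spec_bind (spec_flatten _ _) ?_
        rintro _ t ⟨rfl, rfl⟩
        simp only [Step.spec_writeAt_bind, Step.spec_pure, Rope.toList, List.append_nil,
          Rope.nodes]
        refine ⟨⟨Or.inr ht, ?_, ?_, Or.inl ?_, ?_, ?_⟩, ?_⟩
        · intro u hu
          by_cases e : u = p
          · subst e
            simp only [Function.update_self, Rope.toList, Rope.nodes, List.length_cons,
              List.length_nil, List.mem_singleton, forall_eq]
            exact ⟨trivial, by omega, trivial, b4 u b3, hs⟩
          · simp only [Function.update_of_ne e]
            exact h2' u hu e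
        · intro X hX
          rcases List.mem_cons.mp hX with rfl | hX
          · simp only [List.length_append, List.mem_append]
            refine ⟨by simp [List.ne_nil_of_mem b3], ?_, by omega, fun _ => ⟨by omega, by omega⟩⟩
            rintro w (hw | hw)
            · exact b4 w hw
            · exact a4 w hw
          · obtain ⟨k1, k2, k3, k4⟩ := h3 X hX
            exact ⟨k1, k2, k3, fun _ => k4 (by simp)⟩
        · intro X hX
          rcases List.mem_cons.mp hX with rfl | hX
          · rw [List.length_append]
            omega
          · exact ((h3 X hX).2.2.2 (by simp)).1
        · have := s1 (Rope.one p, 1)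
          simp only [List.map_cons, List.sum_cons, List.length_append]
          omega
        · intro lev
          have k1 := s2 lev (Rope.one p, 1)
          have k2 := h6 lev
          have k3 := hc lev
          have k4 := numLevels_append_le (lev := lev) b3 a3
          have k5 : numLevels lev (Rope.one p).toList = 1 := by simp [numLevels, Rope.toList]
          simp only [List.map_cons, List.sum_cons, hne, if_false] at k1 ⊢
          omega
        · have := s1 (Rope.one p, 1)
          simp only at this
          omega
      · simp only [Step.spec_writeAt_bind, Step.spec_pure]
        refine ⟨⟨Or.inr ht, ?_, ?_, h4, ?_, ?_⟩, ?_⟩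
        · intro u hu
          by_cases e : u = p
          · subst e
            simp only [Function.update_self, Rope.toList, Rope.nodes, List.length_append,
              List.mem_append]
            refine ⟨by omega, by omega, Or.inl b3, ?_, by omega⟩
            rintro w (hw | hw)
            · exact b4 w hw
            · exact a4 w hw
          · simp only [Function.update_of_ne e]
            exact h2' u hu e
        · intro X hX
          obtain ⟨k1, k2, k3, k4⟩ := h3 X hX
          exact ⟨k1, k2, k3, fun _ => k4 (by simp)⟩
        · have := s1 (Rope.join (U p).1 (U v).1, (U p).2 + (U v).2)
          simp only at this ⊢
          omega
        · intro lev
          have k1 := s2 lev (Rope.join (U p).1 (U v).1, (U p).2 + (U v).2)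
          have k2 := h6 lev
          have k3 := hc lev
          have k4 := numLevels_append_le (lev := lev) b3 a3
          simp only [Rope.toList, hne, if_false] at k1 ⊢
          omega
        · have := s1 (Rope.join (U p).1 (U v).1, (U p).2 + (U v).2)
          simp only at this ⊢
          omega
  · have hsum : ∑ v ∈ (tree.map Prod.fst).toFinset, (U₀ v).2 = tree.length := by
      rw [Finset.sum_congr rfl fun v hv => by rw [hval v (List.mem_toFinset.mp hv)]]
      rw [Finset.sum_const, List.toFinset_card_of_nodup htree.nodup]
      simp
    refine ⟨Or.inr htree, ?_, by simp, Or.inr (by simp), ?_, ?_⟩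
    · intro v hv
      simp only [hval v hv]
      simpa [Rope.toList, Rope.nodes, hs] using hv
    · simp only [hsum, List.map_nil, List.sum_nil]
      omega
    · intro lev
      have : ∑ v ∈ (tree.map Prod.fst).toFinset, (numLevels lev (U₀ v).1.toList - 1) = 0 :=
        Finset.sum_eq_zero fun v hv => by
          rw [hval v (List.mem_toFinset.mp hv)]
          simp [numLevels, Rope.toList]
      simp only [this, List.map_nil, List.sum_nil]
      omega
  · rintro ⟨U, Us⟩ t ⟨⟨h1, h2, h3, h4, h5, h6⟩, ht⟩
    rw [Step.spec_pure]
    have hsum : ∑ v ∈ (tree.map Prod.fst).toFinset, (U₀ v).2 = tree.length := by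
      rw [Finset.sum_congr rfl fun v hv => by rw [hval v (List.mem_toFinset.mp hv)]]
      rw [Finset.sum_const, List.toFinset_card_of_nodup htree.nodup]
      simp
    refine ⟨⟨fun X hX => (h3 X hX).1, fun X hX => (h3 X hX).2.1, fun X hX => (h3 X hX).2.2.1,
      by simp only at *; omega, h4, fun lev => ?_⟩, ?_⟩
    · have := h6 lev
      simp only [if_true] at this
      simp only
      omega
    · simp only [hsum] at ht
      omega

end Partition

/-! ### Labels, buckets and scanning in the split algorithm -/

section Split

variable {V W : Type}

/-- The number of distinct values of `lev` on `U` that are less than `i`. -/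
def numLevelsBelow (lev : V → ℕ) (i : ℕ) (U : List V) : ℕ :=
  ((U.map lev).toFinset.filter (· < i)).card

/-- The level of `u` counts below `i` but not below `j`. This drop pays for moving a group from
bucket `i` to bucket `j`. -/
theorem numLevelsBelow_lt {lev : V → ℕ} {i j : ℕ} {U : List V} {u : V} (hu : u ∈ U)
    (hj : j ≤ lev u) (hi : lev u < i) : numLevelsBelow lev j U + 1 ≤ numLevelsBelow lev i U := by
  refine Finset.card_lt_card (Finset.ssubset_iff_of_subset ?_ |>.mpr ⟨lev u, ?_, ?_⟩)
  · intro x hx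
    rw [Finset.mem_filter] at hx ⊢
    exact ⟨hx.1, by omega⟩
  · exact Finset.mem_filter.mpr ⟨List.mem_toFinset.mpr (List.mem_map_of_mem hu), hi⟩
  · simp only [Finset.mem_filter, not_and]
    omega

theorem numLevelsBelow_le {lev : V → ℕ} {j : ℕ} {U : List V} {u : V} (hu : u ∈ U)
    (hj : j ≤ lev u) : numLevelsBelow lev j U ≤ numLevels lev U - 1 := by
  have : numLevelsBelow lev j U < numLevels lev U := by
    refine Finset.card_lt_card (Finset.ssubset_iff_of_subset (Finset.filter_subset _ _) |>.mpr
      ⟨lev u, List.mem_toFinset.mpr (List.mem_map_of_mem hu), ?_⟩)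
    simp only [Finset.mem_filter, not_and]
    omega
  omega

/-- Maximality of the capacity is dropped: the charging argument works with any unlabelled vertex of
the group. -/
theorem spec_groupMax [LinearOrder W] (h : Arr V W) (lab : Arr V (Option ℕ)) (U : List V) :
    (groupMax h lab U).Spec fun o t => (∀ u, o = some u → u ∈ U ∧ lab u = none) ∧
      t ≤ 5 * U.length + 1 := by
  refine (Step.spec_forEach
    (fun rem (o : Option V) => (∀ u, o = some u → u ∈ U ∧ lab u = none) ∧ ∀ u ∈ rem, u ∈ U)
    (fun rem _ => 5 * rem.length) ?_ ?_).mono ?_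
  · rintro u rem o ⟨h1, h2⟩
    have h2' : ∀ u ∈ rem, u ∈ U := fun v hv => h2 v (List.mem_cons_of_mem _ hv)
    have hu := h2 u List.mem_cons_self
    simp only [Step.spec_readAt_bind, List.length_cons]
    cases hlab : lab u with
    | some a =>
      simp only [Step.spec_pure]
      exact ⟨⟨h1, h2'⟩, by omega⟩
    | none =>
      have hnew : ∀ v, some u = some v → v ∈ U ∧ lab v = none := by
        intro v hv
        obtain rfl := Option.some.inj hv
        exact ⟨hu, hlab⟩
      cases o with
      | none =>
        simp only [Step.spec_pure]
        exact ⟨⟨hnew, h2'⟩, by omega⟩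
      | some b =>
        simp only [Step.spec_readAt_bind, Step.spec_leq_bind]
        split_ifs
        · simp only [Step.spec_pure]
          exact ⟨⟨hnew, h2'⟩, by omega⟩
        · simp only [Step.spec_pure]
          exact ⟨⟨h1, h2'⟩, by omega⟩
  · simp
  · rintro o t ⟨⟨h1, -⟩, ht⟩
    simp only [List.length_nil] at ht
    exact ⟨h1, by omega⟩

namespace SplitState

/-- The entries of the buckets of active vertices are distinct, and their labels have not
decreased. -/
def Valid (F : Finset V) (S : SplitState V) : Prop :=
  ∀ j, (S.C j).Nodup ∧ ∀ u ∈ S.C j, u ∈ F ∧ ∃ a, S.lab u = some a ∧ j ≤ a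

/-- The total size of the buckets of active vertices. -/
def active (l : ℕ) (S : SplitState V) : ℕ := ∑ j ∈ Finset.range (l + 1), (S.C j).length

/-- The total weight of the vertices with label `i`. -/
def labelled (F : Finset V) (i : ℕ) (w : V → ℕ) (S : SplitState V) : ℕ :=
  ∑ v ∈ F, if S.lab v = some i then w v else 0

/-- The total weight of the vertices with label `i` that have still to be scanned. -/
def pending (i : ℕ) (w : V → ℕ) (S : SplitState V) : ℕ :=
  ((S.C i).map fun v => if S.lab v = some i then w v else 0).sum

/-- An upper bound for the number of entries that will be taken out of bucket `i`. -/
def supply (F : Finset V) (i : ℕ) (S : SplitState V) : ℕ :=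
  ∑ v ∈ F, (match S.lab v with
    | none => 1
    | some a => if a < i then 1 else 0) + (S.C i).length

/-- The labels change from `S` to `S'` as they may do while label `i` is treated. -/
def Raised [LE W] (h : V → W) (lam : ℕ → W) (i : ℕ) (S S' : SplitState V) : Prop :=
  ∀ v, S'.lab v = S.lab v ∨ ∃ b ≤ i, S'.lab v = some b ∧ (∀ a, S.lab v = some a → a < b) ∧
    ∀ j ≤ i, lam j ≤ h v → j ≤ b

/-- `S'` arises from `S` by activations of vertices while label `i` is treated. -/
structure Advances [LE W] (F : Finset V) (h : V → W) (lam : ℕ → W) (i : ℕ)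
    (S S' : SplitState V) : Prop where
  groups : S'.B = S.B
  valid : S'.Valid F
  raised : Raised h lam i S S'
  weights : ∀ w, S'.labelled F i w + S.pending i w = S.labelled F i w + S'.pending i w
  supply_le : S'.supply F i ≤ S.supply F i

variable {F : Finset V} {lam : ℕ → W} {h : V → W} {i l : ℕ} {S S' S'' : SplitState V}

theorem Raised.refl [LE W] (h : V → W) (lam : ℕ → W) (i : ℕ) (S : SplitState V) :
    Raised h lam i S S := fun _ => Or.inl rfl

theorem Raised.trans [LE W] (h₁ : Raised h lam i S S') (h₂ : Raised h lam i S' S'') :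
    Raised h lam i S S'' := by
  intro v
  rcases h₁ v with e₁ | ⟨b, hb, e₁, h₁, h₁'⟩ <;> rcases h₂ v with e₂ | ⟨b', hb', e₂, h₂, h₂'⟩
  · exact Or.inl (e₂.trans e₁)
  · exact Or.inr ⟨b', hb', e₂, e₁ ▸ h₂, h₂'⟩
  · exact Or.inr ⟨b, hb, e₂.trans e₁, h₁, h₁'⟩
  · exact Or.inr ⟨b', hb', e₂, fun a ha => (h₁ a ha).trans (h₂ b e₁), h₂'⟩

theorem Advances.refl [LE W] (h : V → W) (lam : ℕ → W) (i : ℕ) (hS : S.Valid F) :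
    Advances F h lam i S S := ⟨rfl, hS, Raised.refl h lam i S, fun _ => rfl, le_rfl⟩

theorem Advances.trans [LE W] (h₁ : Advances F h lam i S S') (h₂ : Advances F h lam i S' S'') :
    Advances F h lam i S S'' := by
  refine ⟨h₂.groups.trans h₁.groups, h₂.valid, h₁.raised.trans h₂.raised, fun w => ?_,
    h₂.supply_le.trans h₁.supply_le⟩
  have a := h₁.weights w
  have b := h₂.weights w
  omega

/-- An entry of bucket `i` has a label of at least `i`, so no vertex contributes to both summands of
`supply`. -/
theorem Valid.supply_le (hS : S.Valid F) (i : ℕ) : S.supply F i ≤ F.card := by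
  classical
  have h1 : (S.C i).length = ∑ v ∈ F, if v ∈ S.C i then 1 else 0 := by
    rw [← Finset.card_filter, ← List.toFinset_card_of_nodup (hS i).1]
    congr 1
    ext v
    simp only [List.mem_toFinset, Finset.mem_filter]
    exact ⟨fun hv => ⟨((hS i).2 v hv).1, hv⟩, fun hv => hv.2⟩
  rw [supply, h1, ← Finset.sum_add_distrib, Finset.card_eq_sum_ones]
  refine Finset.sum_le_sum fun v _ => ?_
  by_cases hv : v ∈ S.C i
  · obtain ⟨-, a, ha, hia⟩ := (hS i).2 v hv
    simp only [ha, hv, if_true]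
    rw [if_neg (by omega)]
  · rw [if_neg hv]
    cases S.lab v with
    | none => simp
    | some a =>
      simp only
      split_ifs <;> simp

theorem Valid.pending_le (hS : S.Valid F) (i : ℕ) (w : V → ℕ) :
    S.pending i w ≤ S.labelled F i w := by
  classical
  exact sum_map_le_sum_finset _ (hS i).1 fun v hv => ((hS i).2 v hv).1

end SplitState

open SplitState

variable [DecidableEq V]

/-- The state after the activation of `v` with label `i`. -/
def SplitState.activated (i : ℕ) (v : V) (S : SplitState V) : SplitState V :=
  ⟨Function.update S.lab v (some i), S.B, Function.update S.C i (v :: S.C i)⟩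

theorem lab_activated_of_ne {i : ℕ} {u v : V} (h : u ≠ v) (S : SplitState V) :
    (S.activated i v).lab u = S.lab u := Function.update_of_ne h ..

theorem spec_activate {i : ℕ} {v : V} {S : SplitState V} {R : SplitState V → ℕ → Prop} :
    (activate i v S).Spec R ↔ R (S.activated i v) 3 := by
  simp [activate, SplitState.activated]

theorem active_activated_le (l i : ℕ) (v : V) (S : SplitState V) :
    (S.activated i v).active l ≤ S.active l + 1 :=
  sum_length_update_cons (Finset.range (l + 1)) S.C i v

/-- As the old label is less than `j`, the vertex is in no bucket from `j` on, so buckets stay free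
of repetitions. For `j = i` its weight enters `labelled` and `pending` alike, and in `supply` it
changes from a possible to an actual entry; for `j < i` these three quantities do not change. -/
theorem advances_activated [LE W] {F : Finset V} {lam : ℕ → W} {h : V → W} {i j : ℕ}
    {S : SplitState V} {v : V} (hS : S.Valid F) (hv : v ∈ F) (hlab : ∀ a, S.lab v = some a → a < j)
    (hj : j ≤ i) (hcap : ∀ j' ≤ i, lam j' ≤ h v → j' ≤ j) :
    Advances F h lam i S (S.activated j v) := by
  have hnot : ∀ j', j ≤ j' → v ∉ S.C j' := by
    intro j' hj' hmem
    obtain ⟨-, a, ha, hja⟩ := (hS j').2 v hmem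
    have := hlab a ha
    omega
  refine ⟨rfl, ?_, ?_, ?_, ?_⟩
  · intro j'
    have hold : ∀ u ∈ S.C j', u ∈ F ∧ ∃ a, (S.activated j v).lab u = some a ∧ j' ≤ a := by
      intro u hu
      obtain ⟨h1, a, ha, hja⟩ := (hS j').2 u hu
      refine ⟨h1, ?_⟩
      by_cases e : u = v
      · subst e
        exact ⟨j, Function.update_self .., hja.trans (hlab a ha).le⟩
      · exact ⟨a, by rw [lab_activated_of_ne e, ha], hja⟩
    by_cases e : j' = j
    · subst e
      have hC : (S.activated j' v).C j' = v :: S.C j' := Function.update_self ..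
      rw [hC]
      refine ⟨List.nodup_cons.mpr ⟨hnot j' le_rfl, (hS j').1⟩, fun u hu => ?_⟩
      rcases List.mem_cons.mp hu with rfl | hu
      · exact ⟨hv, j', Function.update_self .., le_rfl⟩
      · exact hold u hu
    · have hC : (S.activated j v).C j' = S.C j' := Function.update_of_ne e ..
      rw [hC]
      exact ⟨(hS j').1, hold⟩
  · intro u
    by_cases e : u = v
    · subst e
      exact Or.inr ⟨j, hj, Function.update_self .., hlab, hcap⟩
    · exact Or.inl (Function.update_of_ne e ..)
  · intro w
    have hmap : (S.C i).map (fun u => if (S.activated j v).lab u = some i then w u else 0) =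
        (S.C i).map fun u => if S.lab u = some i then w u else 0 := by
      refine List.map_congr_left fun u hu => ?_
      have : u ≠ v := by
        rintro rfl
        exact hnot i hj hu
      rw [lab_activated_of_ne this]
    have hsum := sum_change (F := F) (g := fun u => if S.lab u = some i then w u else 0)
      (g' := fun u => if (S.activated j v).lab u = some i then w u else 0) hv
      (fun u hu => by rw [lab_activated_of_ne hu])
    have hv1 : (S.activated j v).lab v = some j := Function.update_self ..
    have hv2 : S.lab v ≠ some i := fun e => by
      have := hlab i e
      omega
    simp only [hv1, hv2, if_false, Option.some.injEq] at hsum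
    simp only [labelled, pending]
    by_cases e : i = j
    · subst e
      have hC : (S.activated i v).C i = v :: S.C i := Function.update_self ..
      rw [hC, List.map_cons, List.sum_cons, hmap, hv1]
      simp only [if_true] at hsum ⊢
      omega
    · have hC : (S.activated j v).C i = S.C i := Function.update_of_ne e ..
      rw [hC, hmap]
      rw [if_neg fun e' => e e'.symm] at hsum
      omega
  · have hsum := sum_change (F := F)
      (g := fun u => (match S.lab u with | none => 1 | some a => if a < i then 1 else 0 : ℕ))
      (g' := fun u => (match (S.activated j v).lab u with
        | none => 1 | some a => if a < i then 1 else 0 : ℕ)) hv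
      (fun u hu => by rw [lab_activated_of_ne hu])
    have hv1 : (S.activated j v).lab v = some j := Function.update_self ..
    have hv2 : (match S.lab v with | none => 1 | some a => if a < i then 1 else 0 : ℕ) = 1 := by
      cases e : S.lab v with
      | none => rfl
      | some a => exact if_pos ((hlab a e).trans_le hj)
    simp only [hv1, hv2] at hsum
    simp only [supply]
    by_cases e : i = j
    · subst e
      have hC : (S.activated i v).C i = v :: S.C i := Function.update_self ..
      rw [hC, List.length_cons]
      simp only [lt_irrefl, if_false] at hsum
      omega
    · have hC : (S.activated j v).C i = S.C i := Function.update_of_ne e ..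
      rw [hC]
      split_ifs at hsum <;> omega

variable [LinearOrder W]

/-- Of the charge 12 for a vertex of a group, 7 cover the loop round and the activation; 5 are
deposited with the new bucket entry for its later removal. -/
theorem spec_release {F : Finset V} {h : Arr V W} {lam : Arr ℕ W} {l i : ℕ}
    {S : SplitState V} (hS : S.Valid F) (hB : ∀ U ∈ S.B i, ∀ u ∈ U, u ∈ F) :
    (release h lam i S).Spec fun S' t => Advances F h lam i S S' ∧
      (∀ U ∈ S.B i, ∀ u ∈ U, lam i ≤ h u → S'.lab u ≠ none) ∧
      t + 5 * S'.active l ≤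
        5 * S.active l + ((S.B i).map fun U => 12 * U.length + 2).sum + 3 := by
  unfold release
  simp only [Step.spec_readAt_bind]
  have hpersist : ∀ {S₁ S₂ : SplitState V}, Raised h lam i S₁ S₂ → ∀ {u}, S₁.lab u ≠ none →
      S₂.lab u ≠ none := by
    intro S₁ S₂ hR u hu
    rcases hR u with e | ⟨b, -, e, -⟩
    · rwa [e]
    · simp [e]
  refine (Step.spec_forEach
    (fun rem S' => Advances F h lam i S S' ∧ (∀ U ∈ rem, U ∈ S.B i) ∧
      ∀ U ∈ S.B i, U ∉ rem → ∀ u ∈ U, lam i ≤ h u → S'.lab u ≠ none)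
    (fun rem S' => (rem.map fun U => 12 * U.length + 2).sum + 5 * S'.active l) ?_ ?_).mono ?_
  · rintro U rem S₁ ⟨h1, h2, h3⟩
    have hU := hB U (h2 U List.mem_cons_self)
    refine (Step.spec_forEach
      (fun rem S' => Advances F h lam i S₁ S' ∧ (∀ u ∈ rem, u ∈ U) ∧
        ∀ u ∈ U, u ∉ rem → lam i ≤ h u → S'.lab u ≠ none)
      (fun rem S' => 12 * rem.length + 5 * S'.active l) ?_ ?_).mono ?_
    · rintro u us S₂ ⟨k1, k2, k3⟩
      have k2' : ∀ u' ∈ us, u' ∈ U := fun u' hu' => k2 u' (List.mem_cons_of_mem _ hu')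
      simp only [Step.spec_readAt_bind, List.length_cons]
      have hk3 : ∀ S' : SplitState V, Raised h lam i S₂ S' → (lam i ≤ h u → S'.lab u ≠ none) →
          ∀ u' ∈ U, u' ∉ us → lam i ≤ h u' → S'.lab u' ≠ none := by
        intro S' hR hu u' hu' hn hl
        by_cases e : u' = u
        · rw [e] at hl ⊢
          exact hu hl
        · exact hpersist hR (k3 u' hu' (by simp [e, hn]) hl)
      cases hlab : S₂.lab u with
      | some a =>
        simp only [Step.spec_pure]
        exact ⟨⟨k1, k2', hk3 S₂ (Raised.refl _ _ _ _) fun _ => by simp [hlab]⟩, by omega⟩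
      | none =>
        simp only [Step.spec_readAt_bind, Step.spec_leq_bind]
        by_cases hl : lam i ≤ h u
        · simp only [hl, decide_true, if_true, spec_activate]
          have hA := advances_activated (lam := lam) (h := h) (i := i) k1.valid
            (hU u (k2 u List.mem_cons_self)) (j := i) (by simp [hlab]) le_rfl (fun _ hj _ => hj)
          refine ⟨⟨k1.trans hA, k2', hk3 _ hA.raised fun _ => ?_⟩, ?_⟩
          · simp [SplitState.activated]
          · have := active_activated_le l i u S₂
            omega
        · simp only [hl, decide_false, Bool.false_eq_true, if_false, Step.spec_pure]
          exact ⟨⟨k1, k2', hk3 S₂ (Raised.refl _ _ _ _) fun h' => absurd h' hl⟩, by omega⟩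
    · exact ⟨Advances.refl h lam i h1.valid, fun _ hu => hu, fun u hu hn => absurd hu hn⟩
    · rintro S₂ t ⟨⟨k1, -, k3⟩, ht⟩
      simp only [List.length_nil, List.map_cons, List.sum_cons] at ht ⊢
      refine ⟨⟨h1.trans k1, fun U' hU' => h2 U' (List.mem_cons_of_mem _ hU'), ?_⟩, by omega⟩
      intro U' hU' hn u hu hl
      by_cases e : U' = U
      · subst e
        exact k3 u hu (by simp) hl
      · exact hpersist k1.raised (h3 U' hU' (by simp [e, hn]) u hu hl)
  · exact ⟨Advances.refl h lam i hS, fun _ hU => hU, fun U hU hn => absurd hU hn⟩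
  · rintro S₁ t ⟨⟨h1, -, h3⟩, ht⟩
    simp only [List.map_nil, List.sum_nil] at ht
    exact ⟨h1, fun U hU => h3 U hU (by simp), by omega⟩

/-- A bound for the cost of the treatment of an edge whose tail has level `i`. -/
def edgeCost (lam : ℕ → W) (l i : ℕ) (e : Edge V W) : ℕ :=
  15 + if e.wt < lam i then 2 * Nat.clog 2 l + 3 else 0

variable [BoundedOrder W]

/-- The new label `j` satisfies `h e.dst < lam j`, so by monotonicity it is not below any index `j'
≤ i` with `lam j' ≤ h e.dst`. This keeps the labels above the buckets in which groups are filed. The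
constant 15 includes the loop round and the deposit of 5 for a new bucket entry. -/
theorem spec_relax {F : Finset V} {h : Arr V W} {lam : Arr ℕ W} {l i : ℕ} {ws : List W}
    (hlam : IsThresholds l ws lam) (hi : i ≤ l) {e : Edge V W} {S : SplitState V}
    (hS : S.Valid F) (he : e.dst ∈ F) :
    (relax h lam l i e S).Spec fun S' t => Advances F h lam i S S' ∧
      t + 1 + 5 * S'.active l ≤ 5 * S.active l + edgeCost lam l i e := by
  unfold relax
  rw [Step.spec_readAt_bind]
  have key : ∀ j ≤ i,
      (readAt lam j >>= fun z => readAt h e.dst >>= fun x => leq z x >>= fun b =>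
        if b = true then pure S else readAt S.lab e.dst >>= fun o => match o with
          | none => activate j e.dst S
          | some j' => if j' < j then activate j e.dst S else pure S).Spec fun S' t =>
      Advances F h lam i S S' ∧ t + 5 * S'.active l ≤ 5 * S.active l + 12 := by
    intro j hj
    simp only [Step.spec_readAt_bind, Step.spec_leq_bind]
    have hA : (∀ a, S.lab e.dst = some a → a < j) → ¬ lam j ≤ h e.dst →
        Advances F h lam i S (S.activated j e.dst) := fun hlt hn =>
      advances_activated hS he hlt hj fun j' hj' hl => by
        by_contra hc
        exact hn ((hlam.mono j j' (by omega) (by omega)).trans hl)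
    have hact := active_activated_le l j e.dst S
    by_cases hl : lam j ≤ h e.dst
    · simp only [hl, decide_true, if_true, Step.spec_pure]
      exact ⟨Advances.refl h lam i hS, by omega⟩
    · simp only [hl, decide_false, Bool.false_eq_true, if_false, Step.spec_readAt_bind]
      cases hlab : S.lab e.dst with
      | none =>
        simp only [spec_activate]
        exact ⟨hA (by simp [hlab]) hl, by omega⟩
      | some j' =>
        simp only
        split_ifs with hlt
        · simp only [spec_activate]
          refine ⟨hA ?_ hl, by omega⟩
          intro a ha
          rw [hlab] at ha
          exact Option.some.inj ha ▸ hlt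
        · simp only [Step.spec_pure]
          exact ⟨Advances.refl h lam i hS, by omega⟩
  have hidx : (leq (lam i) e.wt >>= fun b => if b = true then pure i else index lam l e.wt :
      Step ℕ).Spec fun j t => j ≤ i ∧ t + 14 ≤ edgeCost lam l i e := by
    rw [Step.spec_leq_bind]
    by_cases hw : lam i ≤ e.wt
    · simp only [hw, decide_true, if_true, Step.spec_pure, edgeCost, not_lt.mpr hw, if_false]
      omega
    · simp only [hw, decide_false, Bool.false_eq_true, if_false]
      refine (spec_index l (lam := lam) (x := e.wt) (by rw [hlam.zero]; exact bot_le)).mono ?_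
      rintro j t ⟨h1, h2, h3⟩
      refine ⟨?_, ?_⟩
      · by_contra hc
        exact hw ((hlam.mono i j (by omega) (by omega)).trans h1)
      · simp only [edgeCost, lt_of_not_ge hw, if_true]
        omega
  refine Step.spec_bind hidx ?_
  rintro j t ⟨h1, h2⟩
  refine (key j h1).mono ?_
  rintro S' u ⟨h3, h4⟩
  exact ⟨h3, by omega⟩

/-- A bound for the cost of scanning a vertex of level `i`. -/
def scanCost (out : V → List (Edge V W)) (lam : ℕ → W) (l i : ℕ) (v : V) : ℕ :=
  ((out v).map (edgeCost lam l i)).sum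

/-- The difference `labelled - pending` is the weight of the vertices scanned so far with label `i`.
Activations preserve it and scanning `u` raises it by the scan cost of `u`, so its growth pays for
the scans; removals, also of outdated entries, are paid by the deposit of 5. Each removal lowers
`supply` by one, which bounds the number of rounds. -/
theorem spec_drain {F : Finset V} {out : Arr V (List (Edge V W))} {h : Arr V W} {lam : Arr ℕ W}
    {l i : ℕ} {ws : List W} (hlam : IsThresholds l ws lam) (hi : i ≤ l)
    (hout : ∀ v, ∀ e ∈ out v, e.dst ∈ F) (f : ℕ) (S : SplitState V) (hS : S.Valid F)
    (hf : S.supply F i < f) :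
    (drain out h lam l i f S).Spec fun S' t => S'.B = S.B ∧ S'.Valid F ∧ Raised h lam i S S' ∧
      t + 5 * S'.active l + S.labelled F i (scanCost out lam l i) ≤ 5 * S.active l +
        S'.labelled F i (scanCost out lam l i) + S.pending i (scanCost out lam l i) + 2 := by
  induction f generalizing S with
  | zero => omega
  | succ f ih =>
    rw [drain, Step.spec_readAt_bind]
    cases hC : S.C i with
    | nil =>
      simp only [Step.spec_pure]
      refine ⟨trivial, hS, Raised.refl _ _ _ _, by omega⟩
    | cons u us =>
      simp only [Step.spec_writeAt_bind, Step.spec_readAt_bind]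
      set S₁ : SplitState V := ⟨S.lab, S.B, Function.update S.C i us⟩ with hS₁
      have hCi : S₁.C i = us := Function.update_self ..
      have hval : S₁.Valid F := by
        intro j
        by_cases e : j = i
        · subst e
          have := hS j
          rw [hC] at this
          rw [hCi]
          exact ⟨(List.nodup_cons.mp this.1).2, fun v hv => this.2 v (List.mem_cons_of_mem _ hv)⟩
        · have e' : S₁.C j = S.C j := Function.update_of_ne e ..
          rw [e']
          exact hS j
      have hact : S₁.active l + 1 = S.active l := by
        have := sum_change (F := Finset.range (l + 1)) (g := fun j => (S.C j).length)
          (g' := fun j => (S₁.C j).length) (Finset.mem_range.mpr (by omega : i < l + 1))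
          (fun j hj => by simp [hS₁, Function.update_of_ne hj])
        simp only [hC, hCi, List.length_cons] at this
        simp only [active]
        omega
      have hsup : S₁.supply F i + 1 = S.supply F i := by
        have hlab₁ : S₁.lab = S.lab := rfl
        simp only [supply, hCi, hC, hlab₁, List.length_cons]
        omega
      have hpend : ∀ w, S.pending i w = (if S.lab u = some i then w u else 0) + S₁.pending i w := by
        intro w
        simp only [pending, hC, hCi, List.map_cons, List.sum_cons]
        rfl
      have hlab : ∀ w, S₁.labelled F i w = S.labelled F i w := fun _ => rfl
      have hp := hpend (scanCost out lam l i)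
      have hl := hlab (scanCost out lam l i)
      by_cases hu : S.lab u = some i
      · simp only [hu, if_true, Step.spec_readAt_bind] at hp ⊢
        refine Step.spec_bind (Step.spec_forEach
          (fun rem S' => Advances F h lam i S₁ S' ∧ ∀ e ∈ rem, e ∈ out u)
          (fun rem S' => (rem.map (edgeCost lam l i)).sum + 5 * S'.active l) ?_ ?_) ?_
        · rintro e rem S₂ ⟨h1, h2⟩
          refine (spec_relax hlam hi h1.valid (hout u e (h2 e List.mem_cons_self))).mono ?_
          rintro S₃ t ⟨h3, h4⟩
          refine ⟨⟨h1.trans h3, fun e' he' => h2 e' (List.mem_cons_of_mem _ he')⟩, ?_⟩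
          simp only [List.map_cons, List.sum_cons]
          omega
        · exact ⟨Advances.refl h lam i hval, fun _ he => he⟩
        · rintro S₂ t₂ ⟨⟨h1, -⟩, ht₂⟩
          simp only [List.map_nil, List.sum_nil] at ht₂
          have hsup₂ := h1.supply_le
          refine (ih S₂ h1.valid (by omega)).mono ?_
          rintro S' t ⟨g1, g2, g3, g4⟩
          refine ⟨g1.trans h1.groups, g2, (show Raised h lam i S S₂ from h1.raised).trans g3, ?_⟩
          have hw := h1.weights (scanCost out lam l i)
          have hsc : scanCost out lam l i u = ((out u).map (edgeCost lam l i)).sum := rfl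
          omega
      · simp only [hu, if_false] at hp ⊢
        refine (ih S₁ hval (by omega)).mono ?_
        rintro S' t ⟨g1, g2, g3, g4⟩
        exact ⟨g1, g2, g3, by omega⟩

end Split

/-! ### Filing groups into buckets -/

section Filing

variable {V W : Type} [LinearOrder W] [BoundedOrder W]

/-- The total potential of the groups in the buckets below `i`. -/
def bucketSum (pot : ℕ → List V → ℕ) (i : ℕ) (B : ℕ → List (List V)) : ℕ :=
  ∑ j ∈ Finset.range i, ((B j).map (pot j)).sum

/-- The potential `pot` and the charges `A` are quantified after the resulting state, because they
will refer to the final levels, which only the later phases determine. A caller only has to check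
the charge for a group that is filed under `j` with an unlabelled witness `u` such that `lam j ≤ h
u`. -/
theorem spec_fileGroups {h : Arr V W} {lam : Arr ℕ W} {l : ℕ} {ws : List W}
    (hlam : IsThresholds l ws lam) (Us : List (List V)) (S : SplitState V) :
    (forEach Us S fun U S => fileGroup h lam l U S).Spec fun S' t =>
      S'.lab = S.lab ∧ S'.C = S.C ∧ (∀ j, ∀ U ∈ S.B j, U ∈ S'.B j) ∧
      (∀ j, ∀ U ∈ S'.B j, U ∈ S.B j ∨ U ∈ Us) ∧
      ∀ (i : ℕ) (pot : ℕ → List V → ℕ) (A : List V → ℕ),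
        (∀ j ≤ l, ∀ U ∈ Us, U ∈ S'.B j → ∀ u ∈ U, S.lab u = none → lam j ≤ h u →
          j < i ∧ pot j U + 5 * U.length + 2 * Nat.clog 2 l + 8 ≤ A U) →
        (∀ U ∈ Us, 5 * U.length + 2 ≤ A U) →
        t + bucketSum pot i S'.B ≤ bucketSum pot i S.B + (Us.map A).sum + 1 := by
  induction Us generalizing S with
  | nil =>
    rw [Step.spec_forEach_nil]
    refine ⟨rfl, rfl, fun _ _ h => h, fun _ _ h => Or.inl h, fun i pot A _ _ => ?_⟩
    simp only [List.map_nil, List.sum_nil]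
    omega
  | cons U Us ih =>
    rw [Step.spec_forEach_cons]
    have hfile : (fileGroup h lam l U S).Spec fun S₁ t =>
        (S₁ = S ∧ t ≤ 5 * U.length + 1) ∨ ∃ u ∈ U, S.lab u = none ∧ ∃ j ≤ l, lam j ≤ h u ∧
          S₁ = ⟨S.lab, Function.update S.B j (U :: S.B j), S.C⟩ ∧
          t ≤ 5 * U.length + 2 * Nat.clog 2 l + 7 := by
      unfold fileGroup
      refine Step.spec_bind (spec_groupMax h S.lab U) ?_
      rintro o t ⟨h1, h2⟩
      cases o with
      | none =>
        simp only [Step.spec_pure]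
        exact Or.inl ⟨trivial, by omega⟩
      | some u =>
        obtain ⟨hu, hlab⟩ := h1 u rfl
        simp only [Step.spec_readAt_bind]
        refine Step.spec_bind (spec_index l (lam := lam) (x := h u)
          (by rw [hlam.zero]; exact bot_le)) ?_
        rintro j t' ⟨h3, h4, h5⟩
        simp only [Step.spec_writeAt_bind, Step.spec_readAt_bind, Step.spec_pure]
        exact Or.inr ⟨u, hu, hlab, j, h4, h3, rfl, by omega⟩
    refine Step.spec_bind hfile ?_
    rintro S₁ t (⟨rfl, ht⟩ | ⟨u, hu, hlab, j, hj, hju, rfl, ht⟩)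
    · refine (ih S₁).mono ?_
      rintro S' t' ⟨h1, h2, h3, h4, h5⟩
      refine ⟨h1, h2, h3, fun j X hX => (h4 j X hX).imp_right (List.mem_cons_of_mem _), ?_⟩
      intro i pot A k1 k2
      have a := h5 i pot A (fun j hj X hX => k1 j hj X (List.mem_cons_of_mem _ hX))
        (fun X hX => k2 X (List.mem_cons_of_mem _ hX))
      have b := k2 U List.mem_cons_self
      simp only [List.map_cons, List.sum_cons]
      omega
    · refine (ih _).mono ?_
      rintro S' t' ⟨h1, h2, h3, h4, h5⟩
      simp only at h1 h2 h3 h4 h5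
      have hself : U ∈ Function.update S.B j (U :: S.B j) j := by
        rw [Function.update_self]
        exact List.mem_cons_self
      refine ⟨h1, h2, ?_, ?_, ?_⟩
      · intro j' X hX
        refine h3 j' X ?_
        by_cases e : j' = j
        · subst e
          rw [Function.update_self]
          exact List.mem_cons_of_mem _ hX
        · rwa [Function.update_of_ne e]
      · intro j' X hX
        rcases h4 j' X hX with hX | hX
        · by_cases e : j' = j
          · subst e
            rw [Function.update_self] at hX
            rcases List.mem_cons.mp hX with rfl | hX
            · exact Or.inr List.mem_cons_self
            · exact Or.inl hX
          · rw [Function.update_of_ne e] at hX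
            exact Or.inl hX
        · exact Or.inr (List.mem_cons_of_mem _ hX)
      · intro i pot A k1 k2
        have a := h5 i pot A (fun j hj X hX => k1 j hj X (List.mem_cons_of_mem _ hX))
          (fun X hX => k2 X (List.mem_cons_of_mem _ hX))
        obtain ⟨hji, b⟩ := k1 j hj U List.mem_cons_self (h3 j U hself) u hu hlab hju
        have c := sum_change (F := Finset.range i) (g := fun j => ((S.B j).map (pot j)).sum)
          (g' := fun j' => ((Function.update S.B j (U :: S.B j) j').map (pot j')).sum)
          (Finset.mem_range.mpr hji) (fun j' hj' => by simp [Function.update_of_ne hj'])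
        simp only [Function.update_self, List.map_cons, List.sum_cons] at c
        simp only [List.map_cons, List.sum_cons]
        simp only [bucketSum] at a ⊢
        omega

end Filing

/-! ### Amortised cost of the split algorithm -/

section Sweep

open SplitState

variable {V W : Type}

/-- The level that is given by the labels in the end. -/
def SplitState.level (S : SplitState V) (v : V) : ℕ := (S.lab v).getD 0

/-- The cost of scanning the vertices with labels less than `i`. -/
def totalScanCost [LinearOrder W] (F : Finset V) (out : V → List (Edge V W)) (lam : ℕ → W)
    (l i : ℕ) (S : SplitState V) : ℕ :=
  ∑ v ∈ F, match S.lab v with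
    | none => 0
    | some a => if a < i then scanCost out lam l a v else 0

/-- The potential of a group in bucket `j`. -/
def groupPotential (lev : V → ℕ) (l j : ℕ) (U : List V) : ℕ :=
  17 * U.length + 4 + numLevelsBelow lev j U * (63 * Nat.clog 2 l)

variable [DecidableEq V] [LinearOrder W] [BoundedOrder W]

/-- Labels of at least `i` are final when the phases below `i` begin, so a vertex is scanned only
with its final level and the scans sum up to `totalScanCost`. A group that returns from bucket `i`
to bucket `j` contains an unlabelled vertex whose capacity is at least `lam j`; its final level lies
in `[j, i)`, so `numLevelsBelow` drops by at least one. The third claim provides the lower bound for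
this level. -/
theorem spec_sweep {F : Finset V} {out : Arr V (List (Edge V W))} {h : Arr V W} {lam : Arr ℕ W}
    {l n : ℕ} {ws : List W} (hlam : IsThresholds l ws lam) (hl : 2 ≤ l)
    (hout : ∀ v, ∀ e ∈ out v, e.dst ∈ F) (hn : F.card ≤ n) (i : ℕ) (hi : i ≤ l + 1)
    (S : SplitState V) (hS : S.Valid F)
    (hB : ∀ j, ∀ U ∈ S.B j, (∀ u ∈ U, u ∈ F) ∧ U.length ≤ 3 * Nat.clog 2 l) :
    (sweep n out h lam l i S).Spec fun S' t =>
      (∀ v a, S.lab v = some a → i ≤ a → S'.lab v = some a) ∧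
      (∀ v, (∀ a, S.lab v = some a → a < i) → ∀ a, S'.lab v = some a → a < i) ∧
      (∀ j < i, ∀ U ∈ S.B j, ∀ u ∈ U, lam j ≤ h u → (∀ a, S.lab u = some a → j ≤ a) →
        ∃ a, S'.lab u = some a ∧ j ≤ a) ∧
      t + 5 * S'.active l ≤ 5 * S.active l + 20 * i + 1 + totalScanCost F out lam l i S' +
        bucketSum (groupPotential S'.level l) i S.B := by
  induction i generalizing S with
  | zero =>
    simp only [sweep, Step.spec_tick_bind, Step.spec_pure]
    exact ⟨fun _ _ h _ => h, fun _ h => h, fun j hj => absurd hj (Nat.not_lt_zero j), by omega⟩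
  | succ i ih =>
    rw [sweep]
    have hil : i ≤ l := by omega
    have hclog : 1 ≤ Nat.clog 2 l := Nat.clog_pos (by norm_num) hl
    refine Step.spec_bind (spec_release (l := l) hS fun U hU => (hB i U hU).1) ?_
    rintro S₁ t₁ ⟨adv₁, rel₁, ht₁⟩
    have hsup : S₁.supply F i < n + 1 := by
      have := adv₁.valid.supply_le i
      omega
    refine Step.spec_bind (spec_drain hlam hil hout (n + 1) S₁ adv₁.valid hsup) ?_
    rintro S₂ t₂ ⟨hB₂, val₂, rai₂, ht₂⟩
    rw [Step.spec_readAt_bind, hB₂, adv₁.groups]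
    refine Step.spec_bind (spec_fileGroups (h := h) hlam (S.B i) S₂) ?_
    rintro S₃ t₃ ⟨lab₃, C₃, sub₃, sup₃, pot₃⟩
    have hB₂' : S₂.B = S.B := hB₂.trans adv₁.groups
    have rai : Raised h lam i S S₂ := (show Raised h lam i S S₁ from adv₁.raised).trans rai₂
    have val₃ : S₃.Valid F := by
      intro j
      rw [C₃]
      refine ⟨(val₂ j).1, fun u hu => ?_⟩
      rw [lab₃]
      exact (val₂ j).2 u hu
    have hB₃ : ∀ j, ∀ U ∈ S₃.B j, (∀ u ∈ U, u ∈ F) ∧ U.length ≤ 3 * Nat.clog 2 l := by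
      intro j U hU
      rcases sup₃ j U hU with hU | hU
      · rw [hB₂'] at hU
        exact hB j U hU
      · exact hB i U hU
    refine (ih (by omega) S₃ val₃ hB₃).mono ?_
    rintro S' t ⟨ih1, ih2, ih3, ih4⟩
    have hreleased : ∀ U ∈ S.B i, ∀ u ∈ U, lam i ≤ h u → S₂.lab u ≠ none := by
      intro U hU u hu hle
      have := rel₁ U hU u hu hle
      rcases rai₂ u with e | ⟨b, -, e, -⟩
      · rwa [e]
      · simp [e]
    refine ⟨?_, ?_, ?_, ?_⟩
    · intro v a hv ha
      refine ih1 v a ?_ (by omega)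
      rw [lab₃]
      rcases rai v with e | ⟨b, hb, e, hlt, -⟩
      · rw [e, hv]
      · have := hlt a hv
        omega
    · intro v hv a ha
      by_cases hva : S₂.lab v = some i
      · rw [ih1 v i (by rw [lab₃, hva]) le_rfl] at ha
        have := Option.some.inj ha
        omega
      · refine Nat.lt_succ_of_lt (ih2 v (fun b hb => ?_) a ha)
        rw [lab₃] at hb
        have hne : b ≠ i := by
          rintro rfl
          exact hva hb
        rcases rai v with e | ⟨b', hb', e, -⟩
        · rw [e] at hb
          have := hv b hb
          omega
        · rw [e] at hb
          have := Option.some.inj hb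
          omega
    · intro j hj U hU u hu hle hlab
      have hP : ∀ a, S₂.lab u = some a → j ≤ a := by
        intro a ha
        rcases rai u with e | ⟨b, hb, e, -, hcap⟩
        · exact hlab a (e ▸ ha)
        · rw [e] at ha
          exact Option.some.inj ha ▸ hcap j (by omega) hle
      by_cases hji : j = i
      · subst hji
        obtain ⟨a, ha⟩ := Option.ne_none_iff_exists'.mp (hreleased U hU u hu hle)
        exact ⟨a, ih1 u a (by rw [lab₃, ha]) (hP a ha), hP a ha⟩
      · refine ih3 j (by omega) U (sub₃ j U (hB₂' ▸ hU)) u hu hle ?_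
        rw [lab₃]
        exact hP
    · have hpot := pot₃ i (groupPotential S'.level l)
        -- With `c = clog 2 l ≥ 1` and groups of at most `3 * c` vertices, one level pays for
        -- refiling and for the linear part of the new potential: `17 * 3c + 2c + 10 ≤ 63c`.
        (fun U => 5 * U.length + 2 + numLevelsBelow S'.level i U * (63 * Nat.clog 2 l)) (by
          intro j hjl U hU hUj u hu hnone hle
          -- A capacity reaching `lam i` would have released the vertex in this phase, so refiling
          -- leads strictly downwards.
          have hji : j < i := by
            by_contra hc
            exact hreleased U hU u hu ((hlam.mono i j (by omega) (by omega)).trans hle) hnone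
          refine ⟨hji, ?_⟩
          obtain ⟨a, ha, hja⟩ := ih3 j hji U hUj u hu hle (by simp [lab₃, hnone])
          have hai := ih2 u (by simp [lab₃, hnone]) a ha
          have hlev : S'.level u = a := by simp [SplitState.level, ha]
          have hlt := numLevelsBelow_lt hu (hlev ▸ hja : j ≤ S'.level u) (hlev ▸ hai)
          have hlen := (hB i U hU).2
          have := Nat.mul_le_mul_right (63 * Nat.clog 2 l) hlt
          rw [add_mul] at this
          simp only [groupPotential]
          omega) (fun U _ => by omega)
      have hpend := hS.pending_le i (scanCost out lam l i)
      have hw := adv₁.weights (scanCost out lam l i)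
      have hact : S₃.active l = S₂.active l := by rw [active, active, C₃]
      -- The vertices labelled `i` after this phase keep that label, so they supply exactly the
      -- missing summand of the total.
      have hscan : S₂.labelled F i (scanCost out lam l i) + totalScanCost F out lam l i S' ≤
          totalScanCost F out lam l (i + 1) S' := by
        rw [labelled, totalScanCost, totalScanCost, ← Finset.sum_add_distrib]
        refine Finset.sum_le_sum fun v _ => ?_
        by_cases hv : S₂.lab v = some i
        · have hv' := ih1 v i (by rw [lab₃, hv]) le_rfl
          simp [hv, hv']
        · rw [if_neg hv]
          cases S'.lab v with
          | none => simp
          | some a =>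
            simp only
            split_ifs with q1 q2 <;> omega
      have hsplit : ((S.B i).map fun U => 12 * U.length + 2).sum +
          ((S.B i).map fun U => 5 * U.length + 2 +
            numLevelsBelow S'.level i U * (63 * Nat.clog 2 l)).sum =
          ((S.B i).map (groupPotential S'.level l i)).sum := by
        rw [← List.sum_map_add]
        congr 1
        refine List.map_congr_left fun U _ => ?_
        simp only [groupPotential]
        omega
      have hbs : bucketSum (groupPotential S'.level l) (i + 1) S.B =
          bucketSum (groupPotential S'.level l) i S.B +
            ((S.B i).map (groupPotential S'.level l i)).sum := Finset.sum_range_succ _ _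
      rw [hB₂'] at hpot
      omega

/-- The number of edges that do not belong to the instances of the levels. -/
def cut (lev : V → ℕ) (lam : ℕ → W) (es : List (Edge V W)) : ℕ :=
  (es.map fun e => if lev e.src ≠ lev e.dst ∨ e.wt < lam (lev e.src) then 1 else 0).sum

/-- Everything beyond linear time is charged to cut edges: binary searches for edge weights
directly, repeated filings of groups through the tree edges between different levels. Here `l` may
exceed the number of vertices and therefore enters the linear term. -/
theorem spec_split {vs : List V} {es : List (Edge V W)} {h : Arr V W} {lam : Arr ℕ W}
    {l : ℕ} {ws : List W} {tree : List (V × Option V)} (hI : IsInstance vs es)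
    (hlam : IsThresholds l ws lam) (hl : 2 ≤ l) (htree : IsTree (Joined es) tree)
    (hvs : ∀ v ∈ tree.map Prod.fst, v ∈ vs) :
    (split vs es h lam l tree).Spec fun lev t =>
      t ≤ 150 * (vs.length + es.length + l) + 150 * Nat.clog 2 l * cut lev lam es := by
  unfold split
  have hclog : 1 ≤ Nat.clog 2 l := Nat.clog_pos (by norm_num) hl
  have hclogl : Nat.clog 2 l ≤ l := Nat.clog_le_of_le_pow (Nat.lt_two_pow_self).le
  have htn : tree.length ≤ vs.length := by
    have := List.Subperm.length_le (List.subperm_of_subset htree.nodup hvs)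
    simpa using this
  have hn1 : 1 ≤ tree.length := List.length_pos_iff.mpr htree.ne_nil
  refine Step.spec_bind (Step.spec_count vs) ?_
  rintro _ t₁ ⟨rfl, ht₁⟩
  refine Step.spec_bind (Step.spec_ceilLog l) ?_
  rintro _ t₂ ⟨rfl, ht₂⟩
  refine Step.spec_bind (spec_partitionTree (by omega) htree) ?_
  rintro Us t₃ ⟨hUs, ht₃⟩
  refine Step.spec_bind (spec_outEdges vs es) ?_
  rintro _ t₄ ⟨rfl, ht₄⟩
  refine Step.spec_bind (Step.spec_fill_default (α := Option ℕ) vs) ?_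
  rintro _ t₅ ⟨rfl, ht₅⟩
  refine Step.spec_bind (Step.spec_fill_nil (α := List V) (List.range (l + 1))) ?_
  rintro _ t₆ ⟨rfl, ht₆⟩
  refine Step.spec_bind (Step.spec_fill_nil (α := V) (List.range (l + 1))) ?_
  rintro _ t₇ ⟨rfl, ht₇⟩
  rw [List.length_range] at ht₆ ht₇
  refine Step.spec_bind (spec_fileGroups (h := h) hlam Us _) ?_
  rintro S₁ t₈ ⟨lab₁, C₁, -, sup₁, pot₁⟩
  simp only at lab₁ C₁
  set F := vs.toFinset with hF
  set out : V → List (Edge V W) := fun v => (es.filter fun e => e.src = v).reverse with hout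
  have hd : (default : Option ℕ) = none := rfl
  have hmemB : ∀ j, ∀ U ∈ S₁.B j, U ∈ Us := by
    intro j U hU
    rcases sup₁ j U hU with hU | hU
    · simp at hU
    · exact hU
  refine Step.spec_bind (spec_sweep (F := F) (out := out) (h := h) hlam hl ?_
    (List.toFinset_card_le vs) (l + 1) le_rfl S₁ ?_ ?_) ?_
  · intro v e he
    simp only [hout, List.mem_reverse, List.mem_filter] at he
    exact List.mem_toFinset.mpr (hI.mem e he.1).2
  · intro j
    simp [C₁]
  · intro j U hU
    refine ⟨fun u hu => List.mem_toFinset.mpr (hvs u (hUs.mem U (hmemB j U hU) u hu)), ?_⟩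
    have := hUs.length_le U (hmemB j U hU)
    omega
  rintro S t₉ ⟨-, -, hS, ht₉⟩
  refine (Step.spec_forEach
    (fun rem (lev : Arr V ℕ) => ∀ v ∈ vs, v ∉ rem → lev v = S.level v)
    (fun rem _ => 3 * rem.length) ?_ ?_).mono ?_
  · intro v rem lev hlev
    simp only [Step.spec_readAt_bind, Step.spec_writeAt, List.length_cons]
    refine ⟨fun w hw hw' => ?_, by omega⟩
    by_cases e : w = v
    · subst e
      exact Function.update_self ..
    · rw [Function.update_of_ne e]
      exact hlev w hw (by simp [e, hw'])
  · exact fun v hv hv' => absurd hv hv'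
  rintro lev t ⟨hlev, ht⟩
  replace hlev : ∀ v ∈ vs, lev v = S.level v := fun v hv => hlev v hv (by simp)
  simp only [List.length_nil] at ht
  set c := Nat.clog 2 l with hc
  have hfile := pot₁ (l + 1) (groupPotential S.level l)
    (fun U => 22 * U.length + (2 * c + 12) + (numLevels S.level U - 1) * (63 * c)) (by
      intro j hj U _ hUj u hu _ hle
      refine ⟨by omega, ?_⟩
      obtain ⟨a, ha, hja⟩ := hS j (by omega) U hUj u hu hle (by simp [lab₁, hd])
      have hla : S.level u = a := by simp [SplitState.level, ha]
      have := numLevelsBelow_le hu (hla ▸ hja : j ≤ S.level u)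
      have := Nat.mul_le_mul_right (63 * c) this
      simp only [groupPotential, ← hc]
      omega) (fun U _ => by omega)
  have hbs₀ : bucketSum (groupPotential S.level l) (l + 1) (fun _ => ([] : List (List V))) = 0 := by
    simp [bucketSum]
  have hact : S₁.active l = 0 := by simp [active, C₁]
  have hA : (Us.map fun U => 22 * U.length + (2 * c + 12) +
      (numLevels S.level U - 1) * (63 * c)).sum =
      22 * (Us.map List.length).sum + Us.length * (2 * c + 12) +
        (Us.map fun U => numLevels S.level U - 1).sum * (63 * c) := by
    clear hfile hmemB sup₁ pot₁ hUs ht₃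
    induction Us with
    | nil => simp
    | cons U Us ih =>
      simp only [List.map_cons, List.sum_cons, List.length_cons, ih]
      ring
  have hU1 : Us.length ≤ (Us.map List.length).sum := by
    rw [← sum_map_one]
    exact sum_map_le _ fun U hU => List.length_pos_iff.mpr (hUs.ne_nil U hU)
  have hU2 := hUs.sum_le
  -- The first filing costs `O(c)` per group. If the size parameter is `c`, there are few groups
  -- since each is large; if it is cut down to the number of vertices, there are at most two groups,
  -- and `c ≤ l`.
  have hU3 : Us.length * c ≤ 2 * vs.length + 2 * l := by
    rcases hUs.large with hlg | hlg
    · have hmul : Us.length * min c vs.length ≤ 2 * tree.length := by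
        refine le_trans ?_ hU2
        rw [← sum_map_one, mul_comm, ← sum_map_const_mul]
        exact sum_map_le _ fun U hU => by simpa using hlg U hU
      rcases le_total c vs.length with hcn | hcn
      · rw [min_eq_left hcn] at hmul
        omega
      · rw [min_eq_right hcn] at hmul
        have : Us.length ≤ 2 := by
          by_contra hc3
          have := Nat.mul_le_mul_right vs.length (by omega : 3 ≤ Us.length)
          omega
        have := Nat.mul_le_mul_right c this
        omega
    · have := Nat.mul_le_mul_right c hlg
      omega
  have hcr := crossings_le htree S.level
  have hlv := hUs.levels S.level
  have hcut1 : (es.map fun e => if S.level e.src ≠ S.level e.dst then 1 else 0).sum ≤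
      cut lev lam es := sum_map_le _ fun e he => by
    rw [hlev _ (hI.mem e he).1, hlev _ (hI.mem e he).2]
    split_ifs with q1 q2 q2
    · exact le_rfl
    · exact absurd (Or.inl q1) q2
    · exact Nat.zero_le _
    · exact le_rfl
  have hscan : totalScanCost F out lam l (l + 1) S ≤
      15 * es.length + (2 * c + 3) * cut lev lam es := by
    have h1 : totalScanCost F out lam l (l + 1) S ≤
        ∑ v ∈ F, ((es.filter fun e => e.src = v).map fun e =>
          15 + (2 * c + 3) * if e.wt < lam (S.level e.src) then 1 else 0).sum := by
      refine Finset.sum_le_sum fun v _ => ?_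
      cases hv : S.lab v with
      | none => simp
      | some a =>
        simp only
        split_ifs with ha
        · rw [scanCost, hout, List.map_reverse, List.sum_reverse]
          refine sum_map_le _ fun e he => ?_
          have hev : e.src = v := by simpa using (List.mem_filter.mp he).2
          have hla : S.level e.src = a := by simp [SplitState.level, hev, hv]
          rw [hla, edgeCost]
          split_ifs <;> omega
        · exact Nat.zero_le _
    refine h1.trans ((sum_filter_key F (fun e : Edge V W => e.src) _ es).trans ?_)
    have h2 : ∀ xs : List (Edge V W), (xs.map fun e =>
        15 + (2 * c + 3) * if e.wt < lam (S.level e.src) then 1 else 0).sum =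
        15 * xs.length + (2 * c + 3) *
          (xs.map fun e => if e.wt < lam (S.level e.src) then 1 else 0).sum := by
      intro xs
      induction xs with
      | nil => simp
      | cons e xs ih =>
        simp only [List.map_cons, List.sum_cons, List.length_cons, ih]
        ring
    rw [h2]
    refine Nat.add_le_add_left (Nat.mul_le_mul_left _ (sum_map_le _ fun e he => ?_)) _
    rw [hlev _ (hI.mem e he).1]
    split_ifs with q1 q2 q2
    · exact le_rfl
    · exact absurd (Or.inr q1) q2
    · exact Nat.zero_le _
    · exact le_rfl
  have hlv' : (Us.map fun U => numLevels S.level U - 1).sum * (63 * c) ≤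
      126 * (c * cut lev lam es) + 63 * c := by
    calc _ ≤ (2 * cut lev lam es + 1) * (63 * c) := Nat.mul_le_mul_right _ (by omega)
      _ = _ := by ring
  have hx1 : Us.length * (2 * c + 12) = 2 * (Us.length * c) + 12 * Us.length := by ring
  have hx2 : (2 * c + 3) * cut lev lam es = 2 * (c * cut lev lam es) + 3 * cut lev lam es := by ring
  have hx3 : 150 * c * cut lev lam es = 150 * (c * cut lev lam es) := by ring
  have hx4 : cut lev lam es ≤ c * cut lev lam es := Nat.le_mul_of_pos_left _ hclog
  rw [hx1] at hA
  rw [hx2] at hscan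
  rw [hx3]
  rw [hA, hbs₀] at hfile
  omega

end Sweep

/-! ### The instances of the levels and the density of the sample -/

section Reduce

variable {V W : Type} [LinearOrder W] [BoundedOrder W]

/-- The edge of the reduced instances that arises from `e`, if any. -/
def reducedEdge (lam : ℕ → W) (lev : V → ℕ) (e : Edge V W) : Option (Edge V W) :=
  if lev e.src = lev e.dst ∧ lam (lev e.src) ≤ e.wt then
    some (if lam (lev e.src + 1) ≤ e.wt then ⟨e.src, e.dst, ⊤⟩ else e)
  else none

/-- The edges of the reduced instances. -/
def reducedEdges (lam : ℕ → W) (lev : V → ℕ) (es : List (Edge V W)) : List (Edge V W) :=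
  (es.filterMap (reducedEdge lam lev)).reverse

theorem reducedEdge_eq_some {lam : ℕ → W} {lev : V → ℕ} {e e' : Edge V W}
    (h : reducedEdge lam lev e = some e') : e'.src = e.src ∧ e'.dst = e.dst ∧
      lev e.src = lev e.dst ∧ lam (lev e.src) ≤ e.wt ∧
      (e'.wt = ⊤ ∨ e'.wt = e.wt ∧ e.wt < lam (lev e.src + 1)) := by
  unfold reducedEdge at h
  split_ifs at h with h1 h2
  · obtain rfl := Option.some.inj h
    exact ⟨rfl, rfl, h1.1, h1.2, Or.inl rfl⟩
  · obtain rfl := Option.some.inj h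
    exact ⟨rfl, rfl, h1.1, h1.2, Or.inr ⟨rfl, lt_of_not_ge h2⟩⟩

theorem mem_reducedEdges {lam : ℕ → W} {lev : V → ℕ} {es : List (Edge V W)} {e' : Edge V W}
    (h : e' ∈ reducedEdges lam lev es) : ∃ e ∈ es, reducedEdge lam lev e = some e' := by
  simpa [reducedEdges] using h

theorem level_eq_of_mem_reducedEdges {lam : ℕ → W} {lev : V → ℕ} {es : List (Edge V W)} :
    ∀ e ∈ reducedEdges lam lev es, lev e.src = lev e.dst := by
  intro e' he'
  obtain ⟨e, he, h⟩ := mem_reducedEdges he'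
  obtain ⟨h1, h2, h3, -⟩ := reducedEdge_eq_some h
  rw [h1, h2, h3]

/-- A weight is kept or becomes `⊤`, so no new coincidence of restricted weights arises. -/
theorem IsInstance.reducedEdges {vs : List V} {es : List (Edge V W)} (h : IsInstance vs es)
    (lam : ℕ → W) (lev : V → ℕ) : IsInstance vs (reducedEdges lam lev es) := by
  refine ⟨h.nodup, fun e' he' => ?_, fun e' he' => ?_, ?_⟩
  · obtain ⟨e, he, hr⟩ := mem_reducedEdges he'
    obtain ⟨h1, h2, -⟩ := reducedEdge_eq_some hr
    rw [h1, h2]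
    exact h.mem e he
  · obtain ⟨e, he, hr⟩ := mem_reducedEdges he'
    obtain ⟨-, -, -, -, h1 | ⟨h1, -⟩⟩ := reducedEdge_eq_some hr
    · rw [h1]
      have := bot_lt_iff_ne_bot.mpr (h.ne_bot e he)
      exact (this.trans_le le_top).ne'
    · rw [h1]
      exact h.ne_bot e he
  · rw [Bottleneck.reducedEdges, List.pairwise_reverse, List.pairwise_filterMap]
    refine h.distinct.imp ?_
    intro a b hab a' ha' b' hb' heq
    obtain ⟨-, -, -, -, h1⟩ := reducedEdge_eq_some ha'
    obtain ⟨-, -, -, -, h2⟩ := reducedEdge_eq_some hb'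
    rcases h2 with h2 | ⟨h2, -⟩
    · exact h2
    · rcases h1 with h1 | ⟨h1, -⟩
      · exact heq.trans h1
      · rw [h1, h2] at heq
        rw [h2, heq]
        exact hab heq.symm

theorem length_reducedEdges_add_cut (lam : ℕ → W) (lev : V → ℕ) (es : List (Edge V W)) :
    (reducedEdges lam lev es).length + cut lev lam es = es.length := by
  rw [reducedEdges, List.length_reverse]
  induction es with
  | nil => simp [cut]
  | cons e es ih =>
    simp only [cut, List.map_cons, List.sum_cons, List.length_cons] at ih ⊢
    by_cases h : lev e.src = lev e.dst ∧ lam (lev e.src) ≤ e.wt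
    · have h1 : ∃ e', reducedEdge lam lev e = some e' := by
        rw [reducedEdge, if_pos h]
        exact ⟨_, rfl⟩
      obtain ⟨e', he'⟩ := h1
      have h2 : ¬ (lev e.src ≠ lev e.dst ∨ e.wt < lam (lev e.src)) := by
        rw [not_or, not_lt, not_not]
        exact h
      rw [List.filterMap_cons_some he', List.length_cons, if_neg h2]
      omega
    · have h1 : reducedEdge lam lev e = none := by rw [reducedEdge, if_neg h]
      have h2 : lev e.src ≠ lev e.dst ∨ e.wt < lam (lev e.src) := by
        rw [← not_le]
        tauto
      rw [List.filterMap_cons_none h1, if_pos h2]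
      omega

theorem restricted_reducedEdges_length_le (lam : ℕ → W) (lev : V → ℕ) (es : List (Edge V W)) :
    (restricted (reducedEdges lam lev es)).length ≤ (restricted es).length := by
  simp only [restricted_length, reducedEdges, List.map_reverse, List.sum_reverse]
  induction es with
  | nil => simp
  | cons e es ih =>
    simp only [List.map_cons, List.sum_cons]
    cases h : reducedEdge lam lev e with
    | none =>
      rw [List.filterMap_cons_none h]
      omega
    | some e' =>
      rw [List.filterMap_cons_some h, List.map_cons, List.sum_cons]
      obtain ⟨-, -, -, -, h1 | ⟨h1, -⟩⟩ := reducedEdge_eq_some h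
      · rw [if_neg (not_not.mpr h1)]
        omega
      · rw [h1]
        omega

/-- An edge that is still restricted inside level `i` has kept its weight, which therefore lies
between two consecutive thresholds. -/
theorem restricted_edgePart_length_le (lam : ℕ → W) (lev : V → ℕ) (es : List (Edge V W)) (i : ℕ) :
    (restricted (edgePart lev (reducedEdges lam lev es) i)).length ≤
      ((restricted es).filter fun e => lam i ≤ e.wt ∧ e.wt < lam (i + 1)).length := by
  simp only [restricted_length, edgePart, reducedEdges, List.filter_reverse, List.reverse_reverse]
  induction es with
  | nil => simp
  | cons e es ih =>
    have hmono : ((restricted es).filter fun e => lam i ≤ e.wt ∧ e.wt < lam (i + 1)).length ≤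
        ((restricted (e :: es)).filter fun e => lam i ≤ e.wt ∧ e.wt < lam (i + 1)).length := by
      refine (List.Sublist.filter _ ?_).length_le
      exact (List.sublist_cons_self e es).filter _
    cases h : reducedEdge lam lev e with
    | none =>
      rw [List.filterMap_cons_none h]
      exact ih.trans hmono
    | some e' =>
      rw [List.filterMap_cons_some h]
      obtain ⟨h1, h2, h3, h4, h5⟩ := reducedEdge_eq_some h
      by_cases hi : lev e.src = i
      · rw [List.filter_cons_of_pos (by simpa [h1] using hi), List.map_cons, List.sum_cons]
        rcases h5 with h5 | ⟨h5, h6⟩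
        · rw [if_neg (not_not.mpr h5)]
          omega
        · have hne : e.wt ≠ ⊤ := (h6.trans_le le_top).ne
          have hc : ((restricted (e :: es)).filter fun e => lam i ≤ e.wt ∧ e.wt < lam (i + 1)).length
              = ((restricted es).filter fun e => lam i ≤ e.wt ∧ e.wt < lam (i + 1)).length + 1 := by
            rw [restricted, List.filter_cons_of_pos (by simpa using hne), List.filter_cons_of_pos]
            · rfl
            · subst hi
              simpa using ⟨h4, h6⟩
          have : (if e'.wt ≠ ⊤ then 1 else 0) ≤ 1 := by split_ifs <;> simp
          omega
      · rw [List.filter_cons_of_neg (by simpa [h1] using hi)]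
        exact ih.trans hmono

theorem spec_reduce [DecidableEq V] (vs : List V) (es : List (Edge V W)) (h : Arr V W)
    (lam : Arr ℕ W) (l : ℕ) (level : Arr V ℕ) :
    (reduce vs es h lam l level).Spec fun r t =>
      IsGather (l + 1) level vs (reducedEdges lam level es) r.2 ∧
      t ≤ 11 * es.length + 7 * l + 4 * vs.length + 15 := by
  unfold reduce
  refine Step.spec_bind (Step.spec_forEach
    (fun rem (p : Arr V W × List (Edge V W)) => reducedEdges lam level rem ++ p.2 =
      reducedEdges lam level es)
    (fun rem _ => 7 * rem.length) ?_ ?_) ?_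
  · intro e rem p hp
    simp only [Step.spec_readAt_bind, List.length_cons]
    have hcons : ∀ e', reducedEdge lam level e = some e' →
        reducedEdges lam level (e :: rem) = reducedEdges lam level rem ++ [e'] := by
      intro e' he'
      simp [reducedEdges, List.filterMap_cons_some he']
    have hnone : reducedEdge lam level e = none →
        reducedEdges lam level (e :: rem) = reducedEdges lam level rem := by
      intro he'
      simp [reducedEdges, List.filterMap_cons_none he']
    by_cases hij : level e.src = level e.dst
    · simp only [hij, if_true, Step.spec_readAt_bind, Step.spec_leq_bind]
      by_cases ha : lam (level e.dst) ≤ e.wt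
      · by_cases hb : lam (level e.dst + 1) ≤ e.wt
        · simp only [ha, hb, decide_true, if_true, Step.spec_leq_bind, Step.spec_pure]
          rw [hcons ⟨e.src, e.dst, ⊤⟩ (by simp [reducedEdge, hij, ha, hb]),
            List.append_assoc] at hp
          exact ⟨hp, by omega⟩
        · simp only [ha, hb, decide_true, decide_false, Bool.false_eq_true, if_true, if_false,
            Step.spec_leq_bind, Step.spec_pure]
          rw [hcons e (by simp [reducedEdge, hij, ha, hb]), List.append_assoc] at hp
          exact ⟨hp, by omega⟩
      · simp only [ha, decide_false, Bool.false_eq_true, if_false, Step.spec_pure]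
        rw [hnone (by simp [reducedEdge, hij, ha])] at hp
        exact ⟨hp, by omega⟩
    · rw [hnone (by simp [reducedEdge, hij])] at hp
      simp only [hij, if_false]
      split_ifs
      · simp only [Step.spec_readAt_bind, Step.spec_maxOf_bind, Step.spec_writeAt_bind,
          Step.spec_pure]
        exact ⟨hp, by omega⟩
      · simp only [Step.spec_pure]
        exact ⟨hp, by omega⟩
  · simp
  · rintro ⟨h', K⟩ t ⟨hK, ht⟩
    obtain rfl : K = reducedEdges lam level es := by simpa [reducedEdges] using hK
    refine Step.spec_bind (spec_gather (l + 1) level vs _) ?_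
    rintro Gs u ⟨hG, hu⟩
    rw [Step.spec_pure]
    have := length_reducedEdges_add_cut lam level es
    simp only [List.length_nil] at ht
    exact ⟨hG, by simp only at *; omega⟩

/-- Every interval that contains many weights contains the weight of a sampled edge. -/
def IsDense (xs : List (Edge V W)) (g : ℕ) (ys : List (Edge V W)) : Prop :=
  ∀ x ∈ ⊥ :: xs.map Edge.wt, ∀ y ∈ xs.map Edge.wt,
    g ≤ (xs.filter fun e => x < e.wt ∧ e.wt ≤ y).length → ∃ e ∈ ys, x < e.wt ∧ e.wt ≤ y

/-- Distinctness of the weights allows only one edge of weight `lam i`. If more than `g` edges were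
counted, at least `g` would lie strictly between the two thresholds; with `m` the heaviest of these,
density gives a sampled weight in `(lam i, m.wt]`, which would be a threshold strictly between
consecutive ones. -/
theorem IsDense.length_filter_le {xs ys : List (Edge V W)} {g l : ℕ} {ws : List W} {lam : ℕ → W}
    (hd : IsDense xs g ys) (hg : 1 ≤ g) (hlam : IsThresholds l ws lam)
    (hws : ∀ w, w ∈ ws ↔ w ∈ ys.map Edge.wt) (hys : ∀ e ∈ ys, e ∈ xs)
    (hx : xs.Pairwise fun e e' => e.wt ≠ e'.wt) {i : ℕ} (hi : i ≤ l) :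
    (xs.filter fun e => lam i ≤ e.wt ∧ e.wt < lam (i + 1)).length ≤ g := by
  set A := xs.filter fun e => lam i < e.wt ∧ e.wt < lam (i + 1) with hA
  have h1 : (xs.filter fun e => lam i ≤ e.wt ∧ e.wt < lam (i + 1)).length ≤
      A.length + (xs.filter fun e => e.wt = lam i).length := by
    rw [hA]
    clear hA hd hys hx
    clear_value A
    induction xs with
    | nil => simp
    | cons e xs ih =>
      simp only [List.filter_cons, decide_eq_true_eq]
      rcases lt_trichotomy e.wt (lam i) with h | h | h
      · rw [if_neg fun h' => h.not_ge h'.1, if_neg fun h' => h.not_gt h'.1, if_neg h.ne]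
        exact ih
      · rw [if_neg fun h' : lam i < e.wt ∧ _ => h'.1.ne' h, if_pos h, List.length_cons]
        split_ifs
        · rw [List.length_cons]
          omega
        · omega
      · rw [if_neg h.ne']
        by_cases h' : e.wt < lam (i + 1)
        · rw [if_pos ⟨h.le, h'⟩, if_pos ⟨h, h'⟩, List.length_cons, List.length_cons]
          omega
        · rw [if_neg fun h'' => h' h''.2, if_neg fun h'' => h' h''.2]
          exact ih
  have h2 : (xs.filter fun e => e.wt = lam i).length ≤ 1 := by
    have hp : (xs.filter fun e => e.wt = lam i).Pairwise fun e e' => e.wt ≠ e'.wt := hx.filter _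
    have hall : ∀ e ∈ xs.filter (fun e => e.wt = lam i), e.wt = lam i := fun e he => by
      simpa using (List.mem_filter.mp he).2
    match hL : xs.filter (fun e => decide (e.wt = lam i)) with
    | [] => rw [hL]; simp
    | [_] => rw [hL]; simp
    | a :: b :: L =>
      exfalso
      rw [hL] at hp hall
      exact (List.pairwise_cons.mp hp).1 b (by simp)
        ((hall a (by simp)).trans (hall b (by simp)).symm)
  by_contra hcon
  have h3 : g ≤ A.length := by omega
  have hne : A ≠ [] := List.ne_nil_of_length_pos (by omega)
  obtain ⟨m, hm, hmax⟩ : ∃ m ∈ A, ∀ e ∈ A, e.wt ≤ m.wt :=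
    Set.exists_max_image {e | e ∈ A} Edge.wt (List.finite_toSet A) (List.exists_mem_of_ne_nil _ hne)
  have hm' : m ∈ xs ∧ lam i < m.wt ∧ m.wt < lam (i + 1) := by simpa [hA] using hm
  obtain ⟨e, he, hlo, hhi⟩ := hd (lam i) (by
      rcases hlam.mem i hi with h | h
      · rw [h]
        exact List.mem_cons_self
      · rw [hws] at h
        obtain ⟨e, he, hew⟩ := List.mem_map.mp h
        exact List.mem_cons_of_mem _ (List.mem_map.mpr ⟨e, hys e he, hew⟩))
    m.wt (List.mem_map_of_mem hm'.1) (h3.trans (by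
      refine (List.Sublist.length_le ?_)
      have : A = A.filter fun e => lam i < e.wt ∧ e.wt ≤ m.wt := by
        refine (List.filter_eq_self.mpr fun e he => ?_).symm
        have h4 : e ∈ xs ∧ lam i < e.wt ∧ e.wt < lam (i + 1) := by simpa [hA] using he
        simpa using ⟨h4.2.1, hmax e he⟩
      rw [this]
      exact (List.filter_sublist).filter _))
  obtain ⟨j, hj, hjw⟩ := hlam.exists_eq e.wt ((hws _).mpr (List.mem_map_of_mem he))
  rw [← hjw] at hlo hhi
  rcases Nat.lt_or_ge i j with hij | hij
  · exact absurd (hlam.mono (i + 1) j hij (by omega)) (not_le.mpr (hhi.trans_lt hm'.2.2))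
  · exact absurd (hlam.mono j i hij (by omega)) (not_le.mpr hlo)

end Reduce

open scoped ENNReal

/-! ### Failure probabilities of randomized computations -/

section Probability

variable {α β σ : Type}

/-- The joint law of the result and the number of steps. -/
def Rand.law (x : Rand α) : PMF (Step α) := x

/-- The probability that the computation takes more than `T` steps is at most `ε`. -/
def Rand.Fails (x : Rand α) (T : ℕ) (ε : ℝ≥0∞) : Prop :=
  x.law.toOuterMeasure {s | ¬ s.cost ≤ (T : ℕ∞)} ≤ ε

namespace Rand

theorem law_pure (a : α) : (pure a : Rand α).law = PMF.pure ⟨a, 0⟩ := rfl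

theorem law_lift (x : Step α) : (liftM x : Rand α).law = PMF.pure x := rfl

theorem law_bind (x : Rand α) (f : α → Rand β) : (x >>= f).law = x.law.bind fun s =>
    PMF.map (fun t => (⟨t.val, s.cost + t.cost⟩ : Step β)) (f s.val).law := rfl

theorem law_randUpTo (q : ℕ) : (randUpTo q).law =
    PMF.map (fun j : Fin (q + 1) => (⟨j, 1⟩ : Step ℕ)) (PMF.uniformOfFintype (Fin (q + 1))) := rfl

theorem Fails.mono {x : Rand α} {T T' : ℕ} {ε ε' : ℝ≥0∞} (h : x.Fails T ε) (hT : T ≤ T')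
    (hε : ε ≤ ε') : x.Fails T' ε' := by
  refine le_trans (MeasureTheory.measure_mono ?_) (h.trans hε)
  intro s hs hle
  exact hs (hle.trans (by exact_mod_cast hT))

theorem toOuterMeasure_le_one (p : PMF α) (A : Set α) : p.toOuterMeasure A ≤ 1 := by
  rw [PMF.toOuterMeasure_apply, ← p.tsum_coe]
  exact ENNReal.tsum_le_tsum fun a => Set.indicator_le_self _ _ _

/-- A union bound: either the first part leaves the good set `G`, or the second part fails given a
good outcome. Restricting to the support makes the deterministic properties of a sample available.
-/
theorem Fails.bind {x : Rand α} {f : α → Rand β} {T₁ T₂ : ℕ} {ε₁ ε₂ : ℝ≥0∞} (G : Set (Step α))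
    (hx : x.law.toOuterMeasure Gᶜ ≤ ε₁)
    (hf : ∀ s ∈ x.law.support, s ∈ G → s.cost ≤ (T₁ : ℕ∞) ∧ (f s.val).Fails T₂ ε₂) :
    (x >>= f).Fails (T₁ + T₂) (ε₁ + ε₂) := by
  classical
  rw [Fails, law_bind, PMF.toOuterMeasure_bind_apply]
  have h1 : ∀ s, x.law s * PMF.toOuterMeasure
      (PMF.map (fun t => (⟨t.val, s.cost + t.cost⟩ : Step β)) (f s.val).law)
      {s | ¬ s.cost ≤ ((T₁ + T₂ : ℕ) : ℕ∞)} ≤ Gᶜ.indicator x.law s + x.law s * ε₂ := by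
    intro s
    by_cases hs : s ∈ x.law.support
    · by_cases hG : s ∈ G
      · refine le_trans ?_ le_add_self
        refine mul_le_mul_right ?_ _
        obtain ⟨hc, hF⟩ := hf s hs hG
        rw [PMF.toOuterMeasure_map_apply]
        refine le_trans (MeasureTheory.measure_mono ?_) hF
        intro t ht hle
        refine ht ?_
        change s.cost + t.cost ≤ _
        push_cast
        exact add_le_add hc hle
      · refine le_trans ?_ le_self_add
        rw [Set.indicator_of_mem hG]
        calc _ ≤ x.law s * 1 := mul_le_mul_right (toOuterMeasure_le_one _ _) _
          _ = x.law s := mul_one _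
    · rw [PMF.mem_support_iff, not_not] at hs
      rw [hs, zero_mul]
      exact zero_le
  refine (ENNReal.tsum_le_tsum h1).trans ?_
  rw [ENNReal.tsum_add, ENNReal.tsum_mul_right, PMF.tsum_coe, one_mul,
    ← PMF.toOuterMeasure_apply]
  exact add_le_add hx le_rfl

theorem Fails.bind_step {x : Step α} {f : α → Rand β} {Q : α → ℕ → Prop} {T₁ T₂ : ℕ} {ε : ℝ≥0∞}
    (hx : x.Spec Q) (hf : ∀ a t, Q a t → t ≤ T₁ ∧ (f a).Fails T₂ ε) :
    ((liftM x : Rand α) >>= f).Fails (T₁ + T₂) ε := by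
  obtain ⟨t, ht, hq⟩ := hx
  rw [← zero_add ε]
  refine Fails.bind Set.univ (by simp) ?_
  intro s hs _
  have hs' : s = x := (PMF.mem_support_pure_iff x s).mp (law_lift x ▸ hs)
  subst hs'
  obtain ⟨h1, h2⟩ := hf _ t hq
  exact ⟨by rw [ht]; exact_mod_cast h1, h2⟩

theorem Fails.bind_step_le {x : Step α} {f : α → Rand β} {Q : α → ℕ → Prop} {T : ℕ} {ε : ℝ≥0∞}
    (hx : x.Spec Q) (hf : ∀ a t, Q a t → ∃ T', t + T' ≤ T ∧ (f a).Fails T' ε) :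
    ((liftM x : Rand α) >>= f).Fails T ε := by
  obtain ⟨t, ht, hq⟩ := hx
  obtain ⟨T', hT, hF⟩ := hf _ t hq
  refine (Fails.bind_step (Q := fun a u => a = x.val ∧ u = t) ⟨t, ht, rfl, rfl⟩ ?_).mono hT le_rfl
  rintro _ _ ⟨rfl, rfl⟩
  exact ⟨le_rfl, hF⟩

theorem Fails.lift {x : Step α} {Q : α → ℕ → Prop} {T : ℕ} (hx : x.Spec Q)
    (hT : ∀ a t, Q a t → t ≤ T) (ε : ℝ≥0∞) : (liftM x : Rand α).Fails T ε := by
  obtain ⟨t, ht, hq⟩ := hx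
  rw [Fails, law_lift, PMF.toOuterMeasure_pure_apply, if_neg]
  · exact zero_le
  · rw [Set.mem_ofPred_eq, not_not, ht]
    exact_mod_cast hT _ _ hq

theorem fails_pure (a : α) : (pure a : Rand α).Fails 0 0 := by
  rw [Fails, law_pure, PMF.toOuterMeasure_pure_apply, if_neg]
  simp

theorem Fails.bind_fails {x : Rand α} {f : α → Rand β} {T₁ T₂ : ℕ} {ε₁ ε₂ : ℝ≥0∞}
    (hx : x.Fails T₁ ε₁) (hf : ∀ a, (f a).Fails T₂ ε₂) : (x >>= f).Fails (T₁ + T₂) (ε₁ + ε₂) :=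
  Fails.bind {s | s.cost ≤ (T₁ : ℕ∞)} hx fun s _ hs => ⟨hs, hf s.val⟩

/-- The body must be bounded in every state, since it runs on the state left by earlier rounds. In
the recursion this state is the array of capacities, on which the bounds do not depend. -/
theorem fails_forEachRand {f : α → σ → Rand σ} {T : α → ℕ} {ε : α → ℝ≥0∞} (xs : List α)
    (hf : ∀ x ∈ xs, ∀ s, (f x s).Fails (T x) (ε x)) (s : σ) :
    (forEachRand xs s f).Fails ((xs.map T).sum + xs.length + 1) (xs.map ε).sum := by
  have htick : tick.Spec fun _ t => t ≤ 1 := ⟨1, rfl, le_rfl⟩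
  induction xs generalizing s with
  | nil =>
    rw [forEachRand]
    exact (Fails.bind_step htick fun _ t ht => ⟨ht, fails_pure s⟩).mono (by simp) zero_le
  | cons x xs ih =>
    rw [forEachRand]
    refine (Fails.bind_step htick fun _ t ht => ⟨ht, Fails.bind_fails
      (hf x List.mem_cons_self s) fun s' =>
        ih (fun y hy => hf y (List.mem_cons_of_mem _ hy)) s'⟩).mono ?_ ?_
    · simp only [List.map_cons, List.sum_cons, List.length_cons]
      omega
    · simp

theorem le_probTimeLE {x : Rand α} {T : ℕ} {ε : ℝ≥0∞} (h : x.Fails T ε) {T' : ℝ}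
    (hT : (T : ℝ) ≤ T') {δ : ℝ} (hδ : ε ≤ ENNReal.ofReal δ) (hδ0 : 0 ≤ δ) :
    1 - δ ≤ x.probTimeLE T' := by
  classical
  set A : Set (Step α) := {s | ¬ s.cost ≤ (T : ℕ∞)} with hA
  have hsum : x.law.toOuterMeasure Aᶜ + x.law.toOuterMeasure A = 1 := by
    rw [PMF.toOuterMeasure_apply, PMF.toOuterMeasure_apply, ← ENNReal.tsum_add, ← PMF.tsum_coe x.law]
    refine tsum_congr fun s => ?_
    by_cases hs : s ∈ A
    · simp [hs]
    · simp [hs]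
  have hA' : x.law.toOuterMeasure A ≤ ENNReal.ofReal δ := le_trans h hδ
  have hle : x.law.toOuterMeasure Aᶜ ≤
      x.law.toOuterMeasure {s | ∃ t : ℕ, s.cost = t ∧ (t : ℝ) ≤ T'} := by
    refine MeasureTheory.measure_mono ?_
    intro s hs
    simp only [hA, Set.mem_compl_iff, Set.mem_ofPred_eq, not_not] at hs
    obtain ⟨t, ht⟩ := ENat.ne_top_iff_exists.mp (ne_top_of_le_ne_top (ENat.natCast_ne_top T) hs)
    refine ⟨t, ht.symm, le_trans ?_ hT⟩
    rw [← ht] at hs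
    exact_mod_cast hs
  have hfin : x.law.toOuterMeasure {s | ∃ t : ℕ, s.cost = t ∧ (t : ℝ) ≤ T'} ≠ ⊤ :=
    ne_top_of_le_ne_top ENNReal.one_ne_top (toOuterMeasure_le_one _ _)
  have h1 : (1 : ℝ≥0∞) ≤ x.law.toOuterMeasure {s | ∃ t : ℕ, s.cost = t ∧ (t : ℝ) ≤ T'} +
      ENNReal.ofReal δ := by
    rw [← hsum]
    exact add_le_add hle hA'
  have h2 := ENNReal.toReal_mono (ENNReal.add_ne_top.mpr ⟨hfin, ENNReal.ofReal_ne_top⟩) h1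
  rw [ENNReal.toReal_add hfin ENNReal.ofReal_ne_top, ENNReal.toReal_ofReal hδ0,
    ENNReal.toReal_one] at h2
  have h3 : x.probTimeLE T' = (x.law.toOuterMeasure _).toReal := rfl
  linarith

end Rand

/-! ### Selection sampling -/

section Sampling

theorem toOuterMeasure_bind_val (x : Rand α) (f : α → Rand β) (A : Set β) :
    (x >>= f).law.toOuterMeasure {s | s.val ∈ A} =
      ∑' s, x.law s * (f s.val).law.toOuterMeasure {s | s.val ∈ A} := by
  rw [Rand.law_bind, PMF.toOuterMeasure_bind_apply]
  refine tsum_congr fun s => ?_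
  rw [PMF.toOuterMeasure_map_apply]
  rfl

theorem toOuterMeasure_randUpTo_bind (q : ℕ) (f : ℕ → Rand β) (A : Set β) :
    (randUpTo q >>= f).law.toOuterMeasure {s | s.val ∈ A} =
      ∑ j : Fin (q + 1), ((q + 1 : ℕ) : ℝ≥0∞)⁻¹ * (f j).law.toOuterMeasure {s | s.val ∈ A} := by
  have hbind : (randUpTo q >>= f).law = (PMF.uniformOfFintype (Fin (q + 1))).bind
      fun j => PMF.map (fun t => (⟨t.val, 1 + t.cost⟩ : Step β)) (f j).law := by
    rw [Rand.law_bind, Rand.law_randUpTo, PMF.bind_map]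
    rfl
  rw [hbind, PMF.toOuterMeasure_bind_apply, tsum_fintype]
  refine Finset.sum_congr rfl fun j _ => ?_
  rw [PMF.toOuterMeasure_map_apply, PMF.uniformOfFintype_apply, Fintype.card_fin]
  rfl

theorem sum_fin_ite_lt {q l : ℕ} (hl : l ≤ q) (a b : ℝ≥0∞) :
    ∑ j : Fin q, (if (j : ℕ) < l then a else b) = l * a + (q - l : ℕ) * b := by
  rw [Fin.sum_univ_eq_sum_range (fun j => if j < l then a else b) q,
    ← Finset.sum_range_add_sum_Ico _ hl]
  congr 1
  · rw [Finset.sum_congr rfl fun j hj => if_pos (Finset.mem_range.mp hj)]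
    simp
  · rw [Finset.sum_congr rfl fun j hj => if_neg (not_lt.mpr (Finset.mem_Ico.mp hj).1)]
    simp

/-- Only the hypergeometric bound is needed, not the full law of the sample. In the induction the
first entry is taken with probability `(l + 1) / (q + 1)`, and after multiplication by the binomial
coefficient both branches carry the coefficients of Pascal's rule. -/
theorem toOuterMeasure_sample_avoid (p : α → Bool) (xs : List α) (l : ℕ) :
    (sample xs xs.length l).law.toOuterMeasure {s | s.val ∈ {ys | ∀ y ∈ ys, p y = false}} *
      (xs.length.choose l : ℕ) ≤ ((xs.length - xs.countP p).choose l : ℕ) := by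
  induction xs generalizing l with
  | nil =>
    cases l with
    | zero => simpa using Rand.toOuterMeasure_le_one _ _
    | succ l => simp
  | cons x xs ih =>
    cases l with
    | zero => simpa using Rand.toOuterMeasure_le_one _ _
    | succ l =>
      set q := xs.length with hq
      set A : Set (List α) := {ys | ∀ y ∈ ys, p y = false} with hA
      rcases Nat.lt_or_ge q l with hlt | hle
      · rw [Nat.choose_eq_zero_of_lt (by simp only [List.length_cons]; omega)]
        simp
      rw [sample, List.length_cons, Nat.add_sub_cancel, Nat.add_sub_cancel,
        toOuterMeasure_randUpTo_bind, ← Finset.mul_sum]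
      set a := (sample xs q l >>= fun ys => pure (x :: ys)).law.toOuterMeasure
        {s | s.val ∈ A} with ha
      set b := (sample xs q (l + 1)).law.toOuterMeasure {s | s.val ∈ A} with hb
      have hsum : ∑ j : Fin (q + 1), (if (j : ℕ) < l + 1 then
          (sample xs q l >>= fun ys => pure (x :: ys)) else sample xs q (l + 1)).law.toOuterMeasure {s | s.val ∈ A} =
          (l + 1 : ℕ) * a + (q + 1 - (l + 1) : ℕ) * b := by
        rw [← sum_fin_ite_lt (by omega) a b]
        refine Finset.sum_congr rfl fun j _ => ?_
        split_ifs <;> rfl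
      rw [← hq, hsum]
      have e1 : (l + 1) * (q + 1).choose (l + 1) = (q + 1) * q.choose l := by
        rw [Nat.add_one_mul_choose_eq, mul_comm]
      have e2 : (q + 1 - (l + 1)) * (q + 1).choose (l + 1) = (q + 1) * q.choose (l + 1) := by
        rw [mul_comm, ← Nat.choose_mul_succ_eq, mul_comm]
      have hq0 : ((q + 1 : ℕ) : ℝ≥0∞) ≠ 0 := by simp
      have hqt : ((q + 1 : ℕ) : ℝ≥0∞) ≠ ⊤ := ENNReal.natCast_ne_top _
      have hmain : ((q + 1 : ℕ) : ℝ≥0∞)⁻¹ * ((l + 1 : ℕ) * a + (q + 1 - (l + 1) : ℕ) * b) *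
          ((q + 1).choose (l + 1) : ℕ) = a * (q.choose l : ℕ) + b * (q.choose (l + 1) : ℕ) := by
        have e1' : ((l + 1 : ℕ) : ℝ≥0∞) * ((q + 1).choose (l + 1) : ℕ) =
            (q + 1 : ℕ) * (q.choose l : ℕ) := by exact_mod_cast e1
        have e2' : ((q + 1 - (l + 1) : ℕ) : ℝ≥0∞) * ((q + 1).choose (l + 1) : ℕ) =
            (q + 1 : ℕ) * (q.choose (l + 1) : ℕ) := by exact_mod_cast e2
        calc _ = ((q + 1 : ℕ) : ℝ≥0∞)⁻¹ * (((l + 1 : ℕ) * ((q + 1).choose (l + 1) : ℕ)) * a +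
              ((q + 1 - (l + 1) : ℕ) * ((q + 1).choose (l + 1) : ℕ)) * b) := by ring
          _ = (((q + 1 : ℕ) : ℝ≥0∞)⁻¹ * (q + 1 : ℕ)) *
              (a * (q.choose l : ℕ) + b * (q.choose (l + 1) : ℕ)) := by
            rw [e1', e2']
            ring
          _ = _ := by rw [ENNReal.inv_mul_cancel hq0 hqt, one_mul]
      rw [hmain]
      have hcnt : xs.countP p ≤ q := List.countP_le_length
      have ha' : a = if p x = true then 0 else
          (sample xs q l).law.toOuterMeasure {s | s.val ∈ A} := by
        rw [ha, toOuterMeasure_bind_val, PMF.toOuterMeasure_apply]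
        have hp : ∀ ys : List α, (pure (x :: ys) : Rand (List α)).law.toOuterMeasure
            {s | s.val ∈ A} = if p x = true then 0 else A.indicator 1 ys := by
          classical
          intro ys
          rw [Rand.law_pure, PMF.toOuterMeasure_pure_apply]
          by_cases hx : p x = true
          · simp [hA, hx]
          · simp [hA, hx, Set.indicator_apply]
        simp only [hp]
        split_ifs with hx
        · simp
        · refine tsum_congr fun s => ?_
          by_cases hs : s.val ∈ A
          · rw [Set.indicator_of_mem hs, Set.indicator_of_mem (show s ∈ {s : Step _ | s.val ∈ A} from hs)]
            simp
          · rw [Set.indicator_of_notMem hs, Set.indicator_of_notMem (show s ∉ {s : Step _ | s.val ∈ A} from hs)]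
            simp
      rw [ha']
      by_cases hx : p x = true
      · rw [if_pos hx, zero_mul, zero_add, List.countP_cons_of_pos hx, Nat.add_sub_add_right]
        exact ih (l + 1)
      · rw [if_neg hx, List.countP_cons_of_neg hx, Nat.sub_add_comm hcnt, Nat.choose_succ_succ]
        push_cast
        exact add_le_add (ih l) (ih (l + 1))

theorem choose_mul_pow_le (q c l : ℕ) :
    (q - c).choose l * q ^ l ≤ (q - c) ^ l * q.choose l := by
  have h : (q - c).descFactorial l * q ^ l ≤ (q - c) ^ l * q.descFactorial l := by
    induction l with
    | zero => simp
    | succ l ih =>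
      rw [Nat.descFactorial_succ, Nat.descFactorial_succ, pow_succ, pow_succ]
      have h1 : (q - c - l) * q ≤ (q - c) * (q - l) := by
        rcases Nat.lt_or_ge (q - c) l with hlt | hge
        · rw [Nat.sub_eq_zero_of_le hlt.le]
          simp
        · rcases Nat.lt_or_ge q c with hqc | hqc
          · rw [Nat.sub_eq_zero_of_le hqc.le]
            simp
          · obtain ⟨d, rfl⟩ := Nat.exists_eq_add_of_le hqc
            rw [Nat.add_sub_cancel_left] at hge ⊢
            obtain ⟨e, rfl⟩ := Nat.exists_eq_add_of_le hge
            rw [Nat.add_sub_cancel_left, show c + (l + e) - l = c + e by omega]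
            nlinarith
      calc (q - c - l) * (q - c).descFactorial l * (q ^ l * q) =
          ((q - c - l) * q) * ((q - c).descFactorial l * q ^ l) := by ring
        _ ≤ ((q - c) * (q - l)) * ((q - c) ^ l * q.descFactorial l) := Nat.mul_le_mul h1 ih
        _ = _ := by ring
  rw [Nat.descFactorial_eq_factorial_mul_choose, Nat.descFactorial_eq_factorial_mul_choose] at h
  refine Nat.le_of_mul_le_mul_left ?_ (Nat.factorial_pos l)
  calc _ = l.factorial * (q - c).choose l * q ^ l := by ring
    _ ≤ _ := h
    _ = _ := by ring

/-- Sampling without replacement misses `c` given entries at most as often as `l` independent draws,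
that is, with probability at most `(1 - c/q) ^ l`. -/
theorem choose_div_choose_le {q c l : ℕ} (hq : 0 < q) (hc : c ≤ q) (hl : l ≤ q) :
    ((q - c).choose l : ℝ) / (q.choose l : ℝ) ≤ Real.exp (-(c * l / q)) := by
  have hq' : (0 : ℝ) < q := by exact_mod_cast hq
  have hch : (0 : ℝ) < q.choose l := by exact_mod_cast Nat.choose_pos hl
  have h1 : ((q - c).choose l : ℝ) * (q : ℝ) ^ l ≤ ((q : ℝ) - c) ^ l * (q.choose l : ℝ) := by
    have := choose_mul_pow_le q c l
    rw [← Nat.cast_sub hc]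
    exact_mod_cast this
  have h2 : ((q - c).choose l : ℝ) / (q.choose l : ℝ) ≤ (((q : ℝ) - c) / q) ^ l := by
    rw [div_pow, div_le_div_iff₀ hch (by positivity)]
    exact h1
  refine h2.trans ?_
  have h3 : ((q : ℝ) - c) / q ≤ Real.exp (-(c / q)) := by
    have := Real.add_one_le_exp (-((c : ℝ) / q))
    have e : ((q : ℝ) - c) / q = -((c : ℝ) / q) + 1 := by
      field_simp
      ring
    rwa [e]
  have h4 : (0 : ℝ) ≤ ((q : ℝ) - c) / q :=
    div_nonneg (sub_nonneg.mpr (by exact_mod_cast hc)) hq'.le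
  refine (pow_le_pow_left₀ h4 h3 l).trans (le_of_eq ?_)
  rw [← Real.exp_nat_mul]
  congr 1
  ring

theorem mem_support_sample {xs : List α} {l : ℕ} (hl : l ≤ xs.length) {s : Step (List α)}
    (hs : s ∈ (sample xs xs.length l).law.support) :
    s.val.Sublist xs ∧ s.val.length = l ∧ s.cost = ((xs.length + 1 : ℕ) : ℕ∞) := by
  induction xs generalizing l s with
  | nil =>
    have h : s = ⟨[], 1 + 0⟩ := by
      rw [List.length_nil, sample, Rand.law_bind, Rand.law_lift, PMF.pure_bind, Rand.law_pure,
        PMF.pure_map, PMF.mem_support_pure_iff] at hs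
      exact hs
    subst h
    simp only [List.length_nil, Nat.le_zero] at hl
    subst hl
    simp
  | cons x xs ih =>
    rw [List.length_cons, sample, Nat.add_sub_cancel, Rand.law_bind, PMF.mem_support_bind_iff] at hs
    obtain ⟨j, hj, hs⟩ := hs
    rw [PMF.mem_support_map_iff] at hs
    obtain ⟨t, ht, rfl⟩ := hs
    have hj' : j.cost = 1 ∧ j.val ≤ xs.length := by
      rw [Rand.law_randUpTo, PMF.mem_support_map_iff] at hj
      obtain ⟨i, -, rfl⟩ := hj
      exact ⟨rfl, Nat.lt_succ_iff.mp i.2⟩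
    rw [List.length_cons] at hl
    split_ifs at ht with hjl
    · rw [Rand.law_bind, PMF.mem_support_bind_iff] at ht
      obtain ⟨u, hu, ht⟩ := ht
      rw [Rand.law_pure, PMF.pure_map, PMF.mem_support_pure_iff] at ht
      subst ht
      obtain ⟨h1, h2, h3⟩ := ih (by omega) hu
      refine ⟨h1.cons_cons x, by simp only [List.length_cons]; omega, ?_⟩
      simp only [h3, hj'.1, add_zero, List.length_cons]
      push_cast
      ring
    · obtain ⟨h1, h2, h3⟩ := ih (by omega) ht
      refine ⟨h1.cons x, h2, ?_⟩
      simp only [h3, hj'.1, List.length_cons]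
      push_cast
      ring

variable {V W : Type} [LinearOrder W] [BoundedOrder W]

/-- A bound for the number of restricted edges in the instances of the levels. -/
def gapBound (k ρ q : ℕ) : ℕ := if q ≤ k then 1 else (q + ρ - 1) / ρ

/-- For `q > k`, a heavy interval has `c ≥ q/ρ` weights and is missed with probability at most `exp
(-c * k / q) ≤ exp (-ρ)`, since `k ≥ ρ²`. For `q ≤ k` every edge is sampled and the binomial
coefficient vanishes. The factor `(q + 1) ^ 2` counts the pairs of endpoints. -/
theorem toOuterMeasure_sample_not_isDense {k ρ : ℕ} (hρ : 1 ≤ ρ) (hk : ρ * ρ ≤ k)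
    (xs : List (Edge V W)) :
    (sample xs xs.length (min k xs.length)).law.toOuterMeasure
      {s | ¬ IsDense xs (gapBound k ρ xs.length) s.val} ≤
      ((xs.length + 1) ^ 2 : ℕ) * ENNReal.ofReal (Real.exp (-ρ)) := by
  classical
  set q := xs.length with hq
  set l := min k q with hl
  set μ := (sample xs q l).law.toOuterMeasure with hμ
  let I : Finset (W × W) := (⊥ :: xs.map Edge.wt).toFinset ×ˢ (xs.map Edge.wt).toFinset
  let P : W × W → Edge V W → Bool := fun z e => decide (z.1 < e.wt ∧ e.wt ≤ z.2)
  have hone : ∀ z, gapBound k ρ q ≤ (xs.filter (P z)).length →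
      μ {s | ∀ y ∈ s.val, P z y = false} ≤ ENNReal.ofReal (Real.exp (-ρ)) := by
    intro z hz
    rw [← List.countP_eq_length_filter] at hz
    set c := xs.countP (P z) with hc
    have hcq : c ≤ q := List.countP_le_length
    have hlq : l ≤ q := min_le_right _ _
    have hch : ((q.choose l : ℕ) : ℝ≥0∞) ≠ 0 := by
      exact_mod_cast (Nat.choose_pos hlq).ne'
    have hmain : μ {s | ∀ y ∈ s.val, P z y = false} ≤
        ((q - c).choose l : ℕ) / (q.choose l : ℕ) := by
      rw [ENNReal.le_div_iff_mul_le (Or.inl hch) (Or.inl (ENNReal.natCast_ne_top _))]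
      exact toOuterMeasure_sample_avoid (P z) xs l
    refine hmain.trans ?_
    by_cases hqk : q ≤ k
    · rw [gapBound, if_pos hqk] at hz
      have : (q - c).choose l = 0 := Nat.choose_eq_zero_of_lt (by omega)
      rw [this]
      simp
    · rw [gapBound, if_neg hqk] at hz
      have hq0 : 0 < q := by omega
      have hlk : l = k := by omega
      rw [← ENNReal.ofReal_natCast, ← ENNReal.ofReal_natCast,
        ← ENNReal.ofReal_div_of_pos (by exact_mod_cast Nat.choose_pos hlq)]
      refine ENNReal.ofReal_le_ofReal ((choose_div_choose_le hq0 hcq hlq).trans ?_)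
      refine Real.exp_le_exp.mpr (neg_le_neg ?_)
      rw [le_div_iff₀ (by exact_mod_cast hq0)]
      have h1 : q ≤ ρ * c := by
        have h2 := Nat.div_add_mod (q + ρ - 1) ρ
        have h3 := Nat.mod_lt (q + ρ - 1) hρ
        have h4 := Nat.mul_le_mul_left ρ hz
        omega
      have h2 : ρ * q ≤ c * l := by
        rw [hlk]
        calc ρ * q ≤ ρ * (ρ * c) := Nat.mul_le_mul_left _ h1
          _ = c * (ρ * ρ) := by ring
          _ ≤ c * k := Nat.mul_le_mul_left _ hk
      exact_mod_cast h2
  have hsub : {s : Step (List (Edge V W)) | ¬ IsDense xs (gapBound k ρ q) s.val} ⊆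
      ⋃ z ∈ I.filter fun z => gapBound k ρ q ≤ (xs.filter (P z)).length,
        {s | ∀ y ∈ s.val, P z y = false} := by
    intro s hs
    simp only [IsDense, Set.mem_ofPred_eq, not_forall] at hs
    obtain ⟨x, hx, y, hy, hg, hne⟩ := hs
    simp only [Set.mem_iUnion]
    refine ⟨(x, y), Finset.mem_filter.mpr ⟨Finset.mem_product.mpr
      ⟨List.mem_toFinset.mpr hx, List.mem_toFinset.mpr hy⟩, hg⟩, ?_⟩
    intro e he
    refine decide_eq_false fun h => hne ⟨e, he, h⟩
  refine (MeasureTheory.measure_mono hsub).trans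
    ((MeasureTheory.measure_biUnion_finset_le _ _).trans ?_)
  refine (Finset.sum_le_sum fun z hz => hone z (Finset.mem_filter.mp hz).2).trans ?_
  rw [Finset.sum_const, nsmul_eq_mul]
  refine mul_le_mul_left ?_ _
  have hI : (I.filter fun z => gapBound k ρ q ≤ (xs.filter (P z)).length).card ≤ (q + 1) ^ 2 := by
    refine (Finset.card_filter_le _ _).trans ?_
    rw [Finset.card_product, pow_two]
    have h1 := List.toFinset_card_le (⊥ :: xs.map Edge.wt)
    have h2 := List.toFinset_card_le (xs.map Edge.wt)
    simp only [List.length_cons, List.length_map, ← hq] at h1 h2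
    exact Nat.mul_le_mul h1 (by omega)
  exact_mod_cast hI

end Sampling

end Probability

/-! ### Sums over the parts of an instance -/

section Gather

variable {V W : Type}

theorem IsGather.length_le {c : ℕ} {key : V → ℕ} {vs : List V} {es : List (Edge V W)}
    {Gs : List (List V × List (Edge V W))} (h : IsGather c key vs es Gs) :
    Gs.length ≤ vs.length := by
  refine le_trans ?_ h.sum_length_le
  obtain ⟨is, -, hne, rfl⟩ := h
  rw [← sum_map_one]
  refine sum_map_le _ fun G hG => ?_
  obtain ⟨i, hi, rfl⟩ := List.mem_map.mp hG
  exact List.length_pos_iff.mpr (hne i hi).2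

theorem IsGather.sum_failure_le {c : ℕ} {key : V → ℕ} {vs : List V} {es : List (Edge V W)}
    {Gs : List (List V × List (Edge V W))} (h : IsGather c key vs es Gs) (j : ℕ) (δ : ℝ≥0∞) :
    (Gs.map fun G => ((j * G.2.length : ℕ) : ℝ≥0∞) * δ).sum ≤ ((j * es.length : ℕ) : ℝ≥0∞) * δ := by
  have h2 := h.sum_le fun _ => 1
  simp only [sum_map_one] at h2
  have h4 : (Gs.map fun G => ((j * G.2.length : ℕ) : ℝ≥0∞) * δ).sum =
      ((j * (Gs.map fun G => G.2.length).sum : ℕ) : ℝ≥0∞) * δ := by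
    clear h h2
    induction Gs with
    | nil => simp
    | cons G Gs ih =>
      simp only [List.map_cons, List.sum_cons, ih]
      push_cast
      ring
  rw [h4]
  refine mul_le_mul_left ?_ _
  exact_mod_cast Nat.mul_le_mul_left j h2

end Gather

/-! ### The budget of the recursion and the cost of sorting -/

section Recursion

variable {V W : Type} [LinearOrder W] [BoundedOrder W]

/-- A bound for the number of steps on an instance. -/
def budget (B D p : ℕ) (vs : List V) (es : List (Edge V W)) : ℕ :=
  B * (vs.length + es.length) + D * (es.length + p * (restricted es).length)

/-- For fixed coefficients the budget is linear in the sizes and hence additive over disjoint parts.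
For this reason `p` is an independent argument, to be adapted to each part afterwards by
monotonicity. -/
theorem IsGather.sum_budget_le {c : ℕ} {key : V → ℕ} {vs : List V} {es : List (Edge V W)}
    {Gs : List (List V × List (Edge V W))} (h : IsGather c key vs es Gs) (B D p : ℕ) :
    (Gs.map fun G => budget B D p G.1 G.2).sum ≤ budget B D p vs es := by
  have h1 := h.sum_length_le
  have h2 := h.sum_le fun _ => 1
  have h3 := h.sum_le fun e => if e.wt ≠ ⊤ then 1 else 0
  simp only [← restricted_length, sum_map_one] at h2 h3
  have h4 : (Gs.map fun G => budget B D p G.1 G.2).sum =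
      B * ((Gs.map fun G => G.1.length).sum + (Gs.map fun G => G.2.length).sum) +
      D * ((Gs.map fun G => G.2.length).sum + p * (Gs.map fun G => (restricted G.2).length).sum) := by
    clear h h1 h2 h3
    induction Gs with
    | nil => simp
    | cons G Gs ih =>
      simp only [List.map_cons, List.sum_cons, ih]
      rw [budget]
      ring
  rw [h4]
  exact Nat.add_le_add (Nat.mul_le_mul_left _ (Nat.add_le_add h1 h2))
    (Nat.mul_le_mul_left _ (Nat.add_le_add h2 (Nat.mul_le_mul_left _ h3)))

theorem IsGather.mem_length_le {c : ℕ} {key : V → ℕ} {vs : List V} {es : List (Edge V W)}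
    {Gs : List (List V × List (Edge V W))} (h : IsGather c key vs es Gs)
    {G : List V × List (Edge V W)} (hG : G ∈ Gs) :
    G.2.length ≤ es.length ∧ (restricted G.2).length ≤ (restricted es).length := by
  obtain ⟨is, -, -, rfl⟩ := h
  obtain ⟨i, -, rfl⟩ := List.mem_map.mp hG
  simp only [edgePart, restricted, List.length_reverse, List.filter_reverse]
  exact ⟨List.length_filter_le _ _, (List.filter_sublist.filter _).length_le⟩

/-- The number of rounds in which the sorting of the sample has still to be paid for by the
restricted edges. -/
def sortingRounds (k q : ℕ) : ℕ := if q ≤ 1 then 0 else if q ≤ k then 1 else 2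

theorem sortingRounds_mono (k : ℕ) {q q' : ℕ} (h : q ≤ q') :
    sortingRounds k q ≤ sortingRounds k q' := by
  unfold sortingRounds
  split_ifs <;> omega

/-- The strict decrease lets a termination counter of `2 * q + 2` survive a good round, which takes
up to two nested calls. -/
theorem gapBound_lt {k ρ q : ℕ} (hρ : 2 ≤ ρ) (hq : 2 ≤ q) : gapBound k ρ q + 1 ≤ q := by
  unfold gapBound
  split_ifs
  · omega
  · rw [Nat.add_one_le_iff, Nat.div_lt_iff_lt_mul (by omega)]
    obtain ⟨a, rfl⟩ := Nat.exists_eq_add_of_le hρ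
    obtain ⟨b, rfl⟩ := Nat.exists_eq_add_of_le hq
    have : (2 + b) * (2 + a) = 4 + 2 * a + 2 * b + b * a := by ring
    omega

theorem one_le_gapBound {k ρ q : ℕ} (hρ : 2 ≤ ρ) (hq : 2 ≤ q) : 1 ≤ gapBound k ρ q := by
  unfold gapBound
  split_ifs
  · omega
  · rw [Nat.le_div_iff_mul_le (by omega)]
    omega

/-- Rounding up the quotient does no harm below a power of `ρ`, so the exponent counts the remaining
rounds exactly. -/
theorem gapBound_le_pow {k ρ q j : ℕ} (hρ : 2 ≤ ρ) (hq : q ≤ ρ ^ (j + 1)) :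
    gapBound k ρ q ≤ ρ ^ j := by
  unfold gapBound
  split_ifs
  · exact Nat.one_le_pow _ _ (by omega)
  · rw [← Nat.lt_add_one_iff, Nat.div_lt_iff_lt_mul (by omega), add_one_mul, ← pow_succ]
    omega

/-- Three regimes. For `q > k * ρ` sorting costs at most `k * ρ < q`. For `k < q ≤ k * ρ` the next
instances have at most `k` restricted edges, so one of the two sorting rounds is used up. For `q ≤
k` they have at most one, and the last sorting round is used up. -/
theorem sorting_le {k ρ q : ℕ} (hρ : 2 ≤ ρ) (hclog : Nat.clog 2 k ≤ ρ) (hq : 2 ≤ q) :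
    min k q * Nat.clog 2 (min k q) + Nat.clog 2 k * (sortingRounds k (gapBound k ρ q) * q) ≤
      q + Nat.clog 2 k * (sortingRounds k q * q) := by
  set L := Nat.clog 2 k with hL
  have h1 : Nat.clog 2 (min k q) ≤ L := Nat.clog_mono_right 2 (min_le_left _ _)
  have h2 : min k q * Nat.clog 2 (min k q) ≤ min k q * L := Nat.mul_le_mul_left _ h1
  have hg := gapBound_lt (k := k) hρ hq
  have hmono := sortingRounds_mono k (Nat.le_of_succ_le hg)
  by_cases hqk : q ≤ k
  · have e1 : sortingRounds k (gapBound k ρ q) = 0 := by simp [gapBound, hqk, sortingRounds]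
    have e2 : sortingRounds k q = 1 := by
      simp only [sortingRounds, hqk, if_true]
      rw [if_neg (by omega)]
    rw [e1, e2]
    have : min k q * L ≤ q * L := Nat.mul_le_mul_right _ (min_le_right _ _)
    rw [mul_comm q L] at this
    simp only [zero_mul, mul_zero, one_mul]
    omega
  · have e2 : sortingRounds k q = 2 := by
      simp only [sortingRounds, hqk, if_false]
      rw [if_neg (by omega)]
    have e3 : min k q = k := min_eq_left (by omega)
    rw [e3] at h2 ⊢
    rw [e2] at hmono ⊢
    rcases Nat.lt_or_ge (k * ρ) q with hbig | hsmall
    · have h3 : k * L ≤ k * ρ := Nat.mul_le_mul_left _ hclog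
      have h4 := Nat.mul_le_mul_left L (Nat.mul_le_mul_right q hmono)
      omega
    · have e1 : sortingRounds k (gapBound k ρ q) ≤ 1 := by
        have : gapBound k ρ q ≤ k := by
          rw [gapBound, if_neg hqk, ← Nat.lt_add_one_iff, Nat.div_lt_iff_lt_mul (by omega),
            add_one_mul]
          omega
        unfold sortingRounds
        split_ifs <;> omega
      have h4 := Nat.mul_le_mul_left L (Nat.mul_le_mul_right q e1)
      have h5 : k * L ≤ q * L := Nat.mul_le_mul_right _ (by omega)
      have h6 : L * (2 * q) = L * (1 * q) + q * L := by ring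
      omega

end Recursion

/-! ### Induction over the rounds of sampling -/

section Solve

variable {V W : Type} [DecidableEq V] [LinearOrder W] [BoundedOrder W]

/-- The budget of the reduced instances is smaller by at least `D` for each cut edge, and this
difference pays for the superlinear part of the split. -/
theorem fails_split_reduce {vs : List V} {es : List (Edge V W)} {lam : Arr ℕ W} {l g B D : ℕ}
    {ws : List W} {ys : List (Edge V W)} {tree : List (V × Option V)}
    {rec : List V × List (Edge V W) → Arr V W → Rand (Arr V W)} {p : ℕ} {ε : ℝ≥0∞} {j : ℕ}
    (hI : IsInstance vs es) (hl : 2 ≤ l) (hlm : l ≤ es.length) (hlam : IsThresholds l ws lam)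
    (htree : IsTree (Joined es) tree) (hvs : ∀ v ∈ tree.map Prod.fst, v ∈ vs) (hne : vs ≠ [])
    (hws : ∀ w, w ∈ ws ↔ w ∈ ys.map Edge.wt) (hys : ∀ e ∈ ys, e ∈ restricted es)
    (hd : IsDense (restricted es) g ys) (hg : 1 ≤ g) (hD : 150 * Nat.clog 2 l ≤ D)
    (hrec : ∀ G : List V × List (Edge V W), IsInstance G.1 G.2 → G.1 ≠ [] →
      (restricted G.2).length ≤ g → G.2.length ≤ es.length → ∀ h,
      (rec G h).Fails (budget B D p G.1 G.2) ((j * G.2.length : ℕ) * ε)) (h : Arr V W) :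
    ((liftM (split vs es h lam l tree) : Rand (Arr V ℕ)) >>= fun level =>
      (liftM (reduce vs es h lam l level) : Rand _) >>= fun r =>
        forEachRand r.2 r.1 fun G h => rec G h).Fails
      (budget B D p vs es + 350 * (vs.length + es.length)) ((j * es.length : ℕ) * ε) := by
  refine Rand.Fails.bind_step_le (spec_split hI hlam hl htree hvs) fun level t ht => ?_
  refine ⟨budget B D p vs (reducedEdges lam level es) +
    (11 * es.length + 7 * l + 5 * vs.length + 16), ?_, ?_⟩
  · have h1 := length_reducedEdges_add_cut lam level es
    have h2 := restricted_reducedEdges_length_le lam level es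
    have h3 : budget B D p vs (reducedEdges lam level es) + D * cut level lam es ≤
        budget B D p vs es := by
      unfold budget
      rw [← h1]
      have h4 := Nat.mul_le_mul_left D (Nat.mul_le_mul_left p h2)
      have h5 := Nat.mul_le_mul_left B (show vs.length + (reducedEdges lam level es).length ≤
        vs.length + ((reducedEdges lam level es).length + cut level lam es) by omega)
      rw [Nat.mul_add D, Nat.mul_add D, Nat.mul_add D]
      omega
    have h4 := Nat.mul_le_mul_right (cut level lam es) hD
    have h5 := List.length_pos_iff.mpr hne
    omega
  · refine Rand.Fails.bind_step_le (spec_reduce vs es h lam l level) ?_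
    rintro r u ⟨hr, hu⟩
    refine ⟨budget B D p vs (reducedEdges lam level es) + vs.length + 1, by omega, ?_⟩
    refine (Rand.fails_forEachRand (T := fun G => budget B D p G.1 G.2)
      (ε := fun G => (j * G.2.length : ℕ) * ε) r.2 (fun G hG => ?_) r.1).mono ?_ ?_
    · have hlen := (hr.mem_length_le hG).1
      obtain ⟨is, -, his, hG'⟩ := hr
      rw [hG'] at hG
      obtain ⟨i, hi, rfl⟩ := List.mem_map.mp hG
      refine hrec _ ((hI.reducedEdges lam level).part level_eq_of_mem_reducedEdges i)
        (his i hi).2 ?_ ?_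
      · refine (restricted_edgePart_length_le lam level es i).trans ?_
        have hx : (restricted es).Pairwise fun e e' => e.wt ≠ e'.wt := by
          refine List.Pairwise.imp_of_mem ?_ (hI.distinct.filter _)
          intro a b ha _ hab heq
          have : a.wt ≠ ⊤ := by simpa using (List.mem_filter.mp ha).2
          exact this (hab heq)
        exact hd.length_filter_le hg hlam hws hys hx (Nat.lt_add_one_iff.mp (his i hi).1)
      · have := length_reducedEdges_add_cut lam level es
        exact hlen.trans (by omega)
    · have h1 := hr.sum_budget_le B D p
      have h2 := hr.length_le
      omega
    · refine (hr.sum_failure_le j ε).trans (mul_le_mul_left ?_ _)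
      have := length_reducedEdges_add_cut lam level es
      exact_mod_cast Nat.mul_le_mul_left j (by omega)

variable {k ρ M : ℕ}

/-- The failure probability of one round of sampling. -/
noncomputable def samplingFailure (ρ M : ℕ) : ℝ≥0∞ :=
  ((M + 1) ^ 2 : ℕ) * ENNReal.ofReal (Real.exp (-ρ))

/-- The recursion succeeds on instances with at most `q` restricted edges, up to failures of
sampling in `j` rounds. -/
def SolvedWithin (V W : Type) [DecidableEq V] [LinearOrder W] [BoundedOrder W] (k ρ M j : ℕ) :
    Prop :=
  ∀ (f : ℕ) (vs : List V) (es : List (Edge V W)) (h : Arr V W), IsInstance vs es → vs ≠ [] →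
    es.length ≤ M → (restricted es).length ≤ ρ ^ j → 2 * (restricted es).length + 2 ≤ f →
    (solve k f vs es h).Fails
      (budget (1000 * (2 * j + 2)) (150 * Nat.clog 2 k) (sortingRounds k (restricted es).length)
        vs es) ((j * es.length : ℕ) * samplingFailure ρ M)

/-- The recursive calls use the linear coefficient `1000 * (2 * j)`; the remaining `1000 *
(vs.length + es.length)` covers the linear work of this call, and the lost sorting round covers the
rest of the sorting. -/
theorem fails_solve_tree {j : ℕ} (hρ : 2 ≤ ρ) (hk : ρ * ρ ≤ k) (hclog : Nat.clog 2 k ≤ ρ)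
    {f : ℕ} {vs : List V} {es : List (Edge V W)} (h : Arr V W) (hI : IsInstance vs es)
    (hne : vs ≠ []) (hM : es.length ≤ M) (htree : ∃ tree, (components vs es).val = [tree])
    (hj : 2 ≤ (restricted es).length → ∃ i, i + 1 = j ∧ SolvedWithin V W k ρ M i)
    (hq : (restricted es).length ≤ ρ ^ j) (hf : 2 * (restricted es).length + 1 ≤ f) :
    (solve k f vs es h).Fails
      (budget (1000 * (2 * j + 1)) (150 * Nat.clog 2 k) (sortingRounds k (restricted es).length)
        vs es) ((j * es.length : ℕ) * samplingFailure ρ M) := by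
  obtain ⟨f, rfl⟩ := Nat.exists_eq_add_of_le' (show 1 ≤ f by omega)
  obtain ⟨tree, htree⟩ := htree
  have hn := List.length_pos_iff.mpr hne
  have hqm := restricted_length_le es
  set q := (restricted es).length with hqdef
  set D := 150 * Nat.clog 2 k with hD
  set T := budget (1000 * (2 * j + 1)) D (sortingRounds k q) vs es with hT
  have hT0 : 1000 * (2 * j) * (vs.length + es.length) + D * (es.length + sortingRounds k q * q) +
      1000 * (vs.length + es.length) = T := by
    rw [hT, budget]
    ring
  obtain ⟨t₁, hc₁, hF, h₁⟩ := spec_components vs es hI.mem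
  rw [htree] at hF
  rw [solve]
  refine Rand.Fails.bind_step_le (Q := fun cs t => cs = [tree] ∧ t = t₁)
    ⟨t₁, hc₁, htree, rfl⟩ ?_
  rintro _ _ ⟨rfl, rfl⟩
  refine ⟨T - (12 * vs.length + 9 * es.length + 4), by omega, ?_⟩
  dsimp only
  refine Rand.Fails.bind_step_le (spec_classify es) ?_
  rintro ⟨xs, us⟩ t₂ ⟨hxs, -, -, h₂⟩
  refine ⟨T - (12 * vs.length + 11 * es.length + 5), by omega, ?_⟩
  simp only at hxs
  subst hxs
  refine Rand.Fails.bind_step_le (Step.spec_count _) ?_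
  rintro _ t₃ ⟨rfl, h₃⟩
  rw [List.length_reverse, ← hqdef] at h₃ ⊢
  by_cases hq1 : q ≤ 1
  · refine ⟨90 * vs.length + 50 * es.length + 40, by omega, ?_⟩
    rw [if_pos hq1]
    exact Rand.Fails.lift (spec_solveBase vs es h hI.mem) (fun _ _ ht => ht) _
  rw [if_neg hq1]
  have hq2 : 2 ≤ q := by omega
  obtain ⟨i, rfl, hi⟩ := hj hq2
  have hk2 : 2 ≤ k := le_trans (by nlinarith) hk
  set l := min k q with hl
  set g := gapBound k ρ q with hg
  have hl2 : 2 ≤ l := le_min hk2 hq2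
  have hlq : l ≤ q := min_le_right _ _
  -- The cost left after the first tests: sampling, then sorting, copying the weights and the
  -- thresholds, then the split with the recursion, in which the children have at most `g`
  -- restricted edges each.
  refine ⟨(q + 1) + (4 * l * Nat.clog 2 l + 3 * q + 5 +
    (budget (1000 * (2 * i + 2)) D (sortingRounds k g) vs es + 350 * (vs.length + es.length))),
    ?_, ?_⟩
  · have h4 := sorting_le hρ hclog hq2
    rw [← hl, ← hg] at h4
    have h5 : budget (1000 * (2 * i + 2)) D (sortingRounds k g) vs es =
        1000 * (2 * (i + 1)) * (vs.length + es.length) + D * es.length +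
          150 * (Nat.clog 2 k * (sortingRounds k g * q)) := by
      rw [budget, hD, ← hqdef]
      ring
    have h6 : D * (es.length + sortingRounds k q * q) = D * es.length +
        150 * (Nat.clog 2 k * (sortingRounds k q * q)) := by
      rw [hD]
      ring
    have h7 : 4 * l * Nat.clog 2 l = 4 * (l * Nat.clog 2 l) := by ring
    rw [h5, h7]
    rw [h6] at hT0
    omega
  have hε : ((((i + 1) * es.length : ℕ)) : ℝ≥0∞) * samplingFailure ρ M =
      es.length * samplingFailure ρ M + ((i * es.length : ℕ)) * samplingFailure ρ M := by
    push_cast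
    ring
  have hlen : (restricted es).reverse.length = q := List.length_reverse
  refine Rand.Fails.mono (ε := samplingFailure ρ M + ((i * es.length : ℕ)) * samplingFailure ρ M)
    (Rand.Fails.bind {s | IsDense (restricted es).reverse g s.val} ?_ ?_) le_rfl ?_
  · have h4 := toOuterMeasure_sample_not_isDense (k := k) (ρ := ρ) (by omega) hk
      (restricted es).reverse
    rw [hlen] at h4
    refine h4.trans (mul_le_mul_left ?_ _)
    exact_mod_cast Nat.pow_le_pow_left (show q + 1 ≤ M + 1 by omega) 2
  · intro s hs hdense
    have hs' := mem_support_sample (xs := (restricted es).reverse) (l := l) (by rw [hlen]; exact hlq)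
      (by rw [hlen]; exact hs)
    rw [hlen] at hs'
    obtain ⟨hsub, hsl, hcost⟩ := hs'
    refine ⟨hcost.le, ?_⟩
    refine Rand.Fails.bind_step_le (Step.spec_forEach_foldl
      (g := fun ws (e : Edge V W) => e.wt :: ws) (c := 0) (by simp)) ?_
    rintro ws t₄ ⟨hws, h₄⟩
    have hws' : ws = (s.val.map Edge.wt).reverse := by
      rw [hws]
      clear * -
      suffices ∀ (xs : List (Edge V W)) (zs : List W),
          xs.foldl (fun ws e => e.wt :: ws) zs = (xs.map Edge.wt).reverse ++ zs by
        rw [this s.val [], List.append_nil]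
      intro xs
      induction xs with
      | nil => simp
      | cons x xs ih => simp [ih]
    have hwl : ws.length = l := by rw [hws', List.length_reverse, List.length_map, hsl]
    refine ⟨4 * l * Nat.clog 2 l + 2 * q + 4 +
      (budget (1000 * (2 * i + 2)) D (sortingRounds k g) vs es + 350 * (vs.length + es.length)),
      by omega, ?_⟩
    refine Rand.Fails.bind_step_le (spec_mergeSort (l + 1) ws (by omega)) ?_
    rintro zs t₅ ⟨hperm, hsorted, h₅⟩
    have hzl : zs.length = l := by rw [hperm.length_eq, hwl]
    rw [hwl] at h₅
    refine ⟨2 * q + 3 +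
      (budget (1000 * (2 * i + 2)) D (sortingRounds k g) vs es + 350 * (vs.length + es.length)),
      by omega, ?_⟩
    have hthr := spec_thresholds zs hsorted
    rw [hzl] at hthr
    refine Rand.Fails.bind_step_le hthr ?_
    rintro lam t₆ ⟨hlam, h₆⟩
    refine ⟨budget (1000 * (2 * i + 2)) D (sortingRounds k g) vs es +
      350 * (vs.length + es.length), by omega, fails_split_reduce (ys := s.val) hI hl2 (by omega) hlam
      (hF.tree tree (by simp)) (fun v hv => (hF.mem v).mp (by simpa using hv)) hne
      (fun w => ?_) (fun e he => ?_) (g := g) ?_ (one_le_gapBound hρ hq2)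
      (Nat.mul_le_mul_left _ (Nat.clog_mono_right 2 (min_le_left _ _))) ?_ h⟩
    · rw [hperm.mem_iff, hws', List.mem_reverse]
    · exact List.mem_reverse.mp (hsub.subset he)
    · intro x hx y hy hle
      refine hdense x ?_ y ?_ ?_
      · simpa using hx
      · simpa using hy
      · simpa [List.filter_reverse] using hle
    · intro G hG hGne hGq hGm h'
      -- The counter inside this call is at least `2 * q`, which suffices for a child with at most
      -- `q - 1` restricted edges.
      have hglt := gapBound_lt (k := k) hρ hq2
      refine (hi f G.1 G.2 h' hG hGne (hGm.trans hM) (hGq.trans (gapBound_le_pow hρ hq))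
        (by omega)).mono ?_ le_rfl
      unfold budget
      have := sortingRounds_mono k hGq
      gcongr
  · rw [hε]
    -- The one sampling failure possible in this call is charged to its edges, of which there is at
    -- least one; failures within a round thus add up to at most one per edge of the whole graph.
    refine add_le_add ?_ le_rfl
    calc samplingFailure ρ M = (1 : ℕ) * samplingFailure ρ M := by simp
      _ ≤ _ := mul_le_mul_left (by exact_mod_cast (show 1 ≤ es.length by omega)) _

/-- A disconnected graph costs one extra linear pass but no round of sampling: its parts are handled
as connected graphs with the same `j`, and only the coefficient grows from `2 * j + 1` to `2 * j +
2`. -/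
theorem fails_solve {j : ℕ} (hρ : 2 ≤ ρ) (hk : ρ * ρ ≤ k) (hclog : Nat.clog 2 k ≤ ρ)
    {f : ℕ} {vs : List V} {es : List (Edge V W)} (h : Arr V W) (hI : IsInstance vs es)
    (hne : vs ≠ []) (hM : es.length ≤ M)
    (hj : 2 ≤ (restricted es).length → ∃ i, i + 1 = j ∧ SolvedWithin V W k ρ M i)
    (hq : (restricted es).length ≤ ρ ^ j) (hf : 2 * (restricted es).length + 2 ≤ f) :
    (solve k f vs es h).Fails
      (budget (1000 * (2 * j + 2)) (150 * Nat.clog 2 k) (sortingRounds k (restricted es).length)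
        vs es) ((j * es.length : ℕ) * samplingFailure ρ M) := by
  by_cases htree : ∃ tree, (components vs es).val = [tree]
  · refine (fails_solve_tree hρ hk hclog h hI hne hM htree hj hq (by omega)).mono ?_ le_rfl
    unfold budget
    gcongr
    omega
  obtain ⟨f, rfl⟩ := Nat.exists_eq_add_of_le' (show 1 ≤ f by omega)
  set q := (restricted es).length with hqdef
  set D := 150 * Nat.clog 2 k with hD
  have hT : budget (1000 * (2 * j + 2)) D (sortingRounds k q) vs es =
      budget (1000 * (2 * j + 1)) D (sortingRounds k q) vs es +
        1000 * (vs.length + es.length) := by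
    unfold budget
    ring
  have hn := List.length_pos_iff.mpr hne
  obtain ⟨t₁, hc₁, hF, h₁⟩ := spec_components vs es hI.mem
  have hcomponents : ((liftM (componentGraphs (components vs es).val vs es) :
      Rand (List (List V × List (Edge V W)))) >>= fun Gs =>
        forEachRand Gs h fun G h => solve k f G.1 G.2 h).Fails
      (budget (1000 * (2 * j + 1)) D (sortingRounds k q) vs es +
        900 * (vs.length + es.length)) ((j * es.length : ℕ) * samplingFailure ρ M) := by
    refine Rand.Fails.bind_step_le (spec_componentGraphs hI hF) ?_
    rintro Gs t ⟨c, key, hG, hGs, ht⟩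
    refine ⟨budget (1000 * (2 * j + 1)) D (sortingRounds k q) vs es + vs.length + 1, by omega, ?_⟩
    refine (Rand.fails_forEachRand
      (T := fun G => budget (1000 * (2 * j + 1)) D (sortingRounds k q) G.1 G.2)
      (ε := fun G => (j * G.2.length : ℕ) * samplingFailure ρ M) Gs (fun G hmem h' => ?_) h).mono
      ?_ (hG.sum_failure_le j _)
    · obtain ⟨h1, h2⟩ := hG.mem_length_le hmem
      obtain ⟨hIG, hGne, hGtree⟩ := hGs G hmem
      refine (fails_solve_tree hρ hk hclog h' hIG hGne (h1.trans hM) hGtree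
        (fun h => hj (h.trans h2)) (h2.trans hq) (by omega)).mono ?_ le_rfl
      unfold budget
      have := sortingRounds_mono k h2
      gcongr
    · have h1 := hG.sum_budget_le (1000 * (2 * j + 1)) D (sortingRounds k q)
      have h2 := hG.length_le
      omega
  rw [solve]
  refine Rand.Fails.bind_step_le (Q := fun cs t => cs = (components vs es).val ∧ t = t₁)
    ⟨t₁, hc₁, rfl, rfl⟩ ?_
  rintro cs _ ⟨hcs, rfl⟩
  refine ⟨budget (1000 * (2 * j + 1)) D (sortingRounds k q) vs es +
    900 * (vs.length + es.length), by omega, ?_⟩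
  rw [← hcs] at hcomponents htree
  match cs, htree with
  | [], _ => exact hcomponents
  | [tree], htree => exact absurd ⟨tree, rfl⟩ htree
  | _ :: _ :: _, _ => exact hcomponents

theorem solvedWithin (hρ : 2 ≤ ρ) (hk : ρ * ρ ≤ k) (hclog : Nat.clog 2 k ≤ ρ) (j : ℕ) :
    SolvedWithin V W k ρ M j := by
  induction j with
  | zero =>
    intro f vs es h hI hne hM hq hf
    exact fails_solve hρ hk hclog h hI hne hM (fun h2 => by
      rw [pow_zero] at hq
      omega) hq hf
  | succ j ih =>
    intro f vs es h hI hne hM hq hf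
    exact fails_solve hρ hk hclog h hI hne hM (fun _ => ⟨j, rfl, ih⟩) hq hf

end Solve

/-! ### Choice of the parameters and the final estimates -/

section Asymptotics

theorem clog_le_sqrt {k : ℕ} (hk : 36 ≤ k) : Nat.clog 2 k ≤ Nat.sqrt k := by
  have h6 : 6 ≤ Nat.sqrt k := Nat.le_sqrt.mpr (by omega)
  have hpow : ∀ s, 6 ≤ s → (s + 1) ^ 2 ≤ 2 ^ s := by
    intro s hs
    induction s, hs using Nat.le_induction with
    | base => norm_num
    | succ s hs ih =>
      rw [pow_succ 2 s]
      nlinarith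
  refine Nat.clog_le_of_le_pow (le_trans ?_ (hpow _ h6))
  exact (Nat.lt_succ_sqrt' k).le

/-- A generous exponent that absorbs the rounding of the root; it costs only a constant factor in
the number of rounds. -/
theorem le_sqrt_pow_four {k : ℕ} (hk : 4 ≤ k) : k ≤ Nat.sqrt k ^ 4 := by
  have h2 : 2 ≤ Nat.sqrt k := Nat.le_sqrt.mpr (by omega)
  have h := Nat.lt_succ_sqrt' k
  rw [Nat.succ_eq_add_one] at h
  have h3 : Nat.sqrt k + 1 ≤ Nat.sqrt k ^ 2 := by nlinarith
  calc k ≤ (Nat.sqrt k + 1) ^ 2 := h.le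
    _ ≤ (Nat.sqrt k ^ 2) ^ 2 := Nat.pow_le_pow_left h3 2
    _ = _ := by ring

/-- The number of rounds is `J = ⌈8 log n / log k⌉`. The factor 8 arises because `√k`, rounded down,
is at least `k ^ (1/4)` and up to `n ^ 2` restricted edges have to be used up. -/
theorem exists_rounds {n k : ℕ} (hn : 1 ≤ n) (hk : 4 ≤ k) :
    ∃ J : ℕ, n ^ 2 ≤ Nat.sqrt k ^ J ∧ (J : ℝ) ≤ 8 * (Real.logb 2 n / Real.logb 2 k) + 1 := by
  set L := Real.logb 2 n with hL
  set K := Real.logb 2 k with hK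
  have hn' : (0 : ℝ) < n := by exact_mod_cast hn
  have hk' : (0 : ℝ) < k := by exact_mod_cast (show 0 < k by omega)
  have hK0 : 0 < K := Real.logb_pos (by norm_num) (by exact_mod_cast (show 1 < k by omega))
  have hL0 : 0 ≤ L := Real.logb_nonneg (by norm_num) (by exact_mod_cast hn)
  refine ⟨⌈8 * (L / K)⌉₊, ?_, (Nat.ceil_lt_add_one (by positivity)).le⟩
  set J := ⌈8 * (L / K)⌉₊ with hJ
  have h1 : 8 * L ≤ K * J := by
    have h2 : 8 * (L / K) ≤ J := Nat.le_ceil _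
    rwa [← mul_div_assoc, div_le_iff₀ hK0, mul_comm (J : ℝ)] at h2
  have h3 : (n : ℝ) ^ 8 ≤ (k : ℝ) ^ J := by
    have en : (n : ℝ) = 2 ^ L := (Real.rpow_logb (by norm_num) (by norm_num) hn').symm
    have ek : (k : ℝ) = 2 ^ K := (Real.rpow_logb (by norm_num) (by norm_num) hk').symm
    rw [en, ek, ← Real.rpow_mul_natCast (by norm_num), ← Real.rpow_mul_natCast (by norm_num)]
    refine Real.rpow_le_rpow_of_exponent_le (by norm_num) ?_
    push_cast
    linarith
  have h4 : n ^ 8 ≤ k ^ J := by exact_mod_cast h3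
  have h5 : (n ^ 2) ^ 4 ≤ (Nat.sqrt k ^ J) ^ 4 := by
    calc (n ^ 2) ^ 4 = n ^ 8 := by ring
      _ ≤ k ^ J := h4
      _ ≤ (Nat.sqrt k ^ 4) ^ J := Nat.pow_le_pow_left (le_sqrt_pow_four hk) J
      _ = _ := by rw [← pow_mul, ← pow_mul, mul_comm]
  exact (Nat.pow_le_pow_iff_left (by norm_num)).mp h5

theorem budget_le {V W : Type} [LinearOrder W] [BoundedOrder W] {vs : List V} {es : List (Edge V W)}
    {J k : ℕ} {X : ℝ} (hk : 2 ≤ k) (hX : 0 ≤ X) (hJ : (J : ℝ) ≤ 8 * X + 1)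
    (hvs : vs.length ≤ 2 * es.length) :
    (budget (1000 * (2 * J + 2)) (150 * Nat.clog 2 k) (sortingRounds k (restricted es).length)
      vs es : ℝ) ≤ 50000 * (es.length * X + es.length * Real.logb 2 k) := by
  set m := es.length with hm
  set K := Real.logb 2 k with hK
  have hK1 : 1 ≤ K := by
    rw [hK, Real.le_logb_iff_rpow_le (by norm_num) (by exact_mod_cast (show 0 < k by omega)),
      Real.rpow_one]
    exact_mod_cast hk
  have hclog : (Nat.clog 2 k : ℝ) ≤ 2 * K := by
    have h1 := Real.natCeil_logb_natCast 2 k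
    rw [Nat.cast_ofNat] at h1
    have h2 := (Nat.ceil_lt_add_one (show 0 ≤ K by linarith)).le
    rw [hK, h1] at h2
    linarith
  have hrounds : sortingRounds k (restricted es).length * (restricted es).length ≤ 2 * m := by
    refine Nat.mul_le_mul ?_ (restricted_length_le es)
    unfold sortingRounds
    split_ifs <;> omega
  have h1 : budget (1000 * (2 * J + 2)) (150 * Nat.clog 2 k)
      (sortingRounds k (restricted es).length) vs es ≤
      (1000 * (2 * J + 2)) * (3 * m) + (150 * Nat.clog 2 k) * (3 * m) := by
    unfold budget
    refine Nat.add_le_add (Nat.mul_le_mul_left _ (by omega)) (Nat.mul_le_mul_left _ (by omega))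
  have h2 : (budget (1000 * (2 * J + 2)) (150 * Nat.clog 2 k)
      (sortingRounds k (restricted es).length) vs es : ℝ) ≤
      (1000 * (2 * J + 2)) * (3 * m) + (150 * Nat.clog 2 k) * (3 * m) := by exact_mod_cast h1
  have hm0 : (0 : ℝ) ≤ m := Nat.cast_nonneg m
  have h3 := mul_le_mul_of_nonneg_right hJ hm0
  have h4 := mul_le_mul_of_nonneg_right hclog hm0
  have h5 := mul_le_mul_of_nonneg_right hK1 hm0
  have h6 := mul_nonneg hX hm0
  nlinarith

/-- The polynomial factor is at most `n * n² * (n³)² = n ^ 9`, which explains the `9 + a` in the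
requirement on `k`. -/
theorem samplingFailure_le {n m k J : ℕ} {a : ℝ} (hn : 4 ≤ n) (hm : m ≤ n * n) (hJ : J ≤ n)
    (hk : (9 + a) * Real.log n ≤ Nat.sqrt k) :
    ((J * m : ℕ) : ℝ≥0∞) * samplingFailure (Nat.sqrt k) m ≤ ENNReal.ofReal ((n : ℝ) ^ (-a)) := by
  have hn0 : (0 : ℝ) < n := by exact_mod_cast (show 0 < n by omega)
  have h1 : J * m * (m + 1) ^ 2 ≤ n ^ 9 := by
    have h2 : m + 1 ≤ n ^ 3 := by nlinarith
    calc J * m * (m + 1) ^ 2 ≤ n * (n * n) * (n ^ 3) ^ 2 := by gcongr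
      _ = n ^ 9 := by ring
  calc ((J * m : ℕ) : ℝ≥0∞) * samplingFailure (Nat.sqrt k) m =
      ((J * m * (m + 1) ^ 2 : ℕ) : ℝ≥0∞) * ENNReal.ofReal (Real.exp (-(Nat.sqrt k))) := by
        rw [samplingFailure, ← mul_assoc]
        push_cast
        rfl
    _ ≤ ((n ^ 9 : ℕ) : ℝ≥0∞) * ENNReal.ofReal (Real.exp (-(Nat.sqrt k))) :=
      mul_le_mul_left (by exact_mod_cast h1) _
    _ = ENNReal.ofReal ((n : ℝ) ^ 9 * Real.exp (-(Nat.sqrt k))) := by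
      rw [ENNReal.ofReal_mul (by positivity), ← ENNReal.ofReal_natCast]
      push_cast
      rfl
    _ ≤ _ := by
      refine ENNReal.ofReal_le_ofReal ?_
      rw [Real.rpow_def_of_pos hn0, ← Real.exp_log hn0, ← Real.exp_nat_mul, ← Real.exp_add,
        Real.exp_log hn0]
      refine Real.exp_le_exp.mpr ?_
      push_cast
      linarith

/-- With `y` proportional to `√(log n)` the lower bound on `k` reads `exp (4 * y)`, so its rounded
root is at least `exp y`. This outgrows every multiple of `y ^ 2`, hence of `log n`. -/
theorem eventually_parameter_large {c : ℝ} (hc : 0 < c) (a : ℝ) :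
    ∃ n₀ : ℕ, ∀ n : ℕ, n₀ ≤ n → ∀ k : ℕ, (2 : ℝ) ^ (c * Real.sqrt (Real.logb 2 n)) ≤ k →
      4 ≤ n ∧ 2 ^ 16 ≤ k ∧ (9 + a) * Real.log n ≤ Nat.sqrt k := by
  have hlog2 : 0 < Real.log 2 := Real.log_pos (by norm_num)
  set b := c * Real.log 2 / 4 with hb
  have hb0 : 0 < b := by positivity
  have hy : Filter.Tendsto (fun n : ℕ => b * Real.sqrt (Real.logb 2 n)) Filter.atTop Filter.atTop :=
    ((Real.tendsto_sqrt_atTop.comp (Real.tendsto_logb_atTop (by norm_num))).comp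
      tendsto_natCast_atTop_atTop).const_mul_atTop hb0
  have he := ((Real.tendsto_exp_div_pow_atTop 2).comp hy).eventually_ge_atTop
    ((9 + a) * Real.log 2 / b ^ 2)
  obtain ⟨n₀, hn₀⟩ := Filter.eventually_atTop.mp
    (he.and ((hy.eventually_ge_atTop 4).and (Filter.eventually_ge_atTop 4)))
  refine ⟨n₀, fun n hn k hk => ?_⟩
  obtain ⟨h1, h2, h3⟩ := hn₀ n hn
  simp only [Function.comp_apply] at h1
  set L := Real.logb 2 n with hL
  set y := b * Real.sqrt L with hy'
  have hL0 : 0 ≤ L := Real.logb_nonneg (by norm_num) (by exact_mod_cast (show 1 ≤ n by omega))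
  have hexp : Real.exp (4 * y) ≤ k := by
    refine le_trans (le_of_eq ?_) hk
    rw [Real.rpow_def_of_pos (by norm_num), hy', hb]
    congr 1
    ring
  have hk16 : 2 ^ 16 ≤ k := by
    have h4 : (2 : ℝ) ^ 16 ≤ Real.exp (4 * y) := by
      calc (2 : ℝ) ^ 16 ≤ Real.exp 1 ^ 16 :=
            pow_le_pow_left₀ (by norm_num) (by linarith [Real.add_one_le_exp (1 : ℝ)]) 16
        _ = Real.exp ((16 : ℕ) * 1) := (Real.exp_nat_mul 1 16).symm
        _ ≤ _ := Real.exp_le_exp.mpr (by push_cast; linarith)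
    exact_mod_cast h4.trans hexp
  refine ⟨h3, hk16, ?_⟩
  have h5 : Real.exp y ≤ Nat.sqrt k := by
    have h6 : Real.exp y ^ 4 ≤ (Nat.sqrt k : ℝ) ^ 4 := by
      rw [← Real.exp_nat_mul]
      refine le_trans (le_of_eq (by norm_num)) (hexp.trans ?_)
      exact_mod_cast le_sqrt_pow_four (by omega : 4 ≤ k)
    exact le_of_pow_le_pow_left₀ (by norm_num) (Nat.cast_nonneg _) h6
  refine le_trans ?_ h5
  have hy0 : 0 < y := by linarith
  rw [le_div_iff₀ (by positivity)] at h1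
  refine le_trans (le_of_eq ?_) h1
  have hysq : y ^ 2 = b ^ 2 * L := by rw [hy', mul_pow, Real.sq_sqrt hL0]
  have hlogn : Real.log n = L * Real.log 2 := by
    rw [hL, Real.logb, div_mul_cancel₀ _ hlog2.ne']
  rw [hysq, hlogn]
  field_simp

end Asymptotics

end Bottleneck

theorem mainTheorem2 (c : ℝ) (hc : 0 < c) :
    ∃ C : ℝ, ∀ a : ℝ, ∃ n₀ : ℕ, ∀ n : ℕ, n₀ ≤ n →
      ∀ k : ℕ, (2 : ℝ) ^ (c * Real.sqrt (Real.logb 2 n)) ≤ k →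
      ∀ (es : List (Bottleneck.Edge (Fin n) EReal)) (h : Fin n → EReal),
        (es.map fun e => (e.src, e.dst)).Nodup →
        (∀ e ∈ es, e.wt ≠ ⊥) →
        (es.Pairwise fun e e' => e.wt = e'.wt → e.wt = ⊤) →
        n ≤ 2 * es.length →
        1 - (n : ℝ) ^ (-a) ≤
          (Bottleneck.mainAlgorithm k n es h).probTimeLE
            (C * (es.length * Real.logb 2 n / Real.logb 2 k + es.length * Real.logb 2 k)) := by
  -- The constant is absolute; `c` and `a` only influence `n₀`.
  refine ⟨50000, fun a => ?_⟩
  obtain ⟨n₀, hn₀⟩ := Bottleneck.eventually_parameter_large hc a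
  refine ⟨n₀, fun n hn k hk es h hnodup hbot hdist hm => ?_⟩
  obtain ⟨hn4, hk16, hlog⟩ := hn₀ n hn k hk
  have hI : Bottleneck.IsInstance (List.finRange n) es :=
    ⟨List.nodup_finRange n, fun e _ => ⟨List.mem_finRange _, List.mem_finRange _⟩, hbot, hdist⟩
  have hmn : es.length ≤ n * n := by
    have := hnodup.length_le_card
    simpa using this
  have hq := Bottleneck.restricted_length_le es
  obtain ⟨J, hJ, hJX⟩ := Bottleneck.exists_rounds (n := n) (k := k) (by omega) (by omega)
  have hX : 0 ≤ Real.logb 2 n / Real.logb 2 k :=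
    div_nonneg (Real.logb_nonneg (by norm_num) (by exact_mod_cast (show 1 ≤ n by omega)))
      (Real.logb_nonneg (by norm_num) (by exact_mod_cast (show 1 ≤ k by omega)))
  -- For `k ≥ 2 ^ 16` the number of rounds is at most `n / 2 + 1`.
  have hJn : J ≤ n := by
    have hK : (16 : ℝ) ≤ Real.logb 2 k := by
      rw [Real.le_logb_iff_rpow_le (by norm_num) (by exact_mod_cast (show 0 < k by omega))]
      exact_mod_cast hk16
    have hL : Real.logb 2 n ≤ n := by
      rw [Real.logb_le_iff_le_rpow (by norm_num) (by exact_mod_cast (show 0 < n by omega)),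
        Real.rpow_natCast]
      exact_mod_cast Nat.lt_two_pow_self.le
    have h1 : Real.logb 2 n / Real.logb 2 k ≤ n / 16 :=
      div_le_div₀ (Nat.cast_nonneg n) hL (by norm_num) hK
    have h4 : (4 : ℝ) ≤ n := by exact_mod_cast hn4
    have h5 : (J : ℝ) ≤ n := by linarith
    exact_mod_cast h5
  have hsolved := Bottleneck.solvedWithin (V := Fin n) (W := EReal) (k := k) (ρ := Nat.sqrt k)
    (M := es.length) (Nat.le_sqrt.mpr (by omega)) (Nat.sqrt_le k)
    (Bottleneck.clog_le_sqrt (by omega)) J (2 * es.length + 3) (List.finRange n) es h hI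
    (List.ne_nil_of_length_pos (by rw [List.length_finRange]; omega)) le_rfl
    (hq.trans (hmn.trans (by rwa [← pow_two]))) (by omega)
  refine Bottleneck.Rand.le_probTimeLE hsolved ?_
    (Bottleneck.samplingFailure_le hn4 hmn hJn hlog) (by positivity)
  rw [mul_div_assoc]
  exact Bottleneck.budget_le (by omega) hX hJX (by rw [List.length_finRange]; exact hm)
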